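/- Dynamic $k$-center. Fix $k\in\mathbb N$, $k\ge 1$, reals $\Delta\ge 1$ and $\varepsilon>0$. An oblivious adversary fixes in advance a metric space $(X,d)$ and a finite sequence of updates; starting from the empty set of active points, each update inserts a point of $X$ that is currently inactive or deletes an active point. Any two distinct points that occur satisfy $1\le d(x,y)\le\Delta$. For a finite set $P$ of points, the cost of a set $S$ of centers is $\max_{p\in P}\min_{s\in S}d(p,s)$ (which is $0$ if $P=\emptyset$), and $\mathrm{OPT}$ is the minimum cost of a set of at most $k$ centers. The algorithm is a randomized program for a unit-cost random access machine. It has integer memory (addition, truncated subtraction, comparison, indirect addressing), real memory (arithmetic operations and comparison), uniform random choices from $\{0,\dots,m\}$, and a distance oracle that returns in unit time the distance of any two points inserted so far, addressed by their names, which are distinct natural numbers. Theorem. There are a program $A$ and a constant $C>0$, both independent of $k,\Delta,\varepsilon$ and of the input, such that $A$, given $k,\Delta,\varepsilon$, has the following properties for all these inputs. (i) With certainty, $A$ terminates for every update, and after each update its memory contains a solution, namely a list of the names of at most $k$ centers, all of them active points, whose cost for the current set $P$ of active points is at most $(6+\varepsilon)\,\mathrm{OPT}$, and a value $\mathsf{apx}$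 with $\mathrm{OPT}\le\mathsf{apx}\le(6+\varepsilon)\,\mathrm{OPT}$. In both upper bounds $\mathrm{OPT}$ may use all points inserted so far, including deleted ones, as centers; in the lower bound on $\mathsf{apx}$ it uses active points only. (ii) The expected amortized update time is $O(k\log\Delta\log^2 n/\varepsilon)$ for $\varepsilon\le 1$, where $n$ is the current number of active points. Precisely, if $n_t$ is the number of active points after the $t$-th update, then for each $T\ge 0$ the expected total running time of the first $T$ updates, including all initialization, is at most $$\sum_{t=1}^{T} C\,k\,(1+\log\Delta)\Bigl(1+\frac1\varepsilon\Bigr)\log^2(n_t+2).$$ -/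

import Mathlib

open scoped ENNReal

namespace DynKCenter

/-! ### The k-center problem -/

/-- The k-center cost of serving the points `P` by the centers `S`: the largest distance of a point
of `P` to its closest center (`⊤` if `P` is non-empty and `S` is empty, `0` if `P` is empty). -/
noncomputable def kCenterCost {X : Type*} [MetricSpace X] (P S : Set X) : ℝ≥0∞ :=
  ⨆ p ∈ P, Metric.infEDist p S

/-- The optimal k-center cost of `P` if the at most `k` centers are chosen among the points `Z`. -/
noncomputable def kCenterOpt {X : Type*} [MetricSpace X] (k : ℕ) (P Z : Set X) : ℝ≥0∞ :=
  ⨅ (S : Finset X) (_ : (S : Set X) ⊆ Z) (_ : S.card ≤ k), kCenterCost P S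

/-! ### Update sequences -/

/-- An update: a point is inserted or deleted. -/
inductive Update (X : Type*) where
  | insert (x : X)
  | delete (x : X)

open Classical in
/-- The set of active points after one more update. -/
noncomputable def Update.apply {X : Type*} (P : Finset X) : Update X → Finset X
  | .insert x => Insert.insert x P
  | .delete x => P.erase x

/-- The point that an update concerns. -/
def Update.point {X : Type*} : Update X → X
  | .insert x => x
  | .delete x => x

/-- The code under which the kind of the update is announced to the machine. -/
def Update.code {X : Type*} : Update X → ℕ
  | .insert _ => 0
  | .delete _ => 1

/-- The active points after a sequence of updates that starts from the empty set. -/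
noncomputable def active {X : Type*} (l : List (Update X)) : Finset X :=
  l.foldl Update.apply ∅

/-- The points inserted so far: the active ones and those that are deleted already. -/
def seen {X : Type*} (l : List (Update X)) : Set X :=
  {x | Update.insert x ∈ l}

/-- Starting from the active set `P`, only inactive points are inserted and only active ones are
deleted. -/
def ValidFrom {X : Type*} : Finset X → List (Update X) → Prop
  | _, [] => True
  | P, .insert x :: l => x ∉ P ∧ ValidFrom (Update.apply P (.insert x)) l
  | P, .delete x :: l => x ∈ P ∧ ValidFrom (Update.apply P (.delete x)) l

/-! ### The machine: a randomized unit-cost RAM with a distance oracle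

The memory consists of integer variables and integer arrays (over `ℕ`), and of real variables and
real arrays, each numbered by `ℕ`; a program mentions finitely many of them. Integer arithmetic is
limited to addition and truncated subtraction, real numbers can be added, subtracted, multiplied,
divided and compared but not rounded to integers. Every elementary operation costs one unit. -/

/-- The memory. -/
structure State where
  nvar : ℕ → ℕ
  narr : ℕ → ℕ → ℕ
  rvar : ℕ → ℝ
  rarr : ℕ → ℕ → ℝ

/-- Integer expressions; `cell a i` is the `i`-th cell of the integer array `a`. -/
inductive NExpr where
  | lit (n : ℕ)
  | var (x : ℕ)
  | cell (a : ℕ) (i : NExpr)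
  | add (e f : NExpr)
  | sub (e f : NExpr)

def NExpr.eval (s : State) : NExpr → ℕ
  | .lit n => n
  | .var x => s.nvar x
  | .cell a i => s.narr a (i.eval s)
  | .add e f => e.eval s + f.eval s
  | .sub e f => e.eval s - f.eval s

/-- The number of elementary operations of an evaluation. -/
def NExpr.cost : NExpr → ℕ
  | .lit _ => 1
  | .var _ => 1
  | .cell _ i => i.cost + 1
  | .add e f => e.cost + f.cost + 1
  | .sub e f => e.cost + f.cost + 1

/-- Real expressions; the only literals are natural numbers. -/
inductive RExpr where
  | lit (n : ℕ)
  | var (x : ℕ)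
  | cell (a : ℕ) (i : NExpr)
  | add (e f : RExpr)
  | sub (e f : RExpr)
  | mul (e f : RExpr)
  | div (e f : RExpr)

noncomputable def RExpr.eval (s : State) : RExpr → ℝ
  | .lit n => (n : ℝ)
  | .var x => s.rvar x
  | .cell a i => s.rarr a (i.eval s)
  | .add e f => e.eval s + f.eval s
  | .sub e f => e.eval s - f.eval s
  | .mul e f => e.eval s * f.eval s
  | .div e f => e.eval s / f.eval s

/-- The number of elementary operations of an evaluation. -/
def RExpr.cost : RExpr → ℕ
  | .lit _ => 1
  | .var _ => 1
  | .cell _ i => i.cost + 1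
  | .add e f => e.cost + f.cost + 1
  | .sub e f => e.cost + f.cost + 1
  | .mul e f => e.cost + f.cost + 1
  | .div e f => e.cost + f.cost + 1

/-- Tests. -/
inductive Test where
  | natEq (e f : NExpr)
  | natLt (e f : NExpr)
  | realLt (e f : RExpr)
  | not (b : Test)
  | and (b c : Test)

def Test.Holds (s : State) : Test → Prop
  | .natEq e f => e.eval s = f.eval s
  | .natLt e f => e.eval s < f.eval s
  | .realLt e f => e.eval s < f.eval s
  | .not b => ¬ b.Holds s
  | .and b c => b.Holds s ∧ c.Holds s

/-- The number of elementary operations of an evaluation. -/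
def Test.cost : Test → ℕ
  | .natEq e f => e.cost + f.cost + 1
  | .natLt e f => e.cost + f.cost + 1
  | .realLt e f => e.cost + f.cost + 1
  | .not b => b.cost + 1
  | .and b c => b.cost + c.cost + 1

/-- Programs. -/
inductive Program where
  | skip
  /-- assign to an integer variable -/
  | setN (x : ℕ) (e : NExpr)
  /-- assign to a real variable -/
  | setR (x : ℕ) (e : RExpr)
  /-- assign to the cell `i` of the integer array `a` -/
  | storeN (a : ℕ) (i e : NExpr)
  /-- assign to the cell `i` of the real array `a` -/
  | storeR (a : ℕ) (i : NExpr) (e : RExpr)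
  /-- ask for the distance of the points named `e` and `f`, put it into the real variable `x` -/
  | query (x : ℕ) (e f : NExpr)
  /-- put a uniformly random element of `{0, …, e}` into the integer variable `x` -/
  | random (x : ℕ) (e : NExpr)
  | seq (p q : Program)
  | cond (b : Test) (p q : Program)
  | loop (b : Test) (p : Program)

def State.setN (s : State) (x v : ℕ) : State :=
  { s with nvar := Function.update s.nvar x v }

noncomputable def State.setR (s : State) (x : ℕ) (v : ℝ) : State :=
  { s with rvar := Function.update s.rvar x v }

def State.storeN (s : State) (a i v : ℕ) : State :=
  { s with narr := Function.update s.narr a (Function.update (s.narr a) i v) }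

noncomputable def State.storeR (s : State) (a i : ℕ) (v : ℝ) : State :=
  { s with rarr := Function.update s.rarr a (Function.update (s.rarr a) i v) }

/-- Continue a random computation, given by the joint law of its memory and its running time so
far, by a random computation that starts from that memory; the running times add up. -/
noncomputable def andThen (μ : PMF (State × ℕ)) (ν : State → PMF (State × ℕ)) :
    PMF (State × ℕ) :=
  μ.bind fun r => (ν r.1).map fun r' => (r'.1, r.2 + r'.2)

/-- `Exec ans p s μ`: started from the memory `s`, the program `p` terminates (for all outcomes of
its random choices), and `μ` is the joint law of its final memory and its running time. Here
`ans i j d` says that the oracle answers `d` if it is asked for the distance of the points named `i`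
and `j`; a program that asks for a distance that the oracle does not know is stuck. -/
inductive Exec (ans : ℕ → ℕ → ℝ → Prop) : Program → State → PMF (State × ℕ) → Prop
  | skip (s : State) : Exec ans .skip s (PMF.pure (s, 1))
  | setN (s : State) (x : ℕ) (e : NExpr) :
      Exec ans (.setN x e) s (PMF.pure (s.setN x (e.eval s), e.cost + 1))
  | setR (s : State) (x : ℕ) (e : RExpr) :
      Exec ans (.setR x e) s (PMF.pure (s.setR x (e.eval s), e.cost + 1))
  | storeN (s : State) (a : ℕ) (i e : NExpr) :
      Exec ans (.storeN a i e) s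
        (PMF.pure (s.storeN a (i.eval s) (e.eval s), i.cost + e.cost + 1))
  | storeR (s : State) (a : ℕ) (i : NExpr) (e : RExpr) :
      Exec ans (.storeR a i e) s
        (PMF.pure (s.storeR a (i.eval s) (e.eval s), i.cost + e.cost + 1))
  | query (s : State) (x : ℕ) (e f : NExpr) (d : ℝ) (h : ans (e.eval s) (f.eval s) d) :
      Exec ans (.query x e f) s (PMF.pure (s.setR x d, e.cost + f.cost + 1))
  | random (s : State) (x : ℕ) (e : NExpr) :
      Exec ans (.random x e) s
        ((PMF.uniformOfFintype (Fin (e.eval s + 1))).map fun v => (s.setN x v, e.cost + 1))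
  | seq (s : State) (p q : Program) (μ : PMF (State × ℕ)) (ν : State → PMF (State × ℕ))
      (hp : Exec ans p s μ) (hq : ∀ r ∈ μ.support, Exec ans q r.1 (ν r.1)) :
      Exec ans (.seq p q) s (andThen μ ν)
  | condTrue (s : State) (b : Test) (p q : Program) (μ : PMF (State × ℕ))
      (hb : b.Holds s) (hp : Exec ans p s μ) :
      Exec ans (.cond b p q) s (μ.map fun r => (r.1, b.cost + r.2))
  | condFalse (s : State) (b : Test) (p q : Program) (μ : PMF (State × ℕ))
      (hb : ¬ b.Holds s) (hq : Exec ans q s μ) :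
      Exec ans (.cond b p q) s (μ.map fun r => (r.1, b.cost + r.2))
  | loopFalse (s : State) (b : Test) (p : Program) (hb : ¬ b.Holds s) :
      Exec ans (.loop b p) s (PMF.pure (s, b.cost))
  | loopTrue (s : State) (b : Test) (p : Program) (μ : PMF (State × ℕ))
      (ν : State → PMF (State × ℕ)) (hb : b.Holds s) (hp : Exec ans p s μ)
      (hl : ∀ r ∈ μ.support, Exec ans (.loop b p) r.1 (ν r.1)) :
      Exec ans (.loop b p) s ((andThen μ ν).map fun r => (r.1, b.cost + r.2))

/-! ### Dynamic algorithms -/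

/-- The initial memory: the integer variable `0` contains the number `k` of centers, the real
variables `0` and `1` contain the bound `Δ` on the distances and the accuracy `ε`, and everything
else is zero. -/
noncomputable def initial (k : ℕ) (Δ ε : ℝ) : State where
  nvar x := if x = 0 then k else 0
  narr _ _ := 0
  rvar x := if x = 0 then Δ else if x = 1 then ε else 0
  rarr _ _ := 0

/-- An update is announced by its kind in the integer variable `1` and by the name of its point in
the integer variable `2`. -/
def announce {X : Type*} (name : X → ℕ) (u : Update X) (s : State) : State :=
  (s.setN 1 u.code).setN 2 (name u.point)

/-- The distance oracle knows the points of `V`, which are addressed by their names. -/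
def oracle {X : Type*} [MetricSpace X] (name : X → ℕ) (V : Set X) (i j : ℕ) (d : ℝ) : Prop :=
  ∃ x ∈ V, ∃ y ∈ V, name x = i ∧ name y = j ∧ d = dist x y

/-- `Run A name s₀ l μ`: started from the memory `s₀`, the program `A`, which is executed once for
each update of the sequence `l` and keeps its memory in between, terminates for each update, and `μ`
is the joint law of its memory after the last update and its total running time. While it processes
an update, it can ask for distances between the points inserted so far. -/
inductive Run {X : Type*} [MetricSpace X] (A : Program) (name : X → ℕ) (s₀ : State) :
    List (Update X) → PMF (State × ℕ) → Prop
  | nil : Run A name s₀ [] (PMF.pure (s₀, 0))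
  | snoc (l : List (Update X)) (u : Update X) (μ : PMF (State × ℕ))
      (ν : State → PMF (State × ℕ)) (hl : Run A name s₀ l μ)
      (hu : ∀ r ∈ μ.support,
        Exec (oracle name (seen (l ++ [u]))) A (announce name u r.1) (ν r.1)) :
      Run A name s₀ (l ++ [u]) (andThen μ ν)

/-- The expected running time. -/
noncomputable def expectedTime (μ : PMF (State × ℕ)) : ℝ≥0∞ :=
  ∑' r : State × ℕ, μ r * (r.2 : ℝ≥0∞)

/-- The answers to the two kinds of queries can be read off the memory `s` and are correct up to the
factor `α` for the active points `P`, where `V` are all points inserted so far.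

The solution is the set `S` of the points whose names are in the cells `0, …, m - 1` of the integer
array `0`, where `m` is the content of the integer variable `3`; it consists of at most `k` active
points. The value is in the real variable `2`. Both are compared with an optimal solution that may
use active and deleted points as centers; the value is at least the cost of an optimal solution that
uses active points only. -/
def AnswersWithin {X : Type*} [MetricSpace X] (name : X → ℕ) (α : ℝ) (k : ℕ) (P V : Set X)
    (s : State) : Prop :=
  (∃ S : Finset X, (S : Set X) ⊆ P ∧ S.card ≤ k ∧ s.nvar 3 ≤ k ∧
    name '' (S : Set X) = {c | ∃ i < s.nvar 3, s.narr 0 i = c} ∧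
    kCenterCost P S ≤ ENNReal.ofReal α * kCenterOpt k P V) ∧
  0 ≤ s.rvar 2 ∧
  kCenterOpt k P P ≤ ENNReal.ofReal (s.rvar 2) ∧
  ENNReal.ofReal (s.rvar 2) ≤ ENNReal.ofReal α * kCenterOpt k P V

end DynKCenter

/-! For each of the radii 0, 1, 2, 4, ..., 2^J, where 2^J is the first power of two that is at least
Δ, the algorithm keeps a greedy sequence of at most k active centers: no center lies within the
radius of an earlier one, and the sequence stops only when the budget is spent or everything is
covered. Consider the first level without uncovered points. Its centers cost at most its radius. The
level below has k centers and an uncovered point, hence k + 1 points whose distances exceed its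
radius and are at least 1; two of them share a center in any solution, wherever its centers lie, so
OPT is at least a quarter of the radius that is output (`le_kCenterOpt`, `answersWithin_of_level`).
This holds for all outcomes of the random choices; randomness only serves the running time.

For the time, each center is kept uniformly distributed among the points that its predecessors leave
uncovered (`lawE`). An update changes the active set by one point, and the old sequence is coupled
with a new one. Let W and U be the sets that the old and the new centers revealed so far leave
uncovered. Draw a uniform element of W ∪ U. If it falls into U \ W, it becomes the next new center.
Otherwise the next old center, which is itself uniform in W, takes its place: it becomes the next
new center if it lies in U and is discarded if not. So the new center is uniform in U. If both
sequences use the same center, only U \ W has to be inspected. Otherwise all of W ∪ U may be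
inspected, but this happens with probability |W Δ U| / |W ∪ U|. A step therefore costs O(1 + |W Δ
U|) in expectation, and |W Δ U|, initially 1, is a supermartingale by double counting
(`sum_card_symmDiff_le`). A mismatch also unbalances the remaining budgets, which may cost O(|W ∪
U|) per missing center later on; this is charged in the same way. The function `potential` collects
these charges, and `lawE_adaptCost_le` yields O(k) expected work per level and update. There are O(1
+ log Δ) levels, and log²(n + 2) is at least a positive constant (`time_le`).

On the machine the clusters are linked lists, and `pour` distributes one list over others. A deleted
point stays linked until its list is poured the next time; its removal is prepaid by the potential
`garbage`. Pieces without random choices are described by `Det`, the others by `Trip`, whose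
postcondition assigns to the final memory a bound for all later costs. The induction over the
updates (`exists_run`) runs over all test functions F of the centers: the expectation of F plus the
time is at most the expectation of F under `lawE` plus O(k) per level and update. One more update is
treated by applying this to `adaptCost` of F. Thus the joint law of memory and time never has to be
described, and the levels are combined by linearity, without independence. -/

namespace DynKCenter

/-! ### Expectations -/

theorem tsum_bind_mul {α β : Type*} (μ : PMF α) (ν : α → PMF β) (f : β → ℝ≥0∞) :
    ∑' b, μ.bind ν b * f b = ∑' a, μ a * ∑' b, ν a b * f b := by
  simp_rw [PMF.bind_apply, ← ENNReal.tsum_mul_right, ← ENNReal.tsum_mul_left]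
  rw [ENNReal.tsum_comm]
  simp_rw [mul_assoc]

theorem tsum_map_mul {α β : Type*} (μ : PMF α) (g : α → β) (f : β → ℝ≥0∞) :
    ∑' b, μ.map g b * f b = ∑' a, μ a * f (g a) := by
  rw [PMF.map, tsum_bind_mul]
  simp

/-- The expectation of a function of the final memory plus the running time. -/
noncomputable def expect (μ : PMF (State × ℕ)) (Q : State → ℝ≥0∞) : ℝ≥0∞ :=
  ∑' r, μ r * (Q r.1 + r.2)

theorem expect_zero (μ : PMF (State × ℕ)) : expect μ (fun _ => 0) = expectedTime μ := by
  simp [expect, expectedTime]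

theorem expect_pure (s : State) (t : ℕ) (Q : State → ℝ≥0∞) :
    expect (PMF.pure (s, t)) Q = Q s + t := by
  simp [expect]

theorem expect_mono_support {μ : PMF (State × ℕ)} {Q Q' : State → ℝ≥0∞}
    (h : ∀ r ∈ μ.support, Q r.1 ≤ Q' r.1) : expect μ Q ≤ expect μ Q' := by
  refine ENNReal.tsum_le_tsum fun r => ?_
  by_cases hr : μ r = 0
  · simp [hr]
  · have := h r ((PMF.mem_support_iff _ _).2 hr)
    gcongr

theorem expect_map_add (μ : PMF (State × ℕ)) (c : ℕ) (Q : State → ℝ≥0∞) :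
    expect (μ.map fun r => (r.1, c + r.2)) Q = c + expect μ Q := by
  have h1 : (c : ℝ≥0∞) = ∑' r, μ r * c := by
    rw [ENNReal.tsum_mul_right, μ.tsum_coe, one_mul]
  unfold expect
  rw [tsum_map_mul]
  rw [h1, ← ENNReal.tsum_add]
  refine tsum_congr fun r => ?_
  push_cast
  ring

theorem expect_andThen (μ : PMF (State × ℕ)) (ν : State → PMF (State × ℕ)) (Q : State → ℝ≥0∞) :
    expect (andThen μ ν) Q = expect μ (fun s => expect (ν s) Q) := by
  have h : ∀ r : State × ℕ, ∑' b, ((ν r.1).map fun r' => (r'.1, r.2 + r'.2)) b * (Q b.1 + b.2) =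
      expect (ν r.1) Q + r.2 := by
    intro r
    have := expect_map_add (ν r.1) r.2 Q
    rw [expect] at this
    rw [this, add_comm]
  unfold andThen
  rw [expect, tsum_bind_mul]
  simp_rw [h]
  rfl

theorem mem_support_andThen {μ : PMF (State × ℕ)} {ν : State → PMF (State × ℕ)} {r : State × ℕ}
    (h : r ∈ (andThen μ ν).support) :
    ∃ r₁ ∈ μ.support, ∃ r₂ ∈ (ν r₁.1).support, r.1 = r₂.1 := by
  unfold andThen at h
  rw [PMF.mem_support_bind_iff] at h
  obtain ⟨r₁, h₁, h₂⟩ := h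
  rw [PMF.mem_support_map_iff] at h₂
  obtain ⟨r₂, h₂, rfl⟩ := h₂
  exact ⟨r₁, h₁, r₂, h₂, rfl⟩

theorem andThen_congr {μ : PMF (State × ℕ)} {ν ν' : State → PMF (State × ℕ)}
    (h : ∀ r ∈ μ.support, ν r.1 = ν' r.1) : andThen μ ν = andThen μ ν' := by
  unfold andThen
  ext b
  rw [PMF.bind_apply, PMF.bind_apply]
  refine tsum_congr fun r => ?_
  by_cases hr : μ r = 0
  · simp [hr]
  · rw [h r ((PMF.mem_support_iff _ _).2 hr)]

/-! ### Executions -/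

variable {ans : ℕ → ℕ → ℝ → Prop}

/-- A distance oracle gives at most one answer. -/
def Functional (ans : ℕ → ℕ → ℝ → Prop) : Prop :=
  ∀ i j d d', ans i j d → ans i j d' → d = d'

/-- The rules leave the continuation `ν` arbitrary outside the support of `μ`, so derivations are
not unique, but `andThen` only sees the support. `Trip.bind` needs that one law satisfies all cost
bounds at once. -/
theorem Exec.unique (hans : Functional ans) {p : Program} {s : State} {μ μ' : PMF (State × ℕ)}
    (h : Exec ans p s μ) (h' : Exec ans p s μ') : μ = μ' := by
  induction h generalizing μ' with
  | skip s => cases h'; rfl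
  | setN s x e => cases h'; rfl
  | setR s x e => cases h'; rfl
  | storeN s a i e => cases h'; rfl
  | storeR s a i e => cases h'; rfl
  | query s x e f d hd =>
    cases h' with
    | query _ _ _ _ d' hd' => rw [hans _ _ _ _ hd hd']
  | random s x e => cases h'; rfl
  | seq s p q μ ν hp hq ihp ihq =>
    cases h' with
    | seq _ _ _ μ₂ ν₂ hp₂ hq₂ =>
      obtain rfl := ihp hp₂
      exact andThen_congr fun r hr => ihq r hr (hq₂ r hr)
  | condTrue s b p q μ hb hp ih =>
    cases h' with
    | condTrue _ _ _ _ μ₂ _ hp₂ => rw [ih hp₂]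
    | condFalse _ _ _ _ μ₂ hb₂ _ => exact absurd hb hb₂
  | condFalse s b p q μ hb hp ih =>
    cases h' with
    | condFalse _ _ _ _ μ₂ _ hp₂ => rw [ih hp₂]
    | condTrue _ _ _ _ μ₂ hb₂ _ => exact absurd hb₂ hb
  | loopFalse s b p hb =>
    cases h' with
    | loopFalse => rfl
    | loopTrue _ _ _ _ _ hb₂ _ _ => exact absurd hb₂ hb
  | loopTrue s b p μ ν hb hp hl ihp ihl =>
    cases h' with
    | loopFalse _ _ _ hb₂ => exact absurd hb hb₂
    | loopTrue _ _ _ μ₂ ν₂ _ hp₂ hl₂ =>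
      obtain rfl := ihp hp₂
      rw [andThen_congr fun r hr => ihl r hr (hl₂ r hr)]

/-- The program `p` runs from `s` without making random choices; its final memory and its running
time satisfy `Post`. -/
def Det (ans : ℕ → ℕ → ℝ → Prop) (p : Program) (s : State) (Post : State → ℕ → Prop) : Prop :=
  ∃ s' t, Exec ans p s (PMF.pure (s', t)) ∧ Post s' t

theorem Det.mono {p : Program} {s : State} {P Q : State → ℕ → Prop} (h : Det ans p s P)
    (hPQ : ∀ s' t, P s' t → Q s' t) : Det ans p s Q := by
  obtain ⟨s', t, he, hp⟩ := h
  exact ⟨s', t, he, hPQ _ _ hp⟩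

theorem Det.skip {s : State} {Q : State → ℕ → Prop} (h : Q s 1) : Det ans .skip s Q :=
  ⟨_, _, .skip s, h⟩

theorem Det.setN {s : State} {x : ℕ} {e : NExpr} {Q : State → ℕ → Prop}
    (h : Q (s.setN x (e.eval s)) (e.cost + 1)) : Det ans (.setN x e) s Q :=
  ⟨_, _, .setN s x e, h⟩

theorem Det.setR {s : State} {x : ℕ} {e : RExpr} {Q : State → ℕ → Prop}
    (h : Q (s.setR x (e.eval s)) (e.cost + 1)) : Det ans (.setR x e) s Q :=
  ⟨_, _, .setR s x e, h⟩

theorem Det.storeN {s : State} {a : ℕ} {i e : NExpr} {Q : State → ℕ → Prop}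
    (h : Q (s.storeN a (i.eval s) (e.eval s)) (i.cost + e.cost + 1)) :
    Det ans (.storeN a i e) s Q :=
  ⟨_, _, .storeN s a i e, h⟩

theorem Det.storeR {s : State} {a : ℕ} {i : NExpr} {e : RExpr} {Q : State → ℕ → Prop}
    (h : Q (s.storeR a (i.eval s) (e.eval s)) (i.cost + e.cost + 1)) :
    Det ans (.storeR a i e) s Q :=
  ⟨_, _, .storeR s a i e, h⟩

theorem Det.query {s : State} {x : ℕ} {e f : NExpr} {d : ℝ} {Q : State → ℕ → Prop}
    (hd : ans (e.eval s) (f.eval s) d) (h : Q (s.setR x d) (e.cost + f.cost + 1)) :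
    Det ans (.query x e f) s Q :=
  ⟨_, _, .query s x e f d hd, h⟩

theorem Exec.seq_pure {p q : Program} {s s₁ s₂ : State} {t₁ t₂ : ℕ}
    (hp : Exec ans p s (PMF.pure (s₁, t₁))) (hq : Exec ans q s₁ (PMF.pure (s₂, t₂))) :
    Exec ans (.seq p q) s (PMF.pure (s₂, t₁ + t₂)) := by
  have := Exec.seq s p q _ (fun _ => PMF.pure (s₂, t₂)) hp (by
    intro r hr
    rw [PMF.support_pure, Set.mem_singleton_iff] at hr
    subst hr
    exact hq)
  simpa [andThen, PMF.pure_map] using this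

theorem Det.seq {p q : Program} {s : State} {Q : State → ℕ → Prop}
    (h : Det ans p s fun s₁ t₁ => Det ans q s₁ fun s₂ t₂ => Q s₂ (t₁ + t₂)) :
    Det ans (.seq p q) s Q := by
  obtain ⟨s₁, t₁, hp, s₂, t₂, hq, h⟩ := h
  exact ⟨s₂, t₁ + t₂, hp.seq_pure hq, h⟩

theorem Det.cond {b : Test} {p q : Program} {s : State} {Q : State → ℕ → Prop}
    (h₁ : b.Holds s → Det ans p s fun s' t => Q s' (b.cost + t))
    (h₂ : ¬ b.Holds s → Det ans q s fun s' t => Q s' (b.cost + t)) :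
    Det ans (.cond b p q) s Q := by
  by_cases hb : b.Holds s
  · obtain ⟨s', t, he, h⟩ := h₁ hb
    refine ⟨s', _, ?_, h⟩
    have := Exec.condTrue s b p q _ hb he
    rwa [PMF.pure_map] at this
  · obtain ⟨s', t, he, h⟩ := h₂ hb
    refine ⟨s', _, ?_, h⟩
    have := Exec.condFalse s b p q _ hb he
    rwa [PMF.pure_map] at this

theorem Det.loop_exit {b : Test} {p : Program} {s : State} {Q : State → ℕ → Prop}
    (hb : ¬ b.Holds s) (h : Q s b.cost) : Det ans (.loop b p) s Q :=
  ⟨s, _, .loopFalse s b p hb, h⟩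

theorem Det.loop_step {b : Test} {p : Program} {s : State} {Q : State → ℕ → Prop}
    (hb : b.Holds s)
    (h : Det ans p s fun s₁ t₁ => Det ans (.loop b p) s₁ fun s₂ t₂ => Q s₂ (b.cost + (t₁ + t₂))) :
    Det ans (.loop b p) s Q := by
  obtain ⟨s₁, t₁, hp, s₂, t₂, hq, h⟩ := h
  refine ⟨s₂, _, ?_, h⟩
  have := Exec.loopTrue s b p _ (fun _ => PMF.pure (s₂, t₂)) hb hp (by
    intro r hr
    rw [PMF.support_pure, Set.mem_singleton_iff] at hr
    subst hr
    exact hq)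
  simpa [andThen, PMF.pure_map] using this

/-- The best bound that `R` allows for the memory `s`. -/
noncomputable def bestBound (R : State → ℝ≥0∞ → Prop) (s : State) : ℝ≥0∞ :=
  ⨅ (b : ℝ≥0∞) (_ : R s b), b

theorem bestBound_le {R : State → ℝ≥0∞ → Prop} {s : State} {b : ℝ≥0∞} (h : R s b) :
    bestBound R s ≤ b :=
  iInf₂_le b h

theorem le_bestBound {R : State → ℝ≥0∞ → Prop} {s : State} {c : ℝ≥0∞} (h : ∀ b, R s b → c ≤ b) :
    c ≤ bestBound R s :=
  le_iInf₂ h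

/-- The program `p` terminates from `s`, the relation `R` admits a bound for each possible final
memory, and the expectation of the bound plus the running time is at most `B`. -/
def Trip (ans : ℕ → ℕ → ℝ → Prop) (p : Program) (s : State) (R : State → ℝ≥0∞ → Prop)
    (B : ℝ≥0∞) : Prop :=
  ∃ μ, Exec ans p s μ ∧ (∀ r ∈ μ.support, ∃ b, R r.1 b) ∧ expect μ (bestBound R) ≤ B

theorem Trip.of_det {p : Program} {s : State} {R : State → ℝ≥0∞ → Prop} {B : ℝ≥0∞}
    (h : Det ans p s fun s' t => ∃ b, R s' b ∧ b + t ≤ B) : Trip ans p s R B := by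
  obtain ⟨s', t, he, b, hb, hB⟩ := h
  refine ⟨_, he, ?_, ?_⟩
  · intro r hr
    rw [PMF.support_pure, Set.mem_singleton_iff] at hr
    subst hr
    exact ⟨b, hb⟩
  · rw [expect_pure]
    refine le_trans ?_ hB
    gcongr
    exact bestBound_le hb

theorem Trip.mono {p : Program} {s : State} {R R' : State → ℝ≥0∞ → Prop} {B B' : ℝ≥0∞}
    (h : Trip ans p s R B) (hB : B ≤ B') (hR : ∀ s' b, R s' b → ∃ b' ≤ b, R' s' b') :
    Trip ans p s R' B' := by
  obtain ⟨μ, he, hs, hE⟩ := h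
  refine ⟨μ, he, ?_, (expect_mono_support ?_).trans (hE.trans hB)⟩
  · intro r hr
    obtain ⟨b, hb⟩ := hs r hr
    obtain ⟨b', -, hb'⟩ := hR _ _ hb
    exact ⟨b', hb'⟩
  · intro r _
    refine le_bestBound fun b hb => ?_
    obtain ⟨b', hle, hb'⟩ := hR _ _ hb
    exact (bestBound_le hb').trans hle

/-- This is the tower property of expectations. The expectation contains the infimum `bestBound` of
all bounds that `R` admits, so the law chosen for a memory has to obey each of them; by uniqueness
of executions the law obtained for one bound is the law obtained for any other. The map `g` makes
room for the announcement of an update. -/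
theorem Trip.bind (hans : Functional ans) {q : Program} {g : State → State} {μ : PMF (State × ℕ)}
    {R R' : State → ℝ≥0∞ → Prop} {B : ℝ≥0∞}
    (hs : ∀ r ∈ μ.support, ∃ b, R r.1 b) (hE : expect μ (bestBound R) ≤ B)
    (h : ∀ s' b, R s' b → Trip ans q (g s') R' b) :
    ∃ ν : State → PMF (State × ℕ), (∀ r ∈ μ.support, Exec ans q (g r.1) (ν r.1)) ∧
      (∀ r ∈ (andThen μ ν).support, ∃ b, R' r.1 b) ∧
      expect (andThen μ ν) (bestBound R') ≤ B := by
  have key : ∀ s' : State, ∃ ν, (∃ b, R s' b) →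
      Exec ans q (g s') ν ∧ (∀ r ∈ ν.support, ∃ b, R' r.1 b) ∧
        expect ν (bestBound R') ≤ bestBound R s' := by
    intro s'
    by_cases hb : ∃ b, R s' b
    · obtain ⟨b, hb⟩ := hb
      obtain ⟨ν, hν, hν', -⟩ := h s' b hb
      refine ⟨ν, fun _ => ⟨hν, hν', le_bestBound fun b' hb' => ?_⟩⟩
      obtain ⟨ν₂, hν₂, -, hE₂⟩ := h s' b' hb'
      rwa [hν.unique hans hν₂]
    -- Such memories do not occur, so any law will do.
    · exact ⟨PMF.pure (s', 0), fun h => absurd h hb⟩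
  choose ν hν using key
  refine ⟨ν, fun r hr => (hν r.1 (hs r hr)).1, ?_, ?_⟩
  · intro r hr
    obtain ⟨r₁, h₁, r₂, h₂, e⟩ := mem_support_andThen hr
    rw [e]
    exact (hν r₁.1 (hs r₁ h₁)).2.1 r₂ h₂
  · rw [expect_andThen]
    exact (expect_mono_support fun r hr => (hν r.1 (hs r hr)).2.2).trans hE

theorem Trip.seq (hans : Functional ans) {p q : Program} {s : State}
    {R R' : State → ℝ≥0∞ → Prop} {B : ℝ≥0∞} (hp : Trip ans p s R B)
    (hq : ∀ s' b, R s' b → Trip ans q s' R' b) : Trip ans (.seq p q) s R' B := by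
  obtain ⟨μ, he, hs, hE⟩ := hp
  obtain ⟨ν, h₁, h₂, h₃⟩ := Trip.bind (g := fun s => s) hans hs hE hq
  exact ⟨_, .seq s p q μ ν he h₁, h₂, h₃⟩

theorem mem_support_map_add {μ : PMF (State × ℕ)} {c : ℕ} {r : State × ℕ}
    (h : r ∈ (μ.map fun r => (r.1, c + r.2)).support) : ∃ r' ∈ μ.support, r.1 = r'.1 := by
  rw [PMF.mem_support_map_iff] at h
  obtain ⟨r', h, rfl⟩ := h
  exact ⟨r', h, rfl⟩

theorem Trip.cond {b : Test} {p q : Program} {s : State} {R : State → ℝ≥0∞ → Prop} {B B' : ℝ≥0∞}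
    (hB : b.cost + B' ≤ B) (h₁ : b.Holds s → Trip ans p s R B')
    (h₂ : ¬ b.Holds s → Trip ans q s R B') : Trip ans (.cond b p q) s R B := by
  by_cases hb : b.Holds s
  · obtain ⟨μ, he, hs, hE⟩ := h₁ hb
    refine ⟨_, .condTrue s b p q μ hb he, ?_, ?_⟩
    · intro r hr
      obtain ⟨r', hr', e⟩ := mem_support_map_add hr
      rw [e]
      exact hs r' hr'
    · rw [expect_map_add]
      exact le_trans (by gcongr) hB
  · obtain ⟨μ, he, hs, hE⟩ := h₂ hb
    refine ⟨_, .condFalse s b p q μ hb he, ?_, ?_⟩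
    · intro r hr
      obtain ⟨r', hr', e⟩ := mem_support_map_add hr
      rw [e]
      exact hs r' hr'
    · rw [expect_map_add]
      exact le_trans (by gcongr) hB

theorem Trip.loop_exit {b : Test} {p : Program} {s : State} {R : State → ℝ≥0∞ → Prop}
    {B B' : ℝ≥0∞} (hb : ¬ b.Holds s) (hR : R s B') (hB : b.cost + B' ≤ B) :
    Trip ans (.loop b p) s R B :=
  .of_det (.loop_exit hb ⟨B', hR, by rwa [add_comm]⟩)

theorem Trip.loop_step (hans : Functional ans) {b : Test} {p : Program} {s : State}
    {R R' : State → ℝ≥0∞ → Prop} {B B' : ℝ≥0∞} (hb : b.Holds s) (hB : b.cost + B' ≤ B)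
    (hp : Trip ans p s R B') (hl : ∀ s' b', R s' b' → Trip ans (.loop b p) s' R' b') :
    Trip ans (.loop b p) s R' B := by
  obtain ⟨μ, he, hs, hE⟩ := hp
  obtain ⟨ν, h₁, h₂, h₃⟩ := Trip.bind (g := fun s => s) hans hs hE hl
  refine ⟨_, .loopTrue s b p μ ν hb he h₁, ?_, ?_⟩
  · intro r hr
    obtain ⟨r', hr', e⟩ := mem_support_map_add hr
    rw [e]
    exact h₂ r' hr'
  · rw [expect_map_add]
    exact le_trans (by gcongr) hB

theorem Trip.random {s : State} {x : ℕ} {e : NExpr} {R : State → ℝ≥0∞ → Prop} {B : ℝ≥0∞}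
    (b : ℕ → ℝ≥0∞) (hR : ∀ v ≤ e.eval s, R (s.setN x v) (b v))
    (hB : (∑ v ∈ Finset.range (e.eval s + 1), b v) / (e.eval s + 1 : ℕ) + (e.cost + 1 : ℕ) ≤ B) :
    Trip ans (.random x e) s R B := by
  have key : ∃ μ : PMF ℕ, μ = PMF.map (α := Fin (e.eval s + 1)) (fun v => (v : ℕ))
        (PMF.uniformOfFintype (Fin (e.eval s + 1))) ∧
      Exec ans (.random x e) s (μ.map fun v => (s.setN x v, e.cost + 1)) :=
    ⟨_, rfl, .random s x e⟩
  obtain ⟨μ, rfl, he⟩ := key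
  refine ⟨_, he, ?_, ?_⟩
  · intro r hr
    rw [PMF.map_comp, PMF.mem_support_map_iff] at hr
    obtain ⟨v, -, rfl⟩ := hr
    exact ⟨b v, hR v (Nat.lt_succ_iff.1 v.2)⟩
  · refine le_trans ?_ hB
    unfold expect
    rw [PMF.map_comp, tsum_map_mul, tsum_fintype]
    have hle : ∀ v : Fin (e.eval s + 1), PMF.uniformOfFintype (Fin (e.eval s + 1)) v *
        (bestBound R (s.setN x v) + (e.cost + 1 : ℕ)) ≤
        ((e.eval s + 1 : ℕ) : ℝ≥0∞)⁻¹ * (b v + (e.cost + 1 : ℕ)) := by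
      intro v
      rw [PMF.uniformOfFintype_apply, Fintype.card_fin]
      gcongr
      exact bestBound_le (hR v (Nat.lt_succ_iff.1 v.2))
    refine (Finset.sum_le_sum fun v _ => hle v).trans ?_
    rw [← Finset.mul_sum, Finset.sum_add_distrib, mul_add, Finset.sum_const, Finset.card_univ,
      Fintype.card_fin, nsmul_eq_mul, ← mul_assoc, ENNReal.inv_mul_cancel (by simp) (by simp),
      one_mul, Finset.sum_range, mul_comm, div_eq_mul_inv]

end DynKCenter

namespace DynKCenter

/-! ### The law of the random greedy centers -/

section Law
open Classical

variable {adj : ℕ → ℕ → Prop}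

/-- The elements of `W` that `p` does not cover. -/
noncomputable def uncov (adj : ℕ → ℕ → Prop) (W : Finset ℕ) (p : ℕ) : Finset ℕ :=
  W.filter fun y => ¬ adj p y

theorem mem_uncov {W : Finset ℕ} {p y : ℕ} : y ∈ uncov adj W p ↔ y ∈ W ∧ ¬ adj p y := by
  simp [uncov]

theorem uncov_subset {W : Finset ℕ} {p : ℕ} : uncov adj W p ⊆ W :=
  Finset.filter_subset _ _

@[simp] theorem uncov_empty {p : ℕ} : uncov adj ∅ p = ∅ := by simp [uncov]

/-- The expectation of `F` at a random sequence of at most `b` centers for `W`: each center is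
uniformly distributed among the elements that are not covered by its predecessors. -/
noncomputable def lawE (adj : ℕ → ℕ → Prop) :
    ℕ → Finset ℕ → (List ℕ → ℝ≥0∞) → ℝ≥0∞
  | 0, _, F => F []
  | b + 1, W, F =>
    if W = ∅ then F [] else (∑ p ∈ W, lawE adj b (uncov adj W p) fun l => F (p :: l)) / W.card

theorem lawE_empty (b : ℕ) (F : List ℕ → ℝ≥0∞) : lawE adj b ∅ F = F [] := by
  cases b <;> simp [lawE]

theorem lawE_succ {b : ℕ} {W : Finset ℕ} (hW : W.Nonempty) (F : List ℕ → ℝ≥0∞) :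
    lawE adj (b + 1) W F =
      (∑ p ∈ W, lawE adj b (uncov adj W p) fun l => F (p :: l)) / W.card := by
  rw [lawE, if_neg hW.ne_empty]

/-- Multiplying by the cardinality gives a recursion that also holds for empty `W`, where both sides
vanish, and that avoids division. -/
theorem card_mul_lawE (b : ℕ) (W : Finset ℕ) (F : List ℕ → ℝ≥0∞) :
    W.card * lawE adj (b + 1) W F =
      ∑ p ∈ W, lawE adj b (uncov adj W p) fun l => F (p :: l) := by
  rcases W.eq_empty_or_nonempty with rfl | hW
  · simp
  · rw [lawE_succ hW, ENNReal.mul_div_cancel (by simpa using hW.ne_empty) (by simp)]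

theorem lawE_add (b : ℕ) (W : Finset ℕ) (F F' : List ℕ → ℝ≥0∞) :
    lawE adj b W (fun l => F l + F' l) = lawE adj b W F + lawE adj b W F' := by
  induction b generalizing W F F' with
  | zero => rfl
  | succ b ih =>
    rcases W.eq_empty_or_nonempty with rfl | hW
    · simp [lawE]
    · rw [lawE_succ hW, lawE_succ hW, lawE_succ hW, ← ENNReal.add_div, ← Finset.sum_add_distrib]
      simp_rw [ih]

theorem lawE_const_mul (b : ℕ) (W : Finset ℕ) (c : ℝ≥0∞) (F : List ℕ → ℝ≥0∞) :
    lawE adj b W (fun l => c * F l) = c * lawE adj b W F := by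
  induction b generalizing W F with
  | zero => rfl
  | succ b ih =>
    rcases W.eq_empty_or_nonempty with rfl | hW
    · simp [lawE]
    · rw [lawE_succ hW, lawE_succ hW]
      simp_rw [ih]
      rw [← Finset.mul_sum, mul_div_assoc]

theorem lawE_div (b : ℕ) (W : Finset ℕ) (c : ℝ≥0∞) (F : List ℕ → ℝ≥0∞) :
    lawE adj b W (fun l => F l / c) = lawE adj b W F / c := by
  simp_rw [div_eq_mul_inv, mul_comm _ c⁻¹]
  exact lawE_const_mul _ _ _ _

theorem lawE_const (b : ℕ) (W : Finset ℕ) (c : ℝ≥0∞) : lawE adj b W (fun _ => c) = c := by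
  induction b generalizing W with
  | zero => rfl
  | succ b ih =>
    rcases W.eq_empty_or_nonempty with rfl | hW
    · simp [lawE]
    · rw [lawE_succ hW]
      simp_rw [ih]
      rw [Finset.sum_const, nsmul_eq_mul, mul_comm,
        ENNReal.mul_div_cancel_right (by simpa using hW.ne_empty) (by simp)]

theorem lawE_sum {ι : Type*} (b : ℕ) (W : Finset ℕ) (S : Finset ι) (F : ι → List ℕ → ℝ≥0∞) :
    lawE adj b W (fun l => ∑ i ∈ S, F i l) = ∑ i ∈ S, lawE adj b W (F i) := by
  induction S using Finset.induction_on with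
  | empty => simpa using lawE_const b W 0
  | insert i S hi ih =>
    simp_rw [Finset.sum_insert hi]
    rw [lawE_add, ih]

/-! ### The cost of adapting a greedy sequence -/

/-- A bound for the cost of completing a greedy sequence for `U` by `a` more centers without the
help of an old sequence, and then evaluating `F`. -/
noncomputable def freshCost (adj : ℕ → ℕ → Prop) (K : ℕ) :
    ℕ → Finset ℕ → (List ℕ → ℝ≥0∞) → ℝ≥0∞
  | 0, U, F => F [] + (K * (1 + U.card) : ℕ)
  | a + 1, U, F =>
    if U = ∅ then F [] + K
    else (∑ f ∈ U, ((K * U.card : ℕ) + freshCost adj K a (uncov adj U f) fun l => F (f :: l))) /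
      U.card

/-- A bound for the cost of completing a greedy sequence for `U` by `a` more centers, starting from
an old greedy sequence for `W`, and then evaluating `F`. -/
noncomputable def adaptCost (adj : ℕ → ℕ → Prop) (K : ℕ) :
    List ℕ → ℕ → Finset ℕ → Finset ℕ → (List ℕ → ℝ≥0∞) → ℝ≥0∞
  | [], 0, W, U, F => F [] + (K * (1 + (U \ W).card) : ℕ)
  -- The old sequence is used up. What it left uncovered in `W` is freed at once, and the remaining
  -- centers are drawn afresh.
  | [], a + 1, W, U, F =>
    if W = ∅ then freshCost adj K (a + 1) U F
    else (K * (1 + (W ∪ U).card) : ℕ) + freshCost adj K (a + 1) U F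
  | _ :: _, 0, W, U, F => F [] + (K * (1 + (W ∪ U).card) : ℕ)
  -- One draw from `W ∪ U`: each element of `U \ W` has weight one, and the whole weight of `W` goes
  -- to the next old center `c`. That `c` is uniform in `W` enters only when this is averaged over
  -- the old sequence.
  | c :: cs, a + 1, W, U, F =>
    (∑ f ∈ U \ W, ((K * (W ∪ U).card : ℕ) +
        adaptCost adj K (c :: cs) a W (uncov adj U f) fun l => F (f :: l)) +
      W.card * if c ∈ U
        then (K * (1 + (U \ W).card) : ℕ) +
          adaptCost adj K cs a (uncov adj W c) (uncov adj U c) fun l => F (c :: l)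
        else (K * (W ∪ U).card : ℕ) + adaptCost adj K cs (a + 1) (uncov adj W c) U F) /
      (W ∪ U).card
  termination_by cs a => (cs.length, a)

/-- The potential. -/
def potential (K a b d n : ℕ) : ℕ :=
  7 * K * ((a + b + 1) * d) + 5 * K * (((a - b) + (b - a)) * n) + K * (a + b + 1)

/-- The fresh draws have the law `lawE` by definition, and each of the at most `a` rounds as well as
the end costs at most `K * U.card`, up to one additional `K`. -/
theorem freshCost_le (K a : ℕ) (U : Finset ℕ) (F : List ℕ → ℝ≥0∞) :
    freshCost adj K a U F ≤ lawE adj a U F + (K * (1 + (a + 1) * U.card) : ℕ) := by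
  induction a generalizing U F with
  | zero => simp [freshCost, lawE]
  | succ a ih =>
    rcases U.eq_empty_or_nonempty with rfl | hU
    · simp [freshCost, lawE]
    · rw [freshCost, if_neg hU.ne_empty]
      have hc : (U.card : ℝ≥0∞) ≠ 0 := by simpa using hU.ne_empty
      rw [ENNReal.div_le_iff_le_mul (.inl hc) (.inl (by simp)), add_mul, mul_comm _ (U.card : ℝ≥0∞),
        card_mul_lawE]
      calc _ ≤ ∑ f ∈ U, ((K * U.card : ℕ) +
            (lawE adj a (uncov adj U f) (fun l => F (f :: l)) +
              (K * (1 + (a + 1) * U.card) : ℕ))) := by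
            gcongr with f hf
            refine (ih _ _).trans ?_
            have := Finset.card_le_card (uncov_subset (adj := adj) (W := U) (p := f))
            gcongr
        _ = ∑ f ∈ U, lawE adj a (uncov adj U f) (fun l => F (f :: l)) +
            (U.card * (K * U.card + K * (1 + (a + 1) * U.card)) : ℕ) := by
            simp_rw [Finset.sum_add_distrib, Finset.sum_const, nsmul_eq_mul]
            push_cast
            ring
        _ ≤ _ := by
            gcongr
            rw [← Nat.cast_mul, Nat.cast_le]
            exact le_of_eq (by ring)

/-- A common center removes its neighbours in `W Δ U`. A center that only one of the sets contains
can at worst move its neighbours in `W ∩ U` into the symmetric difference. The other two cases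
change nothing. -/
theorem card_symmDiff_step {W U : Finset ℕ} {p : ℕ} :
    (symmDiff (if p ∈ W then uncov adj W p else W) (if p ∈ U then uncov adj U p else U)).card +
      (if p ∈ W ∩ U then ((symmDiff W U).filter fun y => adj p y).card else 0) ≤
    (symmDiff W U).card +
      (if p ∈ symmDiff W U then ((W ∩ U).filter fun y => adj p y).card else 0) := by
  by_cases hW : p ∈ W <;> by_cases hU : p ∈ U
  · have h1 : symmDiff (uncov adj W p) (uncov adj U p) =
        (symmDiff W U).filter fun y => ¬ adj p y := by
      ext y
      simp only [Finset.mem_symmDiff, mem_uncov, Finset.mem_filter]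
      tauto
    have h2 : p ∉ symmDiff W U := by simp [Finset.mem_symmDiff, hW, hU]
    rw [if_pos hW, if_pos hU, if_pos (Finset.mem_inter.2 ⟨hW, hU⟩), if_neg h2, h1, add_comm,
      Finset.card_filter_add_card_filter_not, add_zero]
  · have h1 : symmDiff (uncov adj W p) U ⊆ symmDiff W U ∪ (W ∩ U).filter fun y => adj p y := by
      intro y
      simp only [Finset.mem_symmDiff, mem_uncov, Finset.mem_filter, Finset.mem_union,
        Finset.mem_inter]
      tauto
    have h2 : p ∈ symmDiff W U := by simp [Finset.mem_symmDiff, hW, hU]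
    rw [if_pos hW, if_neg hU, if_neg (by simp [hU]), if_pos h2, add_zero]
    exact (Finset.card_le_card h1).trans (Finset.card_union_le _ _)
  · have h1 : symmDiff W (uncov adj U p) ⊆ symmDiff W U ∪ (W ∩ U).filter fun y => adj p y := by
      intro y
      simp only [Finset.mem_symmDiff, mem_uncov, Finset.mem_filter, Finset.mem_union,
        Finset.mem_inter]
      tauto
    have h2 : p ∈ symmDiff W U := by simp [Finset.mem_symmDiff, hW, hU]
    rw [if_neg hW, if_pos hU, if_neg (by simp [hW]), if_pos h2, add_zero]
    exact (Finset.card_le_card h1).trans (Finset.card_union_le _ _)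
  · have h2 : p ∉ symmDiff W U := by simp [Finset.mem_symmDiff, hW, hU]
    rw [if_neg hW, if_neg hU, if_neg (by simp [hW]), if_neg h2]

/-- The symmetric difference of the uncovered sets is a supermartingale. -/
theorem sum_card_symmDiff_le (hs : ∀ p q, adj p q → adj q p)
    (W U : Finset ℕ) :
    ∑ p ∈ W ∪ U, (symmDiff (if p ∈ W then uncov adj W p else W)
      (if p ∈ U then uncov adj U p else U)).card ≤ (W ∪ U).card * (symmDiff W U).card := by
  have h := Finset.sum_le_sum fun p (_ : p ∈ W ∪ U) =>
    card_symmDiff_step (adj := adj) (W := W) (U := U) (p := p)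
  rw [Finset.sum_add_distrib, Finset.sum_add_distrib, Finset.sum_const, smul_eq_mul] at h
  have e1 : ∑ p ∈ W ∪ U, (if p ∈ W ∩ U then ((symmDiff W U).filter fun y => adj p y).card else 0) =
      ∑ p ∈ W ∩ U, ((symmDiff W U).filter fun y => adj p y).card := by
    rw [← Finset.sum_filter]
    congr 1
    ext y
    simp only [Finset.mem_filter, Finset.mem_union, Finset.mem_inter]
    tauto
  have e2 : ∑ p ∈ W ∪ U, (if p ∈ symmDiff W U then ((W ∩ U).filter fun y => adj p y).card else 0) =
      ∑ p ∈ symmDiff W U, ((W ∩ U).filter fun y => adj p y).card := by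
    rw [← Finset.sum_filter]
    congr 1
    ext y
    simp only [Finset.mem_filter, Finset.mem_union, Finset.mem_symmDiff]
    tauto
  -- Both sides count the adjacent pairs between `W ∩ U` and `W Δ U`, so by symmetry of `adj` the
  -- gains of mismatches and the losses of matches cancel in the sum.
  have e3 : ∑ p ∈ W ∩ U, ((symmDiff W U).filter fun y => adj p y).card =
      ∑ p ∈ symmDiff W U, ((W ∩ U).filter fun y => adj p y).card := by
    simp_rw [Finset.card_filter]
    rw [Finset.sum_comm]
    refine Finset.sum_congr rfl fun p _ => Finset.sum_congr rfl fun q _ => ?_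
    simp [show adj p q ↔ adj q p from ⟨hs _ _, hs _ _⟩]
  omega

theorem sum_union_split {M : Type*} [AddCommMonoid M] (W U : Finset ℕ) (g : ℕ → M) :
    ∑ p ∈ W ∪ U, g p = ∑ p ∈ U \ W, g p + (∑ p ∈ W.filter (· ∈ U), g p +
      ∑ p ∈ W.filter (¬ · ∈ U), g p) := by
  rw [Finset.sum_filter_add_sum_filter_not, ← Finset.sum_union Finset.sdiff_disjoint,
    Finset.sdiff_union_self_eq_union, Finset.union_comm]

theorem card_union_split (W U : Finset ℕ) :
    (W ∪ U).card = (U \ W).card + ((W.filter (· ∈ U)).card + (W.filter (¬ · ∈ U)).card) := by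
  simpa using sum_union_split (M := ℕ) W U fun _ => 1

theorem card_symmDiff_split (W U : Finset ℕ) :
    (symmDiff W U).card = (U \ W).card + (W.filter (¬ · ∈ U)).card := by
  have : symmDiff W U = (U \ W) ∪ W.filter (¬ · ∈ U) := by
    ext y
    simp only [Finset.mem_symmDiff, Finset.mem_union, Finset.mem_sdiff, Finset.mem_filter]
    tauto
  rw [this, Finset.card_union_of_disjoint]
  rw [Finset.disjoint_left]
  intro y
  simp only [Finset.mem_sdiff, Finset.mem_filter]
  tauto

/-- Write N = |W ∪ U| and d = |W Δ U|. There are d mismatching choices; each costs `K * N` and may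
widen the gap of the budgets by one, which adds `5 * K * N`. The at most N matching choices cost `K
* (1 + d)` each. Apart from the term `K` per match, this is at most 7KNd, which is what the factor
`a + b + 1` of the first term of `potential` releases when it drops by one, since the sum of the new
symmetric differences is at most Nd. The last term of `potential` pays for the `K` per match. -/
theorem potential_step_le (hs : ∀ p q, adj p q → adj q p)
    (W U : Finset ℕ) (K a b : ℕ) :
    ∑ f ∈ U \ W, (K * (W ∪ U).card + potential K a (b + 1)
        (symmDiff W (uncov adj U f)).card (W ∪ U).card) +
      (∑ c ∈ W.filter (· ∈ U), (K * (1 + (U \ W).card) + potential K a b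
        (symmDiff (uncov adj W c) (uncov adj U c)).card (W ∪ U).card) +
      ∑ c ∈ W.filter (¬ · ∈ U), (K * (W ∪ U).card + potential K (a + 1) b
        (symmDiff (uncov adj W c) U).card (W ∪ U).card)) ≤
    (W ∪ U).card * potential K (a + 1) (b + 1) (symmDiff W U).card (W ∪ U).card := by
  have hS := sum_card_symmDiff_le hs W U
  have hN := card_union_split W U
  have hD := card_symmDiff_split W U
  set N := (W ∪ U).card
  set d := (symmDiff W U).card
  set S := ∑ p ∈ W ∪ U, (symmDiff (if p ∈ W then uncov adj W p else W)
      (if p ∈ U then uncov adj U p else U)).card with hSdef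
  -- With truncated subtraction this is the distance of `a` and `b`. It changes by at most one if
  -- only one of the two budgets is used, and not at all if both are.
  set δ := (a - b) + (b - a) with hδ
  have h1 : ∀ f ∈ U \ W, K * N + potential K a (b + 1) (symmDiff W (uncov adj U f)).card N ≤
      7 * K * ((a + b + 2) * (symmDiff (if f ∈ W then uncov adj W f else W)
      (if f ∈ U then uncov adj U f else U)).card) +
        (K * N + 5 * K * ((δ + 1) * N) + K * (a + b + 2)) := by
    intro f hf
    rw [Finset.mem_sdiff] at hf
    rw [if_neg hf.2, if_pos hf.1]
    unfold potential
    have : (a - (b + 1)) + ((b + 1) - a) ≤ δ + 1 := by omega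
    have h2 : 5 * K * ((a - (b + 1) + (b + 1 - a)) * N) ≤ 5 * K * ((δ + 1) * N) := by gcongr
    have : a + (b + 1) + 1 = a + b + 2 := by ring
    rw [this]
    omega
  have h2 : ∀ f ∈ W.filter (· ∈ U), K * (1 + (U \ W).card) +
      potential K a b (symmDiff (uncov adj W f) (uncov adj U f)).card N ≤
      7 * K * ((a + b + 2) * (symmDiff (if f ∈ W then uncov adj W f else W)
      (if f ∈ U then uncov adj U f else U)).card) +
        (K * (1 + d) + 5 * K * (δ * N) + K * (a + b + 1)) := by
    intro f hf
    rw [Finset.mem_filter] at hf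
    rw [if_pos hf.1, if_pos hf.2]
    unfold potential
    have h3 : K * (1 + (U \ W).card) ≤ K * (1 + d) := by gcongr; omega
    have h4 : (a + b + 1) * (symmDiff (uncov adj W f) (uncov adj U f)).card ≤
      (a + b + 2) * (symmDiff (uncov adj W f) (uncov adj U f)).card := by gcongr; omega
    have h5 := Nat.mul_le_mul_left (7 * K) h4
    rw [← hδ]
    omega
  have h3 : ∀ f ∈ W.filter (¬ · ∈ U), K * N + potential K (a + 1) b
      (symmDiff (uncov adj W f) U).card N ≤
      7 * K * ((a + b + 2) * (symmDiff (if f ∈ W then uncov adj W f else W)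
      (if f ∈ U then uncov adj U f else U)).card) +
        (K * N + 5 * K * ((δ + 1) * N) + K * (a + b + 2)) := by
    intro f hf
    rw [Finset.mem_filter] at hf
    rw [if_pos hf.1, if_neg hf.2]
    unfold potential
    have : (a + 1 - b) + (b - (a + 1)) ≤ δ + 1 := by omega
    have h2 : 5 * K * ((a + 1 - b + (b - (a + 1))) * N) ≤ 5 * K * ((δ + 1) * N) := by gcongr
    have : a + 1 + b + 1 = a + b + 2 := by ring
    rw [this]
    omega
  refine (Nat.add_le_add (Finset.sum_le_sum h1)
    (Nat.add_le_add (Finset.sum_le_sum h2) (Finset.sum_le_sum h3))).trans ?_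
  simp_rw [Finset.sum_add_distrib, Finset.sum_const, smul_eq_mul, ← Finset.mul_sum]
  have hsplit := sum_union_split (M := ℕ) W U fun p =>
    (symmDiff (if p ∈ W then uncov adj W p else W) (if p ∈ U then uncov adj U p else U)).card
  rw [← hSdef] at hsplit
  unfold potential
  have e : (a + 1 - (b + 1)) + ((b + 1) - (a + 1)) = δ := by omega
  rw [e]
  generalize (∑ p ∈ U \ W, (symmDiff (if p ∈ W then uncov adj W p else W)
    (if p ∈ U then uncov adj U p else U)).card) = S1 at hsplit ⊢
  generalize (∑ p ∈ W.filter (· ∈ U), (symmDiff (if p ∈ W then uncov adj W p else W)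
    (if p ∈ U then uncov adj U p else U)).card) = S2 at hsplit ⊢
  generalize (∑ p ∈ W.filter (¬ · ∈ U), (symmDiff (if p ∈ W then uncov adj W p else W)
    (if p ∈ U then uncov adj U p else U)).card) = S3 at hsplit ⊢
  generalize (U \ W).card = x at hN hD ⊢
  generalize (W.filter (· ∈ U)).card = y at hN ⊢
  generalize (W.filter (¬ · ∈ U)).card = z at hN hD ⊢
  clear_value N d S δ
  subst hsplit
  -- The supermartingale property, multiplied by the smaller of the two factors; the difference of
  -- the factors stays available for the costs of the step.
  have key : 7 * K * ((a + b + 2) * (S1 + (S2 + S3))) ≤ 7 * K * ((a + b + 2) * (N * d)) := by gcongr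
  subst hD
  have hy : y ≤ N := by omega
  have hxz : x + z ≤ N := by omega
  have e3 : y * (K * (1 + (x + z))) ≤ N * (K * (1 + (x + z))) := by gcongr
  have e5 : (x + y + z) * (5 * K * (δ * N) + K * (a + b + 2)) =
      N * (5 * K * (δ * N) + K * (a + b + 2)) := by rw [hN]; ring
  nlinarith [key, e3, e5, Nat.zero_le (y * K)]

theorem potential_mono_right {K a b d n n' : ℕ} (h : n ≤ n') :
    potential K a b d n ≤ potential K a b d n' := by
  unfold potential
  gcongr

/-- The induction is on the old budget, then on the new one. A draw from `U \ W` does not look at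
the old sequence, which therefore keeps its law while `a` drops. Otherwise the first old center `c`
is revealed: it is uniform in `W`, and the rest of the sequence follows the law for `uncov adj W c`.
The draws from `U \ W` and the matches together amount to one uniform draw from `U`, and a discarded
old center leaves the law of the new sequence as it is. -/
theorem lawE_adaptCost_le (hs : ∀ p q, adj p q → adj q p) (K a b : ℕ)
    (W U : Finset ℕ) (F : List ℕ → ℝ≥0∞) :
    lawE adj b W (fun cs => adaptCost adj K cs a W U F) ≤
      lawE adj a U F + potential K a b (symmDiff W U).card (W ∪ U).card := by
  have hsd : (U \ W).card ≤ (symmDiff W U).card := by rw [card_symmDiff_split]; omega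
  induction b generalizing a W U F with
  | zero =>
    rw [lawE]
    cases a with
    | zero =>
      rw [adaptCost, lawE]
      gcongr
      unfold potential
      have := Nat.mul_le_mul_left K hsd
      have h7 : K * (symmDiff W U).card ≤ 7 * K * (symmDiff W U).card := by gcongr; omega
      simp only [Nat.zero_add, Nat.one_mul, Nat.mul_one, Nat.mul_add]
      omega
    | succ a =>
      rw [adaptCost]
      by_cases hW : W = ∅
      · rw [if_pos hW]
        refine (freshCost_le _ _ _ _).trans ?_
        subst hW
        gcongr
        unfold potential
        have : symmDiff ∅ U = U := by ext; simp [Finset.mem_symmDiff]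
        rw [this]
        have h7 : K * ((a + 1 + 1) * U.card) ≤ 7 * K * ((a + 1 + 0 + 1) * U.card) := by
          gcongr <;> omega
        have h8 : K ≤ K * (a + 1 + 0 + 1) := Nat.le_mul_of_pos_right _ (by omega)
        rw [Nat.mul_add, Nat.mul_one]
        omega
      · rw [if_neg hW]
        have hN : 1 ≤ (W ∪ U).card :=
          Finset.card_pos.2 ((Finset.nonempty_iff_ne_empty.2 hW).mono Finset.subset_union_left)
        have hU : U.card ≤ (W ∪ U).card := Finset.card_le_card Finset.subset_union_right
        calc _ ≤ ((K * (1 + (W ∪ U).card) : ℕ) : ℝ≥0∞) +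
              (lawE adj (a + 1) U F + (K * (1 + (a + 1 + 1) * U.card) : ℕ)) := by
              gcongr
              exact freshCost_le _ _ _ _
          _ = lawE adj (a + 1) U F +
              (K * (1 + (W ∪ U).card) + K * (1 + (a + 1 + 1) * U.card) : ℕ) := by
              push_cast; ring
          _ ≤ _ := by
              gcongr
              unfold potential
              have h1 : K * ((a + 1 + 1) * U.card) ≤ K * ((a + 1 + 1) * (W ∪ U).card) := by gcongr
              have h2 : K ≤ K * (W ∪ U).card := Nat.le_mul_of_pos_right _ hN
              have h3 : K ≤ K * (a + 1 + 0 + 1) := Nat.le_mul_of_pos_right _ (by omega)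
              simp only [Nat.sub_zero, Nat.zero_sub, Nat.add_zero] at h3 ⊢
              nlinarith [Nat.zero_le (K * (a * (W ∪ U).card)),
                Nat.zero_le (7 * K * ((a + 1 + 1) * (symmDiff W U).card))]
  | succ b ihb =>
    -- For empty `W` the symmetric difference is all of `U`, so the first term of the potential pays
    -- for a fresh construction.
    rcases W.eq_empty_or_nonempty with rfl | hW
    · rw [lawE_empty]
      have hd : symmDiff ∅ U = U := by ext; simp [Finset.mem_symmDiff]
      have hle : adaptCost adj K [] a ∅ U F ≤ freshCost adj K a U F := by
        cases a <;> simp [adaptCost, freshCost]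
      refine hle.trans ((freshCost_le _ _ _ _).trans ?_)
      gcongr
      rw [hd]
      unfold potential
      have h7 : K * ((a + 1) * U.card) ≤ 7 * K * ((a + (b + 1) + 1) * U.card) := by
        gcongr <;> omega
      have h8 : K ≤ K * (a + (b + 1) + 1) := Nat.le_mul_of_pos_right _ (by omega)
      rw [Nat.mul_add, Nat.mul_one]
      omega
    · induction a generalizing U F with
      | zero =>
        have : ∀ c cs, adaptCost adj K (c :: cs) 0 W U F = F [] + (K * (1 + (W ∪ U).card) : ℕ) := by
          intro c cs
          rw [adaptCost]
        rw [lawE_succ hW]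
        simp_rw [this, lawE_const]
        rw [Finset.sum_const, nsmul_eq_mul, mul_comm,
          ENNReal.mul_div_cancel_right (by simpa using hW.ne_empty) (by simp), lawE]
        gcongr
        unfold potential
        have h3 : K ≤ K * (0 + (b + 1) + 1) := Nat.le_mul_of_pos_right _ (by omega)
        have h4 : K * (W ∪ U).card ≤ 5 * K * ((0 - (b + 1) + (b + 1 - 0)) * (W ∪ U).card) := by
          rw [← Nat.mul_assoc]
          gcongr
          rw [Nat.mul_comm 5, Nat.mul_assoc]
          exact Nat.le_mul_of_pos_right _ (by omega)
        rw [Nat.mul_add, Nat.mul_one]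
        omega
      | succ a iha =>
        have hcW : (W.card : ℝ≥0∞) ≠ 0 := by simpa using hW.ne_empty
        have hcN : ((W ∪ U).card : ℝ≥0∞) ≠ 0 := by
          simpa using (hW.mono Finset.subset_union_left).ne_empty
        set N := (W ∪ U).card with hN
        set X : List ℕ → ℝ≥0∞ := fun cs => ∑ f ∈ U \ W, ((K * N : ℕ) +
          adaptCost adj K cs a W (uncov adj U f) fun l => F (f :: l)) with hX
        set Y : ℕ → List ℕ → ℝ≥0∞ := fun c cs => if c ∈ U
          then (K * (1 + (U \ W).card) : ℕ) +
            adaptCost adj K cs a (uncov adj W c) (uncov adj U c) fun l => F (c :: l)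
          else (K * N : ℕ) + adaptCost adj K cs (a + 1) (uncov adj W c) U F with hY
        have hG : ∀ c cs, adaptCost adj K (c :: cs) (a + 1) W U F =
            (X (c :: cs) + W.card * Y c cs) / N := by
          intro c cs
          rw [adaptCost]
        -- The factor `W.card` in front of `Y` cancels the denominator of the average over the first
        -- old center, so all the choices in `W ∪ U` have equal weight.
        have e1 : lawE adj (b + 1) W (fun cs => adaptCost adj K cs (a + 1) W U F) =
            (lawE adj (b + 1) W X + ∑ c ∈ W, lawE adj b (uncov adj W c) (Y c)) / N := by
          rw [lawE_succ hW]
          simp_rw [hG, lawE_div, lawE_add, lawE_const_mul]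
          rw [lawE_succ hW X]
          simp_rw [div_eq_mul_inv]
          rw [← Finset.sum_mul, Finset.sum_add_distrib, ← Finset.mul_sum]
          rw [add_mul, add_mul, add_mul]
          congr 1
          · ring
          · rw [mul_comm (W.card : ℝ≥0∞), mul_assoc, mul_assoc, mul_comm ((N : ℝ≥0∞)⁻¹),
              ← mul_assoc (W.card : ℝ≥0∞), ENNReal.mul_inv_cancel hcW (by simp), one_mul]
        rw [e1, ENNReal.div_le_iff_le_mul (.inl hcN) (.inl (by simp))]
        have hXle : lawE adj (b + 1) W X ≤ ∑ f ∈ U \ W,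
            (lawE adj a (uncov adj U f) (fun l => F (f :: l)) +
              (K * N + potential K a (b + 1) (symmDiff W (uncov adj U f)).card N : ℕ)) := by
          rw [hX, lawE_sum]
          simp_rw [lawE_add, lawE_const]
          refine Finset.sum_le_sum fun f hf => ?_
          rw [Nat.cast_add, add_left_comm]
          gcongr
          refine (iha (uncov adj U f) _ (by rw [card_symmDiff_split]; omega)).trans ?_
          gcongr
          exact potential_mono_right (Finset.card_le_card
            (Finset.union_subset_union_right uncov_subset))
        have hYle1 : ∑ c ∈ W.filter (· ∈ U), lawE adj b (uncov adj W c) (Y c) ≤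
            ∑ c ∈ W.filter (· ∈ U), (lawE adj a (uncov adj U c) (fun l => F (c :: l)) +
              (K * (1 + (U \ W).card) + potential K a b
                (symmDiff (uncov adj W c) (uncov adj U c)).card N : ℕ)) := by
          refine Finset.sum_le_sum fun c hc => ?_
          rw [Finset.mem_filter] at hc
          simp only [hY, if_pos hc.2]
          rw [lawE_add, lawE_const, Nat.cast_add, add_left_comm]
          gcongr
          refine (ihb a (uncov adj W c) (uncov adj U c) _
            (by rw [card_symmDiff_split]; omega)).trans ?_
          gcongr
          exact potential_mono_right (Finset.card_le_card
            (Finset.union_subset_union uncov_subset uncov_subset))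
        have hYle2 : ∑ c ∈ W.filter (¬ · ∈ U), lawE adj b (uncov adj W c) (Y c) ≤
            ∑ c ∈ W.filter (¬ · ∈ U), (lawE adj (a + 1) U F +
              (K * N + potential K (a + 1) b (symmDiff (uncov adj W c) U).card N : ℕ)) := by
          refine Finset.sum_le_sum fun c hc => ?_
          rw [Finset.mem_filter] at hc
          simp only [hY, if_neg hc.2]
          rw [lawE_add, lawE_const, Nat.cast_add, add_left_comm]
          gcongr
          refine (ihb (a + 1) (uncov adj W c) U _
            (by rw [card_symmDiff_split]; omega)).trans ?_
          gcongr
          exact potential_mono_right (Finset.card_le_card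
            (Finset.union_subset_union_left uncov_subset))
        rw [← Finset.sum_filter_add_sum_filter_not W (· ∈ U)]
        refine (add_le_add hXle (add_le_add hYle1 hYle2)).trans ?_
        simp_rw [Finset.sum_add_distrib]
        have hP := potential_step_le hs W U K a b
        rw [← hN] at hP
        have hP' : ((_ : ℕ) : ℝ≥0∞) ≤ ((_ : ℕ) : ℝ≥0∞) := Nat.cast_le.2 hP
        rw [Nat.cast_add, Nat.cast_add, Nat.cast_mul] at hP'
        simp_rw [Nat.cast_sum] at hP'
        -- Every element of `U` becomes the next new center in exactly one way: as a draw from `U \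
        -- W` or as a matching old center.
        have hL : ∑ f ∈ U \ W, lawE adj a (uncov adj U f) (fun l => F (f :: l)) +
            ∑ c ∈ W.filter (· ∈ U), lawE adj a (uncov adj U c) (fun l => F (c :: l)) =
            U.card * lawE adj (a + 1) U F := by
          rw [card_mul_lawE]
          have : U = (U \ W) ∪ W.filter (· ∈ U) := by
            ext y
            simp only [Finset.mem_union, Finset.mem_sdiff, Finset.mem_filter]
            tauto
          conv_rhs => rw [this]
          rw [Finset.sum_union, ← this]
          rw [Finset.disjoint_left]
          intro y
          simp only [Finset.mem_sdiff, Finset.mem_filter]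
          tauto
        have hcard : (N : ℝ≥0∞) = U.card + (W.filter (¬ · ∈ U)).card := by
          rw [← Nat.cast_add, Nat.cast_inj, hN, ← Finset.card_union_of_disjoint]
          · congr 1
            ext y
            simp only [Finset.mem_union, Finset.mem_filter]
            tauto
          · rw [Finset.disjoint_left]
            intro y
            simp only [Finset.mem_filter]
            tauto
        rw [Finset.sum_const, nsmul_eq_mul, add_mul, mul_comm _ (N : ℝ≥0∞), mul_comm _ (N : ℝ≥0∞)]
        refine le_trans (le_of_eq ?_) (add_le_add_right hP' (N * lawE adj (a + 1) U F))
        rw [hcard, add_mul, ← hL]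
        ring

end Law

end DynKCenter

namespace DynKCenter

/-! ### Linked lists in the memory

The integer variables: `4` number of levels, `5` number of active points, `6` next free node, `7`
first node of the updated point, `8` level, `9` header of the level, `10` node of the updated point,
`11` next old center, `12` last new center, `13` number of centers that may still be added, `14`
number of nodes that the old centers do not cover, `15` random number, `16` list pointer, `17`-`22`
variables of `pour`.

The integer arrays: `0` answer, `1` successor in a list, `2` head of a list, `3` number of active
nodes of a list, `4` size of an old cluster, `5` list that contains a node, `6` flag of the deleted
nodes that are still linked, `7` successor of a center, `8` name of a node, `9` first node of a
point. The real variables: `3` radius of the level, `4` distance; the real array `0` contains the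
radii. -/

infixr:60 " ;; " => Program.seq

/-- Move the node in variable `17` out of the list that is poured. -/
def pourStep : Program :=
  .setN 18 (.cell 1 (.var 17)) ;;
  .cond (.natEq (.cell 5 (.var 17)) (.var 19))
    (.setN 22 (.var 21) ;;
     .cond (.not (.natEq (.var 20) (.lit 0)))
       (.query 4 (.cell 8 (.var 20)) (.cell 8 (.var 17)) ;;
        .cond (.realLt (.var 3) (.var 4)) .skip (.setN 22 (.var 20)))
       .skip ;;
     .storeN 1 (.var 17) (.cell 2 (.var 22)) ;;
     .storeN 2 (.var 22) (.var 17) ;;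
     .storeN 3 (.var 22) (.add (.cell 3 (.var 22)) (.lit 1)) ;;
     .storeN 5 (.var 17) (.var 22))
    (.storeN 6 (.var 17) (.lit 0)) ;;
  .setN 17 (.var 18)

/-- Pour the list in variable `19`: the nodes within the radius of the node in variable `20` (if this
is not `0`) go to the list of this node, the others go to the list in variable `21`, and deleted
nodes are dropped. -/
def pour : Program :=
  .setN 17 (.cell 2 (.var 19)) ;;
  .storeN 2 (.var 19) (.lit 0) ;;
  .storeN 3 (.var 19) (.lit 0) ;;
  .loop (.not (.natEq (.var 17) (.lit 0))) pourStep

/-- The pointer `a` starts the linked list `l`, which ends with the pointer `0`. -/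
def Chain (nx : ℕ → ℕ) : ℕ → List ℕ → Prop
  | a, [] => a = 0
  | a, y :: l => a = y ∧ y ≠ 0 ∧ Chain nx (nx y) l

theorem Chain.congr {nx nx' : ℕ → ℕ} {a : ℕ} {l : List ℕ} (h : Chain nx a l)
    (he : ∀ y ∈ l, nx' y = nx y) : Chain nx' a l := by
  induction l generalizing a with
  | nil => exact h
  | cons y l ih =>
    obtain ⟨h1, h2, h3⟩ := h
    refine ⟨h1, h2, ?_⟩
    rw [he y (by simp)]
    exact ih h3 fun z hz => he z (by simp [hz])

theorem State.narr_storeN_of_ne {s : State} {a b i j v : ℕ} (h : i ≠ j) :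
    (s.storeN a j v).narr b i = s.narr b i := by
  by_cases hb : b = a
  · subst hb
    simp [State.storeN, h]
  · simp [State.storeN, hb]

/-- The number of deleted nodes that are still linked. -/
def garbage (N : Finset ℕ) (m : ℕ → ℕ → ℕ) : ℕ :=
  (N.filter fun y => m 6 y = 1).card

/-- The lists `Lst g` with headers `g ∈ H` and the list `rest`, whose header is `src`, contain the
active nodes `A` and possibly deleted ones. -/
structure Links (N H A : Finset ℕ) (m : ℕ → ℕ → ℕ) (src : ℕ) (rest : List ℕ)
    (Lst : ℕ → List ℕ) : Prop where
  chain : ∀ g ∈ H, Chain (m 1) (m 2 g) (Lst g)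
  sub : ∀ g ∈ H, ∀ y ∈ Lst g, y ∈ N
  nodup : ∀ g ∈ H, (Lst g).Nodup
  disj : ∀ g ∈ H, ∀ g' ∈ H, ∀ y ∈ Lst g, y ∈ Lst g' → g = g'
  count : ∀ g ∈ H, m 3 g = ((Lst g).filter (· ∈ A)).length
  lead : ∀ y ∈ A, m 5 y ∈ H ∧ (y ∈ Lst (m 5 y) ∨ m 5 y = src ∧ y ∈ rest)
  alive : ∀ g ∈ H, ∀ y ∈ Lst g, y ∈ A → m 5 y = g
  -- A deleted node that is still linked is recognised by its entry in array `5`, which no longer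
  -- names its list. The free list, with header `0`, contains no such nodes, so a random position in
  -- it is a random active free node.
  dead : ∀ g ∈ H, ∀ y ∈ Lst g, y ∉ A → g ≠ 0 ∧ m 6 y = 1 ∧ m 5 y ≠ g
  restSub : ∀ y ∈ rest, y ∈ N
  restAlive : ∀ y ∈ rest, y ∈ A → m 5 y = src
  restDead : ∀ y ∈ rest, y ∉ A → src ≠ 0 ∧ m 6 y = 1 ∧ m 5 y ≠ src
  restDisj : ∀ y ∈ rest, ∀ g ∈ H, y ∉ Lst g
  restNodup : rest.Nodup

/-- What `pour` leaves unchanged. -/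
structure PourFrame (H A : Finset ℕ) (s s' : State) : Prop where
  nvar : ∀ x, x ≠ 17 → x ≠ 18 → x ≠ 22 → s'.nvar x = s.nvar x
  rvar : ∀ x, x ≠ 4 → s'.rvar x = s.rvar x
  rarr : s'.rarr = s.rarr
  arr : ∀ a, a ≠ 1 → a ≠ 2 → a ≠ 3 → a ≠ 5 → a ≠ 6 → s'.narr a = s.narr a
  out : ∀ a i, i ∉ H → s'.narr a i = s.narr a i
  lead : ∀ i, i ∉ A → s'.narr 5 i = s.narr 5 i

theorem PourFrame.refl (H A : Finset ℕ) (s : State) : PourFrame H A s s :=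
  ⟨fun _ _ _ _ => rfl, fun _ _ => rfl, rfl, fun _ _ _ _ _ _ => rfl, fun _ _ _ => rfl,
    fun _ _ => rfl⟩

theorem PourFrame.trans {H A : Finset ℕ} {s₁ s₂ s₃ : State} (h : PourFrame H A s₁ s₂)
    (h' : PourFrame H A s₂ s₃) : PourFrame H A s₁ s₃ where
  nvar x h1 h2 h3 := (h'.nvar x h1 h2 h3).trans (h.nvar x h1 h2 h3)
  rvar x h1 := (h'.rvar x h1).trans (h.rvar x h1)
  rarr := h'.rarr.trans h.rarr
  arr a h1 h2 h3 h4 h5 := (h'.arr a h1 h2 h3 h4 h5).trans (h.arr a h1 h2 h3 h4 h5)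
  out a i hi := (h'.out a i hi).trans (h.out a i hi)
  lead i hi := (h'.lead i hi).trans (h.lead i hi)

open Classical in
/-- The list to which `pour` moves the node `y`. -/
noncomputable def target (Dst : ℕ → ℕ → ℝ) (ρ : ℝ) (f g y : ℕ) : ℕ :=
  if f ≠ 0 ∧ Dst f y ≤ ρ then f else g

variable {ans : ℕ → ℕ → ℝ → Prop} {Dst : ℕ → ℕ → ℝ} {ρ : ℝ} {N H A : Finset ℕ}

theorem pourStep_dead {s : State} {y : ℕ} (hy : s.nvar 17 = y) (hl : s.narr 5 y ≠ s.nvar 19) :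
    Det ans pourStep s fun s' t =>
      s' = ((s.setN 18 (s.narr 1 y)).storeN 6 y 0).setN 17 (s.narr 1 y) ∧ t ≤ 30 := by
  unfold pourStep
  refine Det.seq (Det.setN (Det.seq (Det.cond (fun hb => absurd hb ?_) fun _ =>
    Det.storeN (Det.setN ⟨?_, ?_⟩))))
  · simpa [Test.Holds, NExpr.eval, State.setN, hy] using hl
  · simp [NExpr.eval, State.setN, State.storeN, hy]
  · simp [NExpr.cost, Test.cost]

theorem pourStep_alive {s : State} {y : ℕ} (hy : s.nvar 17 = y) (hl : s.narr 5 y = s.nvar 19)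
    (hρ : s.rvar 3 = ρ)
    (hans : s.nvar 20 ≠ 0 → ans (s.narr 8 (s.nvar 20)) (s.narr 8 y) (Dst (s.nvar 20) y)) :
    Det ans pourStep s fun s' t =>
      s'.nvar 17 = s.narr 1 y ∧ (∀ x, x ≠ 17 → x ≠ 18 → x ≠ 22 → s'.nvar x = s.nvar x) ∧
      (∀ x, x ≠ 4 → s'.rvar x = s.rvar x) ∧ s'.rarr = s.rarr ∧
      s'.narr = ((((s.storeN 1 y (s.narr 2 (target Dst ρ (s.nvar 20) (s.nvar 21) y))).storeN 2
        (target Dst ρ (s.nvar 20) (s.nvar 21) y) y).storeN 3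
        (target Dst ρ (s.nvar 20) (s.nvar 21) y)
          (s.narr 3 (target Dst ρ (s.nvar 20) (s.nvar 21) y) + 1)).storeN 5 y
        (target Dst ρ (s.nvar 20) (s.nvar 21) y)).narr ∧ t ≤ 60 := by
  unfold pourStep
  refine Det.seq (Det.setN (Det.seq (Det.cond (fun _ => ?_) fun hb => absurd ?_ hb)))
  · refine Det.seq (Det.setN (Det.seq (Det.cond (fun hf => ?_) fun hf => ?_)))
    · have hf0 : s.nvar 20 ≠ 0 := by simpa [Test.Holds, NExpr.eval, State.setN] using hf
      refine Det.seq (Det.query (d := Dst (s.nvar 20) y) ?_ (Det.cond (fun hd => ?_) fun hd => ?_))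
      · simpa [NExpr.eval, State.setN, hy] using hans hf0
      · have ht : target Dst ρ (s.nvar 20) (s.nvar 21) y = s.nvar 21 := by
          rw [target, if_neg]
          simpa [Test.Holds, RExpr.eval, State.setN, State.setR, hρ, hf0] using hd
        rw [ht]
        refine Det.skip (Det.seq (Det.storeN (Det.seq (Det.storeN (Det.seq (Det.storeN
          (Det.storeN (Det.setN ?_))))))))
        simp +contextual [NExpr.eval, State.setN, State.setR, State.storeN, hy, NExpr.cost,
          Test.cost, RExpr.cost, Function.update_of_ne]
      · have ht : target Dst ρ (s.nvar 20) (s.nvar 21) y = s.nvar 20 := by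
          rw [target, if_pos]
          simpa [Test.Holds, RExpr.eval, State.setN, State.setR, hρ, hf0] using hd
        rw [ht]
        refine Det.setN (Det.seq (Det.storeN (Det.seq (Det.storeN (Det.seq (Det.storeN
          (Det.storeN (Det.setN ?_))))))))
        simp +contextual [NExpr.eval, State.setN, State.setR, State.storeN, hy, NExpr.cost,
          Test.cost, RExpr.cost, Function.update_of_ne]
    · have hf0 : s.nvar 20 = 0 := by simpa [Test.Holds, NExpr.eval, State.setN] using hf
      have ht : target Dst ρ (s.nvar 20) (s.nvar 21) y = s.nvar 21 := by
        rw [target, if_neg]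
        simp [hf0]
      rw [ht]
      refine Det.skip (Det.seq (Det.storeN (Det.seq (Det.storeN (Det.seq (Det.storeN
          (Det.storeN (Det.setN ?_))))))))
      simp +contextual [NExpr.eval, State.setN, State.storeN, hy, NExpr.cost,
        Test.cost, Function.update_of_ne]
  · simpa [Test.Holds, NExpr.eval, State.setN, hy] using hl

theorem Links.push {m m' : ℕ → ℕ → ℕ} {src y tg : ℕ} {rest : List ℕ} {Lst : ℕ → List ℕ}
    (h : Links N H A m src (y :: rest) Lst) (h0 : 0 ∉ N) (hy : y ∈ A) (hto : tg ∈ H)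
    (h1 : m' 1 = Function.update (m 1) y (m 2 tg)) (h2 : m' 2 = Function.update (m 2) tg y)
    (h3 : m' 3 = Function.update (m 3) tg (m 3 tg + 1)) (h5 : m' 5 = Function.update (m 5) y tg)
    (h6 : m' 6 = m 6) :
    Links N H A m' src rest (Function.update Lst tg (y :: Lst tg)) := by
  have hyL : ∀ g ∈ H, y ∉ Lst g := h.restDisj y (by simp)
  have hyr : y ∉ rest := (List.nodup_cons.1 h.restNodup).1
  have hne : ∀ z, z ≠ y → m' 5 z = m 5 z := fun z hz => by rw [h5, Function.update_of_ne hz]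
  have heq : m' 5 y = tg := by rw [h5, Function.update_self]
  have hch : ∀ g ∈ H, ∀ a, Chain (m 1) a (Lst g) → Chain (m' 1) a (Lst g) := by
    intro g hg a ha
    refine ha.congr fun z hz => ?_
    rw [h1, Function.update_of_ne]
    rintro rfl
    exact hyL g hg hz
  have hmem : ∀ g z, z ∈ Function.update Lst tg (y :: Lst tg) g →
      z ∈ Lst g ∨ (g = tg ∧ z = y) := by
    intro g z hz
    by_cases hg : g = tg
    · subst hg
      rw [Function.update_self, List.mem_cons] at hz
      tauto
    · rw [Function.update_of_ne hg] at hz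
      exact .inl hz
  have hmem' : ∀ g z, z ∈ Lst g → z ∈ Function.update Lst tg (y :: Lst tg) g := by
    intro g z hz
    by_cases hg : g = tg
    · subst hg
      rw [Function.update_self]
      exact List.mem_cons_of_mem _ hz
    · rwa [Function.update_of_ne hg]
  have hzy : ∀ g ∈ H, ∀ z ∈ Lst g, z ≠ y := by
    rintro g hg z hz rfl
    exact hyL g hg hz
  constructor
  · intro g hg
    by_cases hgt : g = tg
    · subst hgt
      rw [Function.update_self, h2, Function.update_self]
      refine ⟨rfl, ?_, ?_⟩
      · rintro rfl
        exact h0 (h.restSub _ (by simp))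
      · rw [h1, Function.update_self, ← h1]
        exact hch g hg _ (h.chain g hg)
    · rw [Function.update_of_ne hgt, h2, Function.update_of_ne hgt]
      exact hch g hg _ (h.chain g hg)
  · intro g hg z hz
    rcases hmem g z hz with hz | ⟨-, rfl⟩
    · exact h.sub g hg z hz
    · exact h.restSub _ (by simp)
  · intro g hg
    by_cases hgt : g = tg
    · subst hgt
      rw [Function.update_self]
      exact List.nodup_cons.2 ⟨hyL g hg, h.nodup g hg⟩
    · rw [Function.update_of_ne hgt]
      exact h.nodup g hg
  · intro g hg g' hg' z hz hz'
    rcases hmem g z hz with h₁ | ⟨e₁, e₂⟩ <;> rcases hmem g' z hz' with h₂ | ⟨e₃, e₄⟩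
    · exact h.disj g hg g' hg' z h₁ h₂
    · exact absurd e₄ (hzy g hg z h₁)
    · exact absurd e₂ (hzy g' hg' z h₂)
    · rw [e₁, e₃]
  · intro g hg
    by_cases hgt : g = tg
    · subst hgt
      rw [Function.update_self, h3, Function.update_self, h.count g hg]
      simp [hy]
    · rw [Function.update_of_ne hgt, h3, Function.update_of_ne hgt, h.count g hg]
  · intro z hz
    by_cases hzy' : z = y
    · subst hzy'
      rw [heq]
      exact ⟨hto, .inl (by simp)⟩
    · rw [hne z hzy']
      obtain ⟨a, b⟩ := h.lead z hz
      refine ⟨a, ?_⟩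
      rcases b with b | ⟨b, c⟩
      · exact .inl (hmem' _ _ b)
      · rw [List.mem_cons] at c
        exact .inr ⟨b, c.resolve_left hzy'⟩
  · intro g hg z hz hzA
    rcases hmem g z hz with hz | ⟨rfl, rfl⟩
    · rw [hne z (hzy g hg z hz)]
      exact h.alive g hg z hz hzA
    · exact heq
  · intro g hg z hz hzA
    rcases hmem g z hz with hz | ⟨rfl, rfl⟩
    · rw [hne z (hzy g hg z hz), h6]
      exact h.dead g hg z hz hzA
    · exact absurd hy hzA
  · exact fun z hz => h.restSub z (by simp [hz])
  · intro z hz hzA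
    rw [hne z (by rintro rfl; exact hyr hz)]
    exact h.restAlive z (by simp [hz]) hzA
  · intro z hz hzA
    rw [hne z (by rintro rfl; exact hyr hz), h6]
    exact h.restDead z (by simp [hz]) hzA
  · intro z hz g hg hzg
    rcases hmem g z hzg with hz' | ⟨rfl, rfl⟩
    · exact h.restDisj z (by simp [hz]) g hg hz'
    · exact hyr hz
  · exact (List.nodup_cons.1 h.restNodup).2

theorem Links.drop {m m' : ℕ → ℕ → ℕ} {src y : ℕ} {rest : List ℕ} {Lst : ℕ → List ℕ}
    (h : Links N H A m src (y :: rest) Lst) (hy : y ∉ A)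
    (h1 : m' 1 = m 1) (h2 : m' 2 = m 2) (h3 : m' 3 = m 3) (h5 : m' 5 = m 5)
    (h6 : m' 6 = Function.update (m 6) y 0) :
    Links N H A m' src rest Lst := by
  have hyL : ∀ g ∈ H, y ∉ Lst g := h.restDisj y (by simp)
  have hyr : y ∉ rest := (List.nodup_cons.1 h.restNodup).1
  have hne : ∀ z, z ≠ y → m' 6 z = m 6 z := fun z hz => by rw [h6, Function.update_of_ne hz]
  constructor
  · rw [h1, h2]; exact h.chain
  · exact h.sub
  · exact h.nodup
  · exact h.disj
  · rw [h3]; exact h.count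
  · intro z hz
    rw [h5]
    obtain ⟨a, b⟩ := h.lead z hz
    refine ⟨a, b.imp_right fun ⟨b, c⟩ => ⟨b, ?_⟩⟩
    rw [List.mem_cons] at c
    exact c.resolve_left (by rintro rfl; exact hy hz)
  · rw [h5]; exact h.alive
  · intro g hg z hz hzA
    rw [h5, hne z (by rintro rfl; exact hyL g hg hz)]
    exact h.dead g hg z hz hzA
  · exact fun z hz => h.restSub z (by simp [hz])
  · rw [h5]; exact fun z hz => h.restAlive z (by simp [hz])
  · intro z hz hzA
    rw [h5, hne z (by rintro rfl; exact hyr hz)]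
    exact h.restDead z (by simp [hz]) hzA
  · exact fun z hz => h.restDisj z (by simp [hz])
  · exact (List.nodup_cons.1 h.restNodup).2

/-- The programs never test the flags in array `6`; they carry the amortization. Dropping a deleted
node releases one unit, which pays for the step of `pour` that drops it. -/
theorem garbage_drop {m m' : ℕ → ℕ → ℕ} {y : ℕ} (hy : y ∈ N) (h : m 6 y = 1)
    (h6 : m' 6 = Function.update (m 6) y 0) : garbage N m' + 1 = garbage N m := by
  have : (N.filter fun z => m' 6 z = 1) = (N.filter fun z => m 6 z = 1).erase y := by
    ext z
    simp only [Finset.mem_filter, Finset.mem_erase, h6]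
    by_cases hz : z = y
    · subst hz; simp
    · simp [hz]
  rw [garbage, garbage, this, Finset.card_erase_add_one]
  simp [hy, h]

/-- An active node costs at most 64, a deleted one is paid by the decrease of `garbage`. The target
`g` may be the source itself, because the list `rest` is detached from its header. Distances are
only asked between active nodes. -/
theorem pour_loop (h0 : 0 ∉ N) (hNH : N ⊆ H) {src f g : ℕ} (hg : g ∈ H)
    (hf : f ≠ 0 → f ∈ A) (hA : A ⊆ N) (rest : List ℕ) :
    ∀ (s : State) (Lst : ℕ → List ℕ), Links N H A s.narr src rest Lst →
      Chain (s.narr 1) (s.nvar 17) rest → s.nvar 19 = src → s.nvar 20 = f → s.nvar 21 = g →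
      s.rvar 3 = ρ → (∀ x ∈ A, ∀ y ∈ A, ans (s.narr 8 x) (s.narr 8 y) (Dst x y)) →
      Det ans (.loop (.not (.natEq (.var 17) (.lit 0))) pourStep) s fun s' t =>
        (∃ Lst', Links N H A s'.narr src [] Lst') ∧ PourFrame H A s s' ∧
        (∀ y ∈ A, s'.narr 5 y = if y ∈ rest then target Dst ρ f g y else s.narr 5 y) ∧
        t + 64 * garbage N s'.narr ≤
          64 * garbage N s.narr + 64 * (rest.filter (· ∈ A)).length + 4 := by
  induction rest with
  | nil =>
    intro s Lst hL hc _ _ _ _ _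
    refine Det.loop_exit ?_ ⟨⟨Lst, hL⟩, .refl _ _ _, by simp, ?_⟩
    · simpa [Test.Holds, NExpr.eval, Chain] using hc
    · simp [Test.cost, NExpr.cost, Nat.add_comm]
  | cons y rest ih =>
    intro s Lst hL hc hsrc hf' hg' hρ hans
    obtain ⟨hy17, hy0, hc⟩ := hc
    have hyr : y ∉ rest := (List.nodup_cons.1 hL.restNodup).1
    have hyN : y ∈ N := hL.restSub y (by simp)
    refine Det.loop_step (by simpa [Test.Holds, NExpr.eval, hy17] using hy0) ?_
    by_cases hyA : y ∈ A
    · have hto : target Dst ρ f g y ∈ H := by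
        unfold target
        split
        · next hh => exact hNH (hA (hf hh.1))
        · exact hg
      refine (pourStep_alive (ρ := ρ) (Dst := Dst) hy17 (by rw [hsrc]; exact hL.restAlive y (by simp) hyA) hρ
        (by rw [hf']; exact fun h => hans _ (hf h) _ hyA)).mono ?_
      rintro s₁ t₁ ⟨h17, hnv, hrv, hra, hna, ht₁⟩
      rw [hf', hg'] at hna
      set tg := target Dst ρ f g y with hto'
      have hL' := hL.push (m' := s₁.narr) h0 hyA hto (by simp [hna, State.storeN])
        (by simp [hna, State.storeN]) (by simp [hna, State.storeN]) (by simp [hna, State.storeN])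
        (by simp [hna, State.storeN])
      have harr : ∀ a, a ≠ 1 → a ≠ 2 → a ≠ 3 → a ≠ 5 → s₁.narr a = s.narr a := by
        intro a h1 h2 h3 h5
        simp [hna, State.storeN, h1, h2, h3, h5]
      have h5 : s₁.narr 5 = Function.update (s.narr 5) y tg := by simp [hna, State.storeN]
      have hfr : PourFrame H A s s₁ := by
        refine ⟨hnv, hrv, hra, fun a h1 h2 h3 h5 _ => harr a h1 h2 h3 h5, ?_, ?_⟩
        · intro a i hi
          have hiy : i ≠ y := by rintro rfl; exact hi (hNH hyN)
          have hit : i ≠ tg := by rintro rfl; exact hi hto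
          rw [hna]
          simp only [State.narr_storeN_of_ne, ne_eq, hiy, hit, not_false_eq_true]
        · intro i hi
          rw [h5, Function.update_of_ne]
          rintro rfl
          exact hi hyA
      refine (ih s₁ _ hL' ?_ ?_ ?_ ?_ ?_ ?_).mono ?_
      · rw [h17]
        refine hc.congr fun z hz => ?_
        have : z ≠ y := by rintro rfl; exact hyr hz
        simp [hna, State.storeN, this]
      · rw [hnv _ (by decide) (by decide) (by decide), hsrc]
      · rw [hnv _ (by decide) (by decide) (by decide), hf']
      · rw [hnv _ (by decide) (by decide) (by decide), hg']
      · rw [hrv _ (by decide), hρ]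
      · rw [harr 8 (by decide) (by decide) (by decide) (by decide)]
        exact hans
      · rintro s₂ t₂ ⟨hL₂, hfr₂, hlead, ht₂⟩
        refine ⟨hL₂, hfr.trans hfr₂, ?_, ?_⟩
        · intro z hz
          rw [hlead z hz]
          by_cases hzy : z = y
          · subst hzy
            rw [if_neg hyr, if_pos (by simp), h5, Function.update_self]
          · rw [h5, Function.update_of_ne hzy]
            simp [hzy]
        · have hgb : garbage N s₁.narr = garbage N s.narr := by
            unfold garbage
            rw [harr 6 (by decide) (by decide) (by decide) (by decide)]
          rw [hgb] at ht₂
          have : ((y :: rest).filter (· ∈ A)).length = (rest.filter (· ∈ A)).length + 1 := by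
            simp [hyA]
          simp only [Test.cost, NExpr.cost]
          omega
    · obtain ⟨hs0, hd1, hd2⟩ := hL.restDead y (by simp) hyA
      refine (pourStep_dead hy17 (by rw [hsrc]; exact hd2)).mono ?_
      rintro s₁ t₁ ⟨rfl, ht₁⟩
      set s₁ := ((s.setN 18 (s.narr 1 y)).storeN 6 y 0).setN 17 (s.narr 1 y) with hs₁
      have hL' := hL.drop (m' := s₁.narr) hyA (by simp [hs₁, State.storeN, State.setN])
        (by simp [hs₁, State.storeN, State.setN]) (by simp [hs₁, State.storeN, State.setN])
        (by simp [hs₁, State.storeN, State.setN]) (by simp [hs₁, State.storeN, State.setN])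
      have hfr : PourFrame H A s s₁ := by
        refine ⟨?_, fun _ _ => rfl, rfl, ?_, ?_, ?_⟩
        · intro x h1 h2 _
          simp [hs₁, State.storeN, State.setN, h1, h2]
        · intro a _ _ _ _ h6
          simp [hs₁, State.storeN, State.setN, h6]
        · intro a i hi
          have hiy : i ≠ y := by rintro rfl; exact hi (hNH hyN)
          exact State.narr_storeN_of_ne hiy
        · intro i hi
          simp [hs₁, State.storeN, State.setN]
      refine (ih s₁ _ hL' ?_ ?_ ?_ ?_ ?_ ?_).mono ?_
      · simpa [hs₁, State.storeN, State.setN] using hc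
      · simpa [hs₁, State.storeN, State.setN] using hsrc
      · simpa [hs₁, State.storeN, State.setN] using hf'
      · simpa [hs₁, State.storeN, State.setN] using hg'
      · exact hρ
      · simpa [hs₁, State.storeN, State.setN] using hans
      · rintro s₂ t₂ ⟨hL₂, hfr₂, hlead, ht₂⟩
        refine ⟨hL₂, hfr.trans hfr₂, ?_, ?_⟩
        · intro z hz
          have hzy : z ≠ y := by rintro rfl; exact hyA hz
          rw [hlead z hz]
          simp [hzy, hs₁, State.storeN, State.setN]
        · have hgb : garbage N s₁.narr + 1 = garbage N s.narr :=
            garbage_drop hyN hd1 (by simp [hs₁, State.storeN, State.setN])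
          have : ((y :: rest).filter (· ∈ A)).length = (rest.filter (· ∈ A)).length := by
            simp [hyA]
          simp only [Test.cost, NExpr.cost]
          omega

/-- The active nodes are linked by the lists with headers in `H`. -/
def Linked (N H A : Finset ℕ) (m : ℕ → ℕ → ℕ) : Prop :=
  ∃ Lst, Links N H A m 0 [] Lst

theorem Links.of_nil {m : ℕ → ℕ → ℕ} {src : ℕ} {Lst : ℕ → List ℕ}
    (h : Links N H A m src [] Lst) (src' : ℕ) : Links N H A m src' [] Lst :=
  { h with
    lead := fun y hy => by simpa using h.lead y hy
    restAlive := by simp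
    restDead := by simp }

theorem Links.mem_iff {m : ℕ → ℕ → ℕ} {src : ℕ} {Lst : ℕ → List ℕ}
    (h : Links N H A m src [] Lst) {g y : ℕ} (hg : g ∈ H) (hy : y ∈ A) :
    y ∈ Lst g ↔ m 5 y = g := by
  refine ⟨fun hh => h.alive g hg y hh hy, ?_⟩
  rintro rfl
  simpa using (h.lead y hy).2

theorem Links.length_filter {m : ℕ → ℕ → ℕ} {src : ℕ} {Lst : ℕ → List ℕ}
    (h : Links N H A m src [] Lst) {g : ℕ} (hg : g ∈ H) :
    ((Lst g).filter (· ∈ A)).length = (A.filter fun y => m 5 y = g).card := by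
  rw [← List.toFinset_card_of_nodup ((h.nodup g hg).filter _)]
  congr 1
  ext y
  simp only [List.mem_toFinset, List.mem_filter, decide_eq_true_eq, Finset.mem_filter]
  constructor
  · rintro ⟨h1, h2⟩
    exact ⟨h2, (h.mem_iff hg h2).1 h1⟩
  · rintro ⟨h1, h2⟩
    exact ⟨(h.mem_iff hg h1).2 h2, h1⟩

theorem Linked.count {m : ℕ → ℕ → ℕ} (h : Linked N H A m) {g : ℕ} (hg : g ∈ H) :
    m 3 g = (A.filter fun y => m 5 y = g).card := by
  obtain ⟨Lst, h⟩ := h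
  rw [h.count g hg, h.length_filter hg]

theorem Linked.lead_mem {m : ℕ → ℕ → ℕ} (h : Linked N H A m) {y : ℕ} (hy : y ∈ A) :
    m 5 y ∈ H := by
  obtain ⟨Lst, h⟩ := h
  exact (h.lead y hy).1

theorem pour_spec (h0 : 0 ∉ N) (hNH : N ⊆ H) {s : State} {src f g : ℕ} (hsrc : src ∈ H)
    (hg : g ∈ H) (hf : f ≠ 0 → f ∈ A) (hA : A ⊆ N) (hL : Linked N H A s.narr)
    (hs : s.nvar 19 = src) (hf' : s.nvar 20 = f) (hg' : s.nvar 21 = g) (hρ : s.rvar 3 = ρ)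
    (hans : ∀ x ∈ A, ∀ y ∈ A, ans (s.narr 8 x) (s.narr 8 y) (Dst x y)) :
    Det ans pour s fun s' t =>
      Linked N H A s'.narr ∧ PourFrame H A s s' ∧
      (∀ y ∈ A, s'.narr 5 y =
        if s.narr 5 y = src then target Dst ρ f g y else s.narr 5 y) ∧
      t + 64 * garbage N s'.narr ≤ 64 * garbage N s.narr +
        64 * (A.filter fun y => s.narr 5 y = src).card + 20 := by
  obtain ⟨Lst, hL⟩ := hL
  have hlen := hL.length_filter hsrc
  have hmi : ∀ y ∈ A, (y ∈ Lst src ↔ s.narr 5 y = src) := fun y hy => hL.mem_iff hsrc hy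
  -- The header of the source is reset before the loop, so its list counts as empty and its former
  -- nodes form `rest`.
  set s₁ := ((s.setN 17 (s.narr 2 src)).storeN 2 src 0).storeN 3 src 0 with hs₁
  have e1 : s₁.narr 1 = s.narr 1 := by simp [hs₁, State.storeN, State.setN]
  have e2 : s₁.narr 2 = Function.update (s.narr 2) src 0 := by simp [hs₁, State.storeN, State.setN]
  have e3 : s₁.narr 3 = Function.update (s.narr 3) src 0 := by simp [hs₁, State.storeN, State.setN]
  have e5 : s₁.narr 5 = s.narr 5 := by simp [hs₁, State.storeN, State.setN]
  have e6 : s₁.narr 6 = s.narr 6 := by simp [hs₁, State.storeN, State.setN]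
  have e8 : s₁.narr 8 = s.narr 8 := by simp [hs₁, State.storeN, State.setN]
  have hnv : ∀ x, x ≠ 17 → s₁.nvar x = s.nvar x := by
    intro x hx
    simp [hs₁, State.storeN, State.setN, hx]
  have hfr : PourFrame H A s s₁ := by
    refine ⟨fun x h _ _ => hnv x h, fun _ _ => rfl, rfl, ?_, ?_, ?_⟩
    · intro a _ h2 h3 _ _
      simp [hs₁, State.storeN, State.setN, h2, h3]
    · intro a i hi
      have : i ≠ src := by rintro rfl; exact hi hsrc
      rw [hs₁, State.narr_storeN_of_ne this, State.narr_storeN_of_ne this]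
      rfl
    · intro i _
      rw [e5]
  have hupd : ∀ g, g ≠ src → Function.update Lst src [] g = Lst g := fun g hg =>
    Function.update_of_ne hg _ _
  have hmem : ∀ g z, z ∈ Function.update Lst src [] g → z ∈ Lst g ∧ g ≠ src := by
    intro g z hz
    by_cases hgs : g = src
    · subst hgs
      simp at hz
    · exact ⟨by rwa [hupd g hgs] at hz, hgs⟩
  have hL₁ : Links N H A s₁.narr src (Lst src) (Function.update Lst src []) := by
    constructor
    · intro g hg
      rw [e1, e2]
      by_cases hgs : g = src
      · subst hgs
        simp [Chain]
      · rw [hupd g hgs, Function.update_of_ne hgs]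
        exact hL.chain g hg
    · exact fun g hg z hz => hL.sub g hg z (hmem g z hz).1
    · intro g hg
      by_cases hgs : g = src
      · subst hgs
        simp
      · rw [hupd g hgs]
        exact hL.nodup g hg
    · exact fun g hg g' hg' z hz hz' => hL.disj g hg g' hg' z (hmem g z hz).1 (hmem g' z hz').1
    · intro g hg
      rw [e3]
      by_cases hgs : g = src
      · subst hgs
        simp
      · rw [hupd g hgs, Function.update_of_ne hgs]
        exact hL.count g hg
    · intro z hz
      rw [e5]
      have := hL.lead z hz
      refine ⟨this.1, ?_⟩
      by_cases hzs : s.narr 5 z = src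
      · exact .inr ⟨hzs, (hmi z hz).2 hzs⟩
      · rw [hupd _ hzs]
        exact .inl (by simpa using this.2)
    · intro g hg z hz hzA
      rw [e5]
      exact hL.alive g hg z (hmem g z hz).1 hzA
    · intro g hg z hz hzA
      rw [e5, e6]
      exact hL.dead g hg z (hmem g z hz).1 hzA
    · exact hL.sub src hsrc
    · intro z hz hzA
      rw [e5]
      exact hL.alive src hsrc z hz hzA
    · intro z hz hzA
      rw [e5, e6]
      exact hL.dead src hsrc z hz hzA
    · intro z hz g hg hzg
      exact (hmem g z hzg).2 (hL.disj g hg src hsrc z (hmem g z hzg).1 hz)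
    · exact hL.nodup src hsrc
  unfold pour
  refine Det.seq (Det.setN (Det.seq (Det.storeN (Det.seq (Det.storeN ?_)))))
  have hstate : ((s.setN 17 ((NExpr.cell 2 (.var 19)).eval s)).storeN 2
      ((NExpr.var 19).eval (s.setN 17 ((NExpr.cell 2 (.var 19)).eval s)))
      ((NExpr.lit 0).eval (s.setN 17 ((NExpr.cell 2 (.var 19)).eval s)))).storeN 3
      ((NExpr.var 19).eval ((s.setN 17 ((NExpr.cell 2 (.var 19)).eval s)).storeN 2
      ((NExpr.var 19).eval (s.setN 17 ((NExpr.cell 2 (.var 19)).eval s)))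
      ((NExpr.lit 0).eval (s.setN 17 ((NExpr.cell 2 (.var 19)).eval s)))))
      ((NExpr.lit 0).eval ((s.setN 17 ((NExpr.cell 2 (.var 19)).eval s)).storeN 2
      ((NExpr.var 19).eval (s.setN 17 ((NExpr.cell 2 (.var 19)).eval s)))
      ((NExpr.lit 0).eval (s.setN 17 ((NExpr.cell 2 (.var 19)).eval s))))) = s₁ := by
    simp [hs₁, NExpr.eval, State.setN, State.storeN, hs]
  rw [hstate]
  refine (pour_loop (ans := ans) (Dst := Dst) (ρ := ρ) h0 hNH hg hf hA (Lst src) s₁ _ hL₁ ?_ ?_ ?_ ?_ hρ ?_).mono ?_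
  · rw [e1]
    have : s₁.nvar 17 = s.narr 2 src := by simp [hs₁, State.storeN, State.setN]
    rw [this]
    exact hL.chain src hsrc
  · rw [hnv _ (by decide), hs]
  · rw [hnv _ (by decide), hf']
  · rw [hnv _ (by decide), hg']
  · rw [e8]
    exact hans
  · rintro s₂ t₂ ⟨⟨Lst', hL₂⟩, hfr₂, hlead, ht₂⟩
    refine ⟨⟨Lst', hL₂.of_nil 0⟩, hfr.trans hfr₂, ?_, ?_⟩
    · intro y hy
      rw [hlead y hy, e5]
      simp only [hmi y hy]
    · have hgb : garbage N s₁.narr = garbage N s.narr := by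
        unfold garbage
        rw [e6]
      rw [hgb, hlen] at ht₂
      simp only [NExpr.cost]
      omega

end DynKCenter

namespace DynKCenter

/-! ### Greedy sequences and the clusters of their centers -/

section Greedy
open Classical

variable {adj : ℕ → ℕ → Prop}

/-- The sequence `l` is a possible outcome of the random choice of at most `b` centers for `W`. -/
def Greedy (adj : ℕ → ℕ → Prop) : ℕ → List ℕ → Finset ℕ → Prop
  | b, [], W => b = 0 ∨ W = ∅
  | b, c :: l, W => ∃ b', b = b' + 1 ∧ c ∈ W ∧ Greedy adj b' l (uncov adj W c)

/-- The first element of `l` that covers `y`, or `h` if there is none. -/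
noncomputable def leader (adj : ℕ → ℕ → Prop) (h : ℕ) : List ℕ → ℕ → ℕ
  | [], _ => h
  | c :: l, y => if adj c y then c else leader adj h l y

/-- The elements of `A` that no element of `l` covers. -/
noncomputable def uncovList (adj : ℕ → ℕ → Prop) (A : Finset ℕ) (l : List ℕ) : Finset ℕ :=
  A.filter fun y => ∀ n ∈ l, ¬ adj n y

theorem mem_uncovList {A : Finset ℕ} {l : List ℕ} {y : ℕ} :
    y ∈ uncovList adj A l ↔ y ∈ A ∧ ∀ n ∈ l, ¬ adj n y := by
  simp [uncovList]

@[simp] theorem uncovList_nil {A : Finset ℕ} : uncovList adj A [] = A := by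
  ext; simp [mem_uncovList]

theorem uncovList_append {A : Finset ℕ} {l : List ℕ} {f : ℕ} :
    uncovList adj A (l ++ [f]) = uncov adj (uncovList adj A l) f := by
  ext y
  simp only [mem_uncovList, mem_uncov, List.mem_append, List.mem_singleton]
  constructor
  · rintro ⟨h1, h2⟩
    exact ⟨⟨h1, fun n hn => h2 n (.inl hn)⟩, h2 f (.inr rfl)⟩
  · rintro ⟨⟨h1, h2⟩, h3⟩
    refine ⟨h1, ?_⟩
    rintro n (hn | rfl)
    · exact h2 n hn
    · exact h3

theorem leader_mem_or (h : ℕ) (l : List ℕ) (y : ℕ) : leader adj h l y ∈ l ∨ leader adj h l y = h := by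
  induction l with
  | nil => exact .inr rfl
  | cons c l ih =>
    unfold leader
    split
    · exact .inl (by simp)
    · exact ih.imp_left fun h => by simp [h]

theorem leader_mem {h : ℕ} {l : List ℕ} {y : ℕ} (hc : ∃ n ∈ l, adj n y) :
    leader adj h l y ∈ l ∧ adj (leader adj h l y) y := by
  induction l with
  | nil => simp at hc
  | cons c l ih =>
    unfold leader
    split
    · next hh => exact ⟨by simp, hh⟩
    · next hn =>
      obtain ⟨n, hn1, hn2⟩ := hc
      rw [List.mem_cons] at hn1
      have := ih ⟨n, hn1.resolve_left (by rintro rfl; exact hn hn2), hn2⟩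
      exact ⟨by simp [this.1], this.2⟩

theorem leader_eq_of_not {h : ℕ} {l : List ℕ} {y : ℕ} (hc : ∀ n ∈ l, ¬ adj n y) :
    leader adj h l y = h := by
  induction l with
  | nil => rfl
  | cons c l ih =>
    rw [leader, if_neg (hc c (by simp))]
    exact ih fun n hn => hc n (by simp [hn])

theorem leader_append {h : ℕ} {l : List ℕ} {f y : ℕ} :
    leader adj h (l ++ [f]) y =
      if ∃ n ∈ l, adj n y then leader adj h l y else if adj f y then f else h := by
  induction l with
  | nil => simp [leader]
  | cons c l ih =>
    by_cases hc : adj c y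
    · simp [leader, hc]
    · simp [leader, hc, ih]

theorem Greedy.mem {b : ℕ} {l : List ℕ} {W : Finset ℕ} (h : Greedy adj b l W) :
    ∀ c ∈ l, c ∈ W := by
  induction l generalizing b W with
  | nil => simp
  | cons c l ih =>
    obtain ⟨b', -, h1, h2⟩ := h
    intro x hx
    rw [List.mem_cons] at hx
    rcases hx with rfl | hx
    · exact h1
    · exact uncov_subset (ih h2 x hx)

theorem Greedy.nodup (hr : ∀ p, adj p p) {b : ℕ} {l : List ℕ} {W : Finset ℕ}
    (h : Greedy adj b l W) : l.Nodup := by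
  induction l generalizing b W with
  | nil => simp
  | cons c l ih =>
    obtain ⟨b', -, h1, h2⟩ := h
    refine List.nodup_cons.2 ⟨fun hc => ?_, ih h2⟩
    exact (mem_uncov.1 (h2.mem c hc)).2 (hr c)

theorem Greedy.length_le {b : ℕ} {l : List ℕ} {W : Finset ℕ} (h : Greedy adj b l W) :
    l.length ≤ b := by
  induction l generalizing b W with
  | nil => simp
  | cons c l ih =>
    obtain ⟨b', rfl, -, h2⟩ := h
    simpa using ih h2

theorem Greedy.pairwise {b : ℕ} {l : List ℕ} {W : Finset ℕ} (h : Greedy adj b l W) :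
    l.Pairwise fun p q => ¬ adj p q := by
  induction l generalizing b W with
  | nil => simp
  | cons c l ih =>
    obtain ⟨b', rfl, -, h2⟩ := h
    exact List.pairwise_cons.2 ⟨fun x hx => (mem_uncov.1 (h2.mem x hx)).2, ih h2⟩

/-- A greedy sequence ends early only if it covers everything. This yields the k centers behind the
lower bound on OPT. -/
theorem Greedy.length_eq {b : ℕ} {l : List ℕ} {W : Finset ℕ} (h : Greedy adj b l W)
    (hne : (uncovList adj W l).Nonempty) : l.length = b := by
  induction l generalizing b W with
  | nil =>
    rcases h with rfl | rfl
    · rfl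
    · simp at hne
  | cons c l ih =>
    obtain ⟨b', rfl, -, h2⟩ := h
    simp only [List.length_cons, Nat.add_right_cancel_iff]
    refine ih h2 ?_
    obtain ⟨y, hy⟩ := hne
    rw [mem_uncovList] at hy
    exact ⟨y, mem_uncovList.2 ⟨mem_uncov.2 ⟨hy.1, hy.2 c (by simp)⟩,
      fun n hn => hy.2 n (by simp [hn])⟩⟩

end Greedy

/-! ### Sweeping the old clusters -/

/-- Pour the clusters of all remaining old centers: the nodes within the radius of the node in
variable `20` go to its list, or all nodes go to the header of the level if this is `0`. -/
def sweep : Program :=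
  .setN 16 (.var 11) ;;
  .loop (.not (.natEq (.var 16) (.lit 0)))
    (.setN 19 (.var 16) ;;
     .cond (.natEq (.var 20) (.lit 0)) (.setN 21 (.var 9)) (.setN 21 (.var 16)) ;;
     pour ;;
     .setN 16 (.cell 7 (.var 16)))

/-- What `sweep` leaves unchanged. -/
structure SweepFrame (H A : Finset ℕ) (s s' : State) : Prop where
  nvar : ∀ x, x < 16 ∨ x = 20 → s'.nvar x = s.nvar x
  rvar : ∀ x, x ≠ 4 → s'.rvar x = s.rvar x
  rarr : s'.rarr = s.rarr
  arr : ∀ a, a ≠ 1 → a ≠ 2 → a ≠ 3 → a ≠ 5 → a ≠ 6 → s'.narr a = s.narr a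
  out : ∀ a i, i ∉ H → s'.narr a i = s.narr a i
  lead : ∀ i, i ∉ A → s'.narr 5 i = s.narr 5 i

theorem SweepFrame.trans {H A : Finset ℕ} {s₁ s₂ s₃ : State} (h : SweepFrame H A s₁ s₂)
    (h' : SweepFrame H A s₂ s₃) : SweepFrame H A s₁ s₃ where
  nvar x h1 := (h'.nvar x h1).trans (h.nvar x h1)
  rvar x h1 := (h'.rvar x h1).trans (h.rvar x h1)
  rarr := h'.rarr.trans h.rarr
  arr a h1 h2 h3 h4 h5 := (h'.arr a h1 h2 h3 h4 h5).trans (h.arr a h1 h2 h3 h4 h5)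
  out a i hi := (h'.out a i hi).trans (h.out a i hi)
  lead i hi := (h'.lead i hi).trans (h.lead i hi)

theorem PourFrame.sweepFrame {H A : Finset ℕ} {s s' : State} (h : PourFrame H A s s') :
    SweepFrame H A s s' where
  nvar x hx := h.nvar x (by omega) (by omega) (by omega)
  rvar := h.rvar
  rarr := h.rarr
  arr := h.arr
  out := h.out
  lead := h.lead

theorem SweepFrame.setN {H A : Finset ℕ} {s s' : State} (h : SweepFrame H A s s') (x v : ℕ)
    (hx : 16 ≤ x) (hx' : x ≠ 20) : SweepFrame H A s (s'.setN x v) where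
  nvar y hy := by
    rw [← h.nvar y hy]
    exact Function.update_of_ne (by omega) _ _
  rvar := h.rvar
  rarr := h.rarr
  arr := h.arr
  out := h.out
  lead := h.lead

theorem SweepFrame.refl (H A : Finset ℕ) (s : State) : SweepFrame H A s s :=
  (PourFrame.refl H A s).sweepFrame

variable {ans : ℕ → ℕ → ℝ → Prop} {Dst : ℕ → ℕ → ℝ} {ρ : ℝ} {N H A : Finset ℕ}

/-- With a new center `f`, the nodes that are not near `f` return to the list that they came from;
with `f = 0` all of them go to the header. In either case each cluster is poured once, and the costs
add up to the number of active nodes in all the clusters. -/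
theorem sweep_spec (h0 : 0 ∉ N) (hNH : N ⊆ H) {f h : ℕ} (hh : h ∈ H)
    (hf : f ≠ 0 → f ∈ A) (hA : A ⊆ N) (cs : List ℕ) (hcs : cs.Nodup) (hcN : ∀ c ∈ cs, c ∈ N)
    (hfc : f ∉ cs) (hhc : h ∉ cs) (s : State) (hL : Linked N H A s.narr)
    (hc : Chain (s.narr 7) (s.nvar 11) cs) (h9 : s.nvar 9 = h) (hf' : s.nvar 20 = f)
    (hρ : s.rvar 3 = ρ)
    (hans : ∀ x ∈ A, ∀ y ∈ A, ans (s.narr 8 x) (s.narr 8 y) (Dst x y)) :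
    Det ans sweep s fun s' t =>
      Linked N H A s'.narr ∧ SweepFrame H A s s' ∧
      (∀ y ∈ A, s'.narr 5 y = if s.narr 5 y ∈ cs then
        target Dst ρ f (if f = 0 then h else s.narr 5 y) y else s.narr 5 y) ∧
      t + 64 * garbage N s'.narr ≤ 64 * garbage N s.narr +
        64 * (A.filter fun y => s.narr 5 y ∈ cs).card + 50 * cs.length + 10 := by
  have main : ∀ (cs : List ℕ), cs.Nodup → (∀ c ∈ cs, c ∈ N) → f ∉ cs → h ∉ cs →
      ∀ s : State, Linked N H A s.narr → Chain (s.narr 7) (s.nvar 16) cs → s.nvar 9 = h →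
      s.nvar 20 = f → s.rvar 3 = ρ →
      (∀ x ∈ A, ∀ y ∈ A, ans (s.narr 8 x) (s.narr 8 y) (Dst x y)) →
      Det ans (.loop (.not (.natEq (.var 16) (.lit 0)))
        (.setN 19 (.var 16) ;;
        .cond (.natEq (.var 20) (.lit 0)) (.setN 21 (.var 9)) (.setN 21 (.var 16)) ;;
        pour ;;
        .setN 16 (.cell 7 (.var 16)))) s fun s' t =>
      Linked N H A s'.narr ∧ SweepFrame H A s s' ∧
      (∀ y ∈ A, s'.narr 5 y = if s.narr 5 y ∈ cs then
        target Dst ρ f (if f = 0 then h else s.narr 5 y) y else s.narr 5 y) ∧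
      t + 64 * garbage N s'.narr ≤ 64 * garbage N s.narr +
        64 * (A.filter fun y => s.narr 5 y ∈ cs).card + 50 * cs.length + 5 := by
    intro cs
    induction cs with
    | nil =>
      intro _ _ _ _ s hL hc _ _ _ _
      refine Det.loop_exit ?_ ⟨hL, .refl _ _ _, by simp, ?_⟩
      · simpa [Test.Holds, NExpr.eval, Chain] using hc
      · simp only [Test.cost, NExpr.cost]
        omega
    | cons c cs ih =>
      intro hcs hcN hfc hhc s hL hc h9 hf' hρ hans
      obtain ⟨hc16, hc0, hc⟩ := hc
      rw [List.nodup_cons] at hcs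
      simp only [List.mem_cons, not_or] at hfc hhc
      have hcH : c ∈ H := hNH (hcN c (by simp))
      refine Det.loop_step (by simpa [Test.Holds, NExpr.eval, hc16] using hc0) ?_
      set s₁ := (s.setN 19 c).setN 21 (if f = 0 then h else c) with hs₁
      have hfr₁ : SweepFrame H A s s₁ :=
        ((SweepFrame.refl H A s).setN 19 _ (by decide) (by decide)).setN 21 _ (by decide) (by decide)
      have hg : (if f = 0 then h else c) ∈ H := by split <;> assumption
      have cont : Det ans (pour ;; .setN 16 (.cell 7 (.var 16))) s₁ fun s₂ t₂ =>
          Linked N H A s₂.narr ∧ SweepFrame H A s s₂ ∧ s₂.nvar 16 = s.narr 7 c ∧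
          (∀ y ∈ A, s₂.narr 5 y = if s.narr 5 y = c then
            target Dst ρ f (if f = 0 then h else c) y else s.narr 5 y) ∧
          t₂ + 64 * garbage N s₂.narr ≤ 64 * garbage N s.narr +
            64 * (A.filter fun y => s.narr 5 y = c).card + 25 := by
        refine Det.seq ((pour_spec (s := s₁) (Dst := Dst) (ρ := ρ) (src := c) (f := f)
          (g := if f = 0 then h else c) h0 hNH hcH hg hf hA hL ?_ ?_ ?_ ?_ ?_).mono ?_)
        · simp [hs₁, State.setN]
        · simp [hs₁, State.setN, hf']
        · simp [hs₁, State.setN]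
        · exact hρ
        · exact hans
        · rintro s₂ t₂ ⟨hL₂, hfr₂, hl₂, ht₂⟩
          have hfr := hfr₁.trans hfr₂.sweepFrame
          refine Det.setN ⟨hL₂, hfr.setN 16 _ (by decide) (by decide), ?_, hl₂, ?_⟩
          · have : s₂.nvar 16 = c := by
              rw [hfr₂.nvar _ (by decide) (by decide) (by decide)]
              simp [hs₁, State.setN, hc16]
            simp only [State.setN, Function.update_self, NExpr.eval, this]
            rw [hfr₂.arr _ (by decide) (by decide) (by decide) (by decide) (by decide)]
            rfl
          · have e : garbage N (s₂.setN 16 ((NExpr.cell 7 (.var 16)).eval s₂)).narr =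
              garbage N s₂.narr := rfl
            have e' : garbage N s₁.narr = garbage N s.narr := rfl
            have e'' : s₁.narr = s.narr := rfl
            rw [e', e''] at ht₂
            rw [e]
            simp only [NExpr.cost]
            omega
      have cont' : Det ans (.setN 19 (.var 16) ;;
          .cond (.natEq (.var 20) (.lit 0)) (.setN 21 (.var 9)) (.setN 21 (.var 16)) ;;
          pour ;; .setN 16 (.cell 7 (.var 16))) s fun s₂ t₂ =>
          Linked N H A s₂.narr ∧ SweepFrame H A s s₂ ∧ s₂.nvar 16 = s.narr 7 c ∧
          (∀ y ∈ A, s₂.narr 5 y = if s.narr 5 y = c then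
            target Dst ρ f (if f = 0 then h else c) y else s.narr 5 y) ∧
          t₂ + 64 * garbage N s₂.narr ≤ 64 * garbage N s.narr +
            64 * (A.filter fun y => s.narr 5 y = c).card + 40 := by
        refine Det.seq (Det.setN (Det.seq (Det.cond (fun hb => ?_) fun hb => ?_)))
        · have hf0 : f = 0 := by simpa [Test.Holds, NExpr.eval, State.setN, hf'] using hb
          refine Det.setN ?_
          have : (s.setN 19 ((NExpr.var 16).eval s)).setN 21
              ((NExpr.var 9).eval (s.setN 19 ((NExpr.var 16).eval s))) = s₁ := by
            simp [hs₁, NExpr.eval, State.setN, h9, hc16, hf0]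
          rw [this]
          refine cont.mono ?_
          rintro s₂ t₂ ⟨a1, a2, a3, a4, a5⟩
          refine ⟨a1, a2, a3, a4, ?_⟩
          simp only [NExpr.cost, Test.cost]
          omega
        · have hf0 : f ≠ 0 := by simpa [Test.Holds, NExpr.eval, State.setN, hf'] using hb
          refine Det.setN ?_
          have : (s.setN 19 ((NExpr.var 16).eval s)).setN 21
              ((NExpr.var 16).eval (s.setN 19 ((NExpr.var 16).eval s))) = s₁ := by
            simp [hs₁, NExpr.eval, State.setN, hc16, hf0]
          rw [this]
          refine cont.mono ?_
          rintro s₂ t₂ ⟨a1, a2, a3, a4, a5⟩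
          refine ⟨a1, a2, a3, a4, ?_⟩
          simp only [NExpr.cost, Test.cost]
          omega
      refine cont'.mono ?_
      rintro s₂ t₂ ⟨hL₂, hfr₂, h16, hl₂, ht₂⟩
      have e7 : s₂.narr 7 = s.narr 7 :=
        hfr₂.arr _ (by decide) (by decide) (by decide) (by decide) (by decide)
      have e8 : s₂.narr 8 = s.narr 8 :=
        hfr₂.arr _ (by decide) (by decide) (by decide) (by decide) (by decide)
      refine (ih hcs.2 (fun x hx => hcN x (by simp [hx])) hfc.2 hhc.2 s₂ hL₂ ?_ ?_ ?_ ?_ ?_).mono ?_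
      · rw [h16, e7]
        exact hc
      · rw [hfr₂.nvar _ (by decide), h9]
      · rw [hfr₂.nvar _ (by decide), hf']
      · rw [hfr₂.rvar _ (by decide), hρ]
      · rw [e8]
        exact hans
      · rintro s₃ t₃ ⟨hL₃, hfr₃, hl₃, ht₃⟩
        -- No node is moved into a cluster that is still to be poured, so no node is paid for twice.
        have htgt : ∀ y, target Dst ρ f (if f = 0 then h else c) y ∉ cs := by
          intro y
          unfold target
          split_ifs
          · exact hfc.2
          · exact hhc.2
          · exact hcs.1
        refine ⟨hL₃, hfr₂.trans hfr₃, ?_, ?_⟩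
        · intro y hy
          rw [hl₃ y hy, hl₂ y hy]
          by_cases hyc : s.narr 5 y = c
          · simp [hyc, htgt]
          · simp [hyc]
        · have hcard : (A.filter fun y => s₂.narr 5 y ∈ cs).card +
              (A.filter fun y => s.narr 5 y = c).card ≤
              (A.filter fun y => s.narr 5 y ∈ c :: cs).card := by
            rw [← Finset.card_union_of_disjoint]
            · refine Finset.card_le_card fun y => ?_
              simp only [Finset.mem_union, Finset.mem_filter, List.mem_cons]
              rintro (⟨hy, h1⟩ | ⟨hy, h1⟩)
              · rw [hl₂ y hy] at h1
                by_cases h2 : s.narr 5 y = c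
                · rw [if_pos h2] at h1
                  exact absurd h1 (htgt y)
                · rw [if_neg h2] at h1
                  exact ⟨hy, .inr h1⟩
              · exact ⟨hy, .inl h1⟩
            · rw [Finset.disjoint_left]
              intro y
              simp only [Finset.mem_filter, not_and]
              rintro ⟨hy, h1⟩ _ h2
              rw [hl₂ y hy, if_pos h2] at h1
              exact htgt y h1
          simp only [Test.cost, NExpr.cost, List.length_cons]
          omega
  unfold sweep
  refine Det.seq (Det.setN ((main cs hcs hcN hfc hhc (s.setN 16 ((NExpr.var 11).eval s)) hL
    ?_ ?_ ?_ hρ hans).mono ?_))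
  · simpa [State.setN, NExpr.eval] using hc
  · simpa [State.setN] using h9
  · simpa [State.setN] using hf'
  · rintro s' t ⟨a1, a2, a3, a4⟩
    refine ⟨a1, ((SweepFrame.refl H A s).setN 16 _ (by decide) (by decide)).trans a2, a3, ?_⟩
    have e : garbage N (s.setN 16 ((NExpr.var 11).eval s)).narr = garbage N s.narr := rfl
    have e' : (s.setN 16 ((NExpr.var 11).eval s)).narr = s.narr := rfl
    rw [e, e'] at a4
    simp only [NExpr.cost]
    omega

end DynKCenter

namespace DynKCenter

/-! ### One level: adapting the centers -/

/-- Put the node at position `15` of the list of free nodes into variable `16`. -/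
def walk : Program :=
  .setN 16 (.cell 2 (.lit 0)) ;;
  .loop (.natLt (.lit 0) (.var 15))
    (.setN 16 (.cell 1 (.var 16)) ;; .setN 15 (.sub (.var 15) (.lit 1)))

/-- Make the free node at position `15` the next center. -/
def hit : Program :=
  walk ;;
  .setN 20 (.var 16) ;;
  .storeN 7 (.var 12) (.var 20) ;;
  .setN 12 (.var 20) ;;
  .setN 13 (.sub (.var 13) (.lit 1)) ;;
  sweep ;;
  .setN 19 (.var 9) ;;
  .setN 21 (.var 9) ;;
  pour ;;
  .setN 19 (.lit 0) ;;
  .setN 21 (.lit 0) ;;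
  pour ;;
  .storeN 4 (.var 20) (.cell 3 (.var 20))

/-- Make the old center in variable `16` the next center. -/
def keep : Program :=
  .storeN 7 (.var 12) (.var 16) ;;
  .setN 12 (.var 16) ;;
  .setN 13 (.sub (.var 13) (.lit 1)) ;;
  .setN 20 (.var 16) ;;
  .setN 19 (.lit 0) ;;
  .setN 21 (.lit 0) ;;
  pour ;;
  .storeN 4 (.var 16) (.cell 3 (.var 16))

/-- Free the cluster of the old center in variable `16`. -/
def retire : Program :=
  .setN 19 (.var 16) ;;
  .setN 20 (.lit 0) ;;
  .setN 21 (.lit 0) ;;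
  pour

/-- Proceed to the next old center. -/
def advance : Program :=
  .setN 16 (.var 11) ;;
  .setN 14 (.sub (.var 14) (.cell 4 (.var 11))) ;;
  .setN 11 (.cell 7 (.var 11)) ;;
  .cond (.natEq (.cell 5 (.var 16)) (.var 16)) keep retire

/-- Free the nodes that the old centers do not cover. -/
def release : Program :=
  .setN 19 (.var 9) ;;
  .setN 20 (.lit 0) ;;
  .setN 21 (.lit 0) ;;
  pour ;;
  .setN 14 (.lit 0)

/-- The list `l` is linked from `a` to `b`. -/
def Seg (nx : ℕ → ℕ) : ℕ → List ℕ → ℕ → Prop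
  | a, [], b => b = a
  | a, y :: l, b => nx a = y ∧ Seg nx y l b

theorem Seg.last_mem {nx : ℕ → ℕ} {a b : ℕ} {l : List ℕ} (h : Seg nx a l b) : b ∈ a :: l := by
  induction l generalizing a with
  | nil => simp [show b = a from h]
  | cons y l ih => exact List.mem_cons_of_mem _ (ih h.2)

/-- The nodes are distinct, so overwriting the link of the last one leaves the earlier links intact.
-/
theorem Seg.snoc {nx : ℕ → ℕ} {a b : ℕ} {l : List ℕ} (h : Seg nx a l b) (hn : (a :: l).Nodup)
    (f : ℕ) : Seg (Function.update nx b f) a (l ++ [f]) f := by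
  induction l generalizing a with
  | nil =>
    obtain rfl : b = a := h
    simp [Seg]
  | cons y l ih =>
    rw [List.nodup_cons] at hn
    have hb := h.2.last_mem
    refine ⟨?_, ih h.2 hn.2⟩
    rw [Function.update_of_ne]
    · exact h.1
    · rintro rfl
      exact hn.1 hb

theorem Seg.close {nx : ℕ → ℕ} {a b : ℕ} {l : List ℕ} (h : Seg nx a l b) (hn : (a :: l).Nodup)
    (h0 : 0 ∉ l) : Chain (Function.update nx b 0) (Function.update nx b 0 a) l := by
  induction l generalizing a with
  | nil =>
    obtain rfl : b = a := h
    simp [Chain]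
  | cons y l ih =>
    rw [List.nodup_cons] at hn
    have hb := h.2.last_mem
    rw [Function.update_of_ne (by rintro rfl; exact hn.1 hb), h.1]
    refine ⟨rfl, ?_, ih h.2 hn.2 fun hh => h0 (by simp [hh])⟩
    rintro rfl
    exact h0 (by simp)

variable {ans : ℕ → ℕ → ℝ → Prop}

/-- There is no random access to a linked list. A walk linear in the position is affordable, because
a new center has to inspect the whole free list anyway. -/
theorem walk_spec {s : State} {l : List ℕ} {v : ℕ} (hc : Chain (s.narr 1) (s.narr 2 0) l)
    (hv : s.nvar 15 = v) (hvl : v < l.length) :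
    Det ans walk s fun s' t => s' = (s.setN 15 0).setN 16 l[v] ∧ t ≤ 20 * v + 10 := by
  have main : ∀ (v : ℕ) (l : List ℕ) (s : State) (hvl : v < l.length),
      Chain (s.narr 1) (s.nvar 16) l → s.nvar 15 = v →
      Det ans (.loop (.natLt (.lit 0) (.var 15))
        (.setN 16 (.cell 1 (.var 16)) ;; .setN 15 (.sub (.var 15) (.lit 1)))) s
        fun s' t => s' = (s.setN 15 0).setN 16 l[v] ∧ t ≤ 20 * v + 5 := by
    intro v
    induction v with
    | zero =>
      intro l s hvl hc hv
      refine Det.loop_exit (by simp [Test.Holds, NExpr.eval, hv]) ⟨?_, by simp [Test.cost, NExpr.cost]⟩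
      match l, hc with
      | y :: l, hc =>
        obtain ⟨h1, -, -⟩ := hc
        rcases s with ⟨nv, na, rv, ra⟩
        simp only [State.setN, List.getElem_cons_zero, State.mk.injEq, and_true]
        simp only at h1 hv
        ext x
        simp only [Function.update_apply]
        split_ifs with h h'
        · rw [h, h1]
        · rw [h', hv]
        · rfl
    | succ v ih =>
      intro l s hvl hc hv
      match l, hc with
      | y :: l, hc =>
        obtain ⟨h1, -, hc⟩ := hc
        refine Det.loop_step (by simp [Test.Holds, NExpr.eval, hv]) (Det.seq (Det.setN (Det.setN ?_)))
        have := ih l (((s.setN 16 ((NExpr.cell 1 (.var 16)).eval s))).setN 15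
          ((NExpr.sub (.var 15) (.lit 1)).eval (s.setN 16 ((NExpr.cell 1 (.var 16)).eval s))))
          (by simpa using hvl) (by simpa [State.setN, NExpr.eval, h1] using hc)
          (by simp [State.setN, NExpr.eval, hv])
        refine this.mono ?_
        rintro s' t ⟨rfl, ht⟩
        constructor
        · rcases s with ⟨nv, na, rv, ra⟩
          simp only [State.setN, List.getElem_cons_succ, State.mk.injEq, and_true]
          ext x
          simp only [Function.update_apply]
          split_ifs <;> rfl
        · simp only [Test.cost, NExpr.cost]
          omega
  unfold walk
  refine Det.seq (Det.setN ((main v l (s.setN 16 ((NExpr.cell 2 (.lit 0)).eval s)) hvl ?_ ?_).mono ?_))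
  · simpa [State.setN, NExpr.eval] using hc
  · simpa [State.setN] using hv
  · rintro s' t ⟨rfl, ht⟩
    constructor
    · rcases s with ⟨nv, na, rv, ra⟩
      simp only [State.setN, State.mk.injEq, and_true]
      ext x
      simp only [Function.update_apply]
      split_ifs <;> rfl
    · simp only [NExpr.cost]
      omega

section Level
open Classical

variable {Dst : ℕ → ℕ → ℝ} {ρ : ℝ} {N A : Finset ℕ} {h k : ℕ}

/-- Two nodes of a level are near if their distance is at most the radius of the level. -/
def Near (Dst : ℕ → ℕ → ℝ) (ρ : ℝ) (x y : ℕ) : Prop :=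
  Dst x y ≤ ρ

/-- The headers of lists: `0` for the free nodes, `h` for the uncovered nodes, and the centers. -/
def headers (N : Finset ℕ) (h : ℕ) : Finset ℕ :=
  insert 0 (insert h N)

/-- The general assumptions about a level with the header `h`, the nodes `N`, the active nodes `A`
and the radius `ρ`. -/
structure LevelData (Dst : ℕ → ℕ → ℝ) (ρ : ℝ) (N A : Finset ℕ) (h : ℕ) : Prop where
  header_ne : h ≠ 0
  zero_notMem : 0 ∉ N
  header_notMem : h ∉ N
  subset : A ⊆ N
  symm : ∀ x y, Near Dst ρ x y → Near Dst ρ y x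
  refl : ∀ x, Near Dst ρ x x

/-- The list that contains the node `y` after the new centers `ns` were found and while the old
centers `cs`, which cover a part of `W`, remain. -/
noncomputable def leadOf (adj : ℕ → ℕ → Prop) (h : ℕ) (ns cs : List ℕ) (W : Finset ℕ) (y : ℕ) : ℕ :=
  if ∃ n ∈ ns, adj n y then leader adj h ns y else if y ∈ W then leader adj h cs y else 0

/-- What processing a level leaves unchanged. -/
structure LevelFrame (H : Finset ℕ) (s s' : State) : Prop where
  nvar : ∀ x, x ≤ 10 → s'.nvar x = s.nvar x
  rvar : ∀ x, x ≠ 4 → s'.rvar x = s.rvar x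
  rarr : s'.rarr = s.rarr
  arr : ∀ a, a = 0 ∨ 8 ≤ a → s'.narr a = s.narr a
  out : ∀ a i, i ∉ H → s'.narr a i = s.narr a i

theorem LevelFrame.refl (H : Finset ℕ) (s : State) : LevelFrame H s s :=
  ⟨fun _ _ => rfl, fun _ _ => rfl, rfl, fun _ _ => rfl, fun _ _ _ => rfl⟩

theorem LevelFrame.trans {H : Finset ℕ} {s₁ s₂ s₃ : State} (h : LevelFrame H s₁ s₂)
    (h' : LevelFrame H s₂ s₃) : LevelFrame H s₁ s₃ where
  nvar x h1 := (h'.nvar x h1).trans (h.nvar x h1)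
  rvar x h1 := (h'.rvar x h1).trans (h.rvar x h1)
  rarr := h'.rarr.trans h.rarr
  arr a h1 := (h'.arr a h1).trans (h.arr a h1)
  out a i hi := (h'.out a i hi).trans (h.out a i hi)

theorem SweepFrame.levelFrame {H A : Finset ℕ} {s s' : State} (h : SweepFrame H A s s') :
    LevelFrame H s s' where
  nvar x hx := h.nvar x (by omega)
  rvar := h.rvar
  rarr := h.rarr
  arr a ha := h.arr a (by omega) (by omega) (by omega) (by omega) (by omega)
  out := h.out

theorem LevelFrame.setN {H : Finset ℕ} {s s' : State} (h : LevelFrame H s s') {x v : ℕ}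
    (hx : 11 ≤ x) : LevelFrame H s (s'.setN x v) where
  nvar y hy := by
    rw [← h.nvar y hy]
    exact Function.update_of_ne (by omega) _ _
  rvar := h.rvar
  rarr := h.rarr
  arr := h.arr
  out := h.out

theorem LevelFrame.storeN {H : Finset ℕ} {s s' : State} (h : LevelFrame H s s') {a i v : ℕ}
    (ha : 1 ≤ a ∧ a ≤ 7) (hi : i ∈ H) : LevelFrame H s (s'.storeN a i v) where
  nvar := h.nvar
  rvar := h.rvar
  rarr := h.rarr
  arr b hb := by
    rw [← h.arr b hb]
    exact Function.update_of_ne (by omega) _ _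
  out b j hj := by
    rw [State.narr_storeN_of_ne (by rintro rfl; exact hj hi)]
    exact h.out b j hj

/-- The memory while a level is processed: the new centers `ns` were found, at most `a` more are
allowed, and the old centers `cs` for the nodes `W` remain. -/
structure Mid (ans : ℕ → ℕ → ℝ → Prop) (Dst : ℕ → ℕ → ℝ) (ρ : ℝ) (N A : Finset ℕ) (h k : ℕ)
    (s : State) (a : ℕ) (ns cs : List ℕ) (W : Finset ℕ) : Prop where
  linked : Linked N (headers N h) A s.narr
  lead : ∀ y ∈ A, s.narr 5 y = leadOf (Near Dst ρ) h ns cs W y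
  budget : s.nvar 13 = a
  oldCard : s.nvar 14 = W.card
  header : s.nvar 9 = h
  oldChain : Chain (s.narr 7) (s.nvar 11) cs
  newSeg : Seg (s.narr 7) h ns (s.nvar 12)
  -- These are cluster sizes with respect to the old set, stored when the clusters were formed.
  -- Unlike the counts in array `3` they do not change while nodes move or when a point is deleted,
  -- so the cardinality of `W` can be updated by subtraction.
  oldSize : ∀ c ∈ cs, s.narr 4 c = (W.filter fun y => leader (Near Dst ρ) h cs y = c).card
  newSize : ∀ c ∈ ns, s.narr 4 c = (A.filter fun y => leader (Near Dst ρ) h ns y = c).card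
  oldGreedy : ∃ b, Greedy (Near Dst ρ) b cs W
  -- A prefix of a greedy sequence is described by its continuations, since it need not be greedy by
  -- itself before it is complete.
  newGreedy : ∀ l, Greedy (Near Dst ρ) a l (uncovList (Near Dst ρ) A ns) →
    Greedy (Near Dst ρ) k (ns ++ l) A
  newNotMem : ∀ n ∈ ns, n ∉ W
  newMem : ∀ n ∈ ns, n ∈ A
  newNodup : ns.Nodup
  oldSubset : W ⊆ N
  -- A deleted old center thus fails the test of leading itself.
  deleted : ∀ z ∈ W, z ∉ A → s.narr 5 z = 0
  radius : s.rvar 3 = ρ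
  oracle : ∀ x ∈ A, ∀ y ∈ A, ans (s.narr 8 x) (s.narr 8 y) (Dst x y)

theorem subset_headers : N ⊆ headers N h := fun x hx => by simp [headers, hx]

theorem LevelData.ne_zero (hD : LevelData Dst ρ N A h) {y : ℕ} (hy : y ∈ N) : y ≠ 0 := by
  rintro rfl; exact hD.zero_notMem hy

theorem LevelData.ne_header (hD : LevelData Dst ρ N A h) {y : ℕ} (hy : y ∈ N) : y ≠ h := by
  rintro rfl; exact hD.header_notMem hy

theorem leader_ne_zero (hD : LevelData Dst ρ N A h) {cs : List ℕ} (hcs : ∀ c ∈ cs, c ∈ N) (y : ℕ) :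
    leader (Near Dst ρ) h cs y ≠ 0 := by
  rcases leader_mem_or (adj := Near Dst ρ) h cs y with hh | hh
  · exact hD.ne_zero (hcs _ hh)
  · rw [hh]
    exact hD.header_ne

theorem Mid.old_mem {s : State} {a : ℕ} {ns cs : List ℕ} {W : Finset ℕ}
    (hM : Mid ans Dst ρ N A h k s a ns cs W) : ∀ c ∈ cs, c ∈ W := by
  obtain ⟨b, hb⟩ := hM.oldGreedy
  exact hb.mem

/-- A new center is found. -/
theorem Mid.push (hD : LevelData Dst ρ N A h) {s s' : State} {a f : ℕ} {ns cs cs' : List ℕ} {W W' : Finset ℕ}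
    (hM : Mid ans Dst ρ N A h k s (a + 1) ns cs W) (hf : f ∈ uncovList (Near Dst ρ) A ns)
    (hcs : ∀ c ∈ cs', c ∈ cs) (hW : W' ⊆ W) (hfW : f ∉ W')
    (hG : ∃ b, Greedy (Near Dst ρ) b cs' W')
    (hsiz : ∀ c ∈ cs', (W'.filter fun y => leader (Near Dst ρ) h cs' y = c).card =
      (W.filter fun y => leader (Near Dst ρ) h cs y = c).card)
    (hL : Linked N (headers N h) A s'.narr)
    (hlead : ∀ y ∈ A, s'.narr 5 y = leadOf (Near Dst ρ) h (ns ++ [f]) cs' W' y)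
    (h13 : s'.nvar 13 = a) (h14 : s'.nvar 14 = W'.card) (h9 : s'.nvar 9 = h)
    (h11 : Chain (s.narr 7) (s'.nvar 11) cs') (h12 : s'.nvar 12 = f)
    (h7 : s'.narr 7 = Function.update (s.narr 7) (s.nvar 12) f)
    (h4 : s'.narr 4 = Function.update (s.narr 4) f (s'.narr 3 f)) (h8 : s'.narr 8 = s.narr 8)
    (h5 : ∀ z, z ∉ A → s'.narr 5 z = s.narr 5 z) (h3 : s'.rvar 3 = s.rvar 3) :
    Mid ans Dst ρ N A h k s' a (ns ++ [f]) cs' W' := by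
  have hfA : f ∈ A := (mem_uncovList.1 hf).1
  have hfN : f ∈ N := hD.subset hfA
  have hfns : f ∉ ns := fun hh => (mem_uncovList.1 hf).2 f hh (hD.refl f)
  have hcsW : ∀ c ∈ cs', c ∈ W' := by
    obtain ⟨b, hb⟩ := hG
    exact hb.mem
  have hfcs : f ∉ cs' := fun hh => hfW (hcsW f hh)
  have hnd : (h :: ns).Nodup :=
    List.nodup_cons.2 ⟨fun hh => hD.header_notMem (hD.subset (hM.newMem h hh)), hM.newNodup⟩
  have hlast := hM.newSeg.last_mem
  -- The list of the new centers grows at its end, in the same array that links the old centers. The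
  -- cell written belongs to the header or to a new center, never to a remaining old one.
  have hlcs : ∀ c ∈ cs', c ≠ s.nvar 12 := by
    rintro c hc rfl
    rw [List.mem_cons] at hlast
    rcases hlast with hh | hh
    · rw [hh] at hc
      exact hD.header_notMem (hM.oldSubset (hW (hcsW _ hc)))
    · exact hM.newNotMem _ hh (hW (hcsW _ hc))
  refine ⟨hL, hlead, h13, h14, h9, ?_, ?_, ?_, ?_, hG, ?_, ?_, ?_, ?_, ?_, ?_, ?_, ?_⟩
  · rw [h7]
    exact h11.congr fun y hy => Function.update_of_ne (hlcs y hy) _ _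
  · rw [h7, h12]
    exact hM.newSeg.snoc hnd f
  · intro c hc
    rw [h4, Function.update_of_ne (by rintro rfl; exact hfcs hc), hM.oldSize c (hcs c hc), hsiz c hc]
  · intro n hn
    rw [h4]
    rw [List.mem_append, List.mem_singleton] at hn
    rcases hn with hn | rfl
    · have hnf : n ≠ f := by rintro rfl; exact hfns hn
      rw [Function.update_of_ne hnf, hM.newSize n hn]
      congr 1
      refine Finset.filter_congr fun y hy => ?_
      rw [leader_append]
      by_cases hcov : ∃ m ∈ ns, Near Dst ρ m y
      · rw [if_pos hcov]
      · have hnh : h ≠ n := (hD.ne_header (hD.subset (hM.newMem n hn))).symm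
        rw [if_neg hcov, leader_eq_of_not (by simpa using hcov)]
        split_ifs
        · exact ⟨fun hh => absurd hh hnh, fun hh => absurd hh.symm hnf⟩
        · exact Iff.rfl
    -- The size of the new cluster is the count of its list: at this moment array `5` names `f`
    -- exactly for the active nodes whose first covering center is `f`.
    · rw [Function.update_self, hL.count (subset_headers hfN)]
      congr 1
      refine Finset.filter_congr fun y hy => ?_
      rw [hlead y hy, leadOf]
      by_cases hcov : ∃ m ∈ ns ++ [n], Near Dst ρ m y
      · rw [if_pos hcov]
      · have e : leader (Near Dst ρ) h (ns ++ [n]) y = h := leader_eq_of_not fun m hm hmy =>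
          hcov ⟨m, hm, hmy⟩
        rw [if_neg hcov, e]
        have hnh : h ≠ n := (hD.ne_header hfN).symm
        refine ⟨fun hh => ?_, fun hh => absurd hh hnh⟩
        split_ifs at hh
        · rcases leader_mem_or (adj := Near Dst ρ) h cs' y with h' | h'
          · rw [hh] at h'
            exact absurd h' hfcs
          · exact h'.symm.trans hh
        · exact absurd hh (hD.ne_zero hfN).symm
  · intro l hl
    rw [List.append_assoc]
    refine hM.newGreedy _ ⟨a, rfl, hf, ?_⟩
    rwa [uncovList_append] at hl
  · intro n hn
    rw [List.mem_append, List.mem_singleton] at hn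
    rcases hn with hn | rfl
    · exact fun hh => hM.newNotMem n hn (hW hh)
    · exact hfW
  · intro n hn
    rw [List.mem_append, List.mem_singleton] at hn
    rcases hn with hn | rfl
    · exact hM.newMem n hn
    · exact hfA
  · rw [List.nodup_append]
    refine ⟨hM.newNodup, by simp, ?_⟩
    simp only [List.mem_singleton]
    rintro x hx y rfl rfl
    exact hfns hx
  · exact hW.trans hM.oldSubset
  · intro z hz hzA
    rw [h5 z hzA]
    exact hM.deleted z (hW hz) hzA
  · rw [h3, hM.radius]
  · rw [h8]
    exact hM.oracle

/-- The nodes in lists other than those of the new centers are uncovered. -/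
theorem Mid.card_le {s : State} {a : ℕ} {ns cs : List ℕ} {W : Finset ℕ}
    (hM : Mid ans Dst ρ N A h k s a ns cs W) (p : ℕ → Prop) (hp : ∀ n ∈ ns, ¬ p n) :
    (A.filter fun y => p (s.narr 5 y)).card ≤ (uncovList (Near Dst ρ) A ns).card := by
  refine Finset.card_le_card fun y => ?_
  rw [Finset.mem_filter, mem_uncovList]
  rintro ⟨hy, h1⟩
  refine ⟨hy, fun n hn hny => ?_⟩
  rw [hM.lead y hy, leadOf, if_pos ⟨n, hn, hny⟩] at h1
  exact hp _ (leader_mem ⟨n, hn, hny⟩).1 h1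

/-- Neither a center nor the header is `0`, so the entry `0` marks exactly the active nodes that no
new center covers and that do not belong to `W`. -/
theorem Mid.free_iff (hD : LevelData Dst ρ N A h) {s : State} {a : ℕ} {ns cs : List ℕ} {W : Finset ℕ}
    (hM : Mid ans Dst ρ N A h k s a ns cs W) {y : ℕ} (hy : y ∈ A) :
    s.narr 5 y = 0 ↔ y ∈ uncovList (Near Dst ρ) A ns \ W := by
  rw [hM.lead y hy, leadOf, Finset.mem_sdiff, mem_uncovList]
  have h1 := leader_ne_zero hD (fun c hc => hD.subset (hM.newMem c hc)) (cs := ns) y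
  have h2 := leader_ne_zero hD (fun c hc => hM.oldSubset (hM.old_mem c hc)) (cs := cs) y
  by_cases hcov : ∃ n ∈ ns, Near Dst ρ n y
  · rw [if_pos hcov]
    refine ⟨fun hh => absurd hh h1, fun hh => ?_⟩
    obtain ⟨n, hn, hny⟩ := hcov
    exact absurd hny (hh.1.2 n hn)
  · rw [if_neg hcov]
    split_ifs with hyW
    · exact ⟨fun hh => absurd hh h2, fun hh => absurd hyW hh.2⟩
    · simp only [true_iff]
      exact ⟨⟨hy, by simpa using hcov⟩, hyW⟩

end Level

end DynKCenter

/-! ### A free node becomes the next center -/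

namespace DynKCenter

variable {ans : ℕ → ℕ → ℝ → Prop}

section Level
open Classical

variable {Dst : ℕ → ℕ → ℝ} {ρ : ℝ} {N A : Finset ℕ} {h k : ℕ}

theorem Linked.congr {H : Finset ℕ} {m m' : ℕ → ℕ → ℕ} (hL : Linked N H A m) (h1 : m' 1 = m 1)
    (h2 : m' 2 = m 2) (h3 : m' 3 = m 3) (h5 : m' 5 = m 5) (h6 : m' 6 = m 6) :
    Linked N H A m' := by
  obtain ⟨Lst, hL⟩ := hL
  refine ⟨Lst, ?_, hL.sub, hL.nodup, hL.disj, ?_, ?_, ?_, ?_, hL.restSub, ?_, ?_, hL.restDisj,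
    hL.restNodup⟩
  · rw [h1, h2]; exact hL.chain
  · rw [h3]; exact hL.count
  · rw [h5]; exact hL.lead
  · rw [h5]; exact hL.alive
  · rw [h5, h6]; exact hL.dead
  · simp
  · simp

theorem target_zero {g y : ℕ} : target Dst ρ 0 g y = g := by simp [target]

theorem target_of_near {f g y : ℕ} (hf : f ≠ 0) (hn : Near Dst ρ f y) :
    target Dst ρ f g y = f := by
  rw [target, if_pos ⟨hf, hn⟩]

theorem target_of_not_near {f g y : ℕ} (hn : ¬ Near Dst ρ f y) :
    target Dst ρ f g y = g := by
  rw [target, if_neg fun hh => hn hh.2]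

theorem header_mem_headers : h ∈ headers N h := by simp [headers]

theorem zero_mem_headers : 0 ∈ headers N h := by simp [headers]

theorem Mid.last_mem_headers (hD : LevelData Dst ρ N A h) {s : State} {a : ℕ} {ns cs : List ℕ}
    {W : Finset ℕ} (hM : Mid ans Dst ρ N A h k s a ns cs W) : s.nvar 12 ∈ headers N h := by
  have := hM.newSeg.last_mem
  rw [List.mem_cons] at this
  rcases this with hh | hh
  · rw [hh]
    exact header_mem_headers
  · exact subset_headers (hD.subset (hM.newMem _ hh))

theorem Mid.last_notMem (hD : LevelData Dst ρ N A h) {s : State} {a : ℕ} {ns cs : List ℕ}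
    {W : Finset ℕ} (hM : Mid ans Dst ρ N A h k s a ns cs W) : s.nvar 12 ∉ cs := by
  intro hc
  have := hM.newSeg.last_mem
  rw [List.mem_cons] at this
  rcases this with hh | hh
  · rw [hh] at hc
    exact hD.header_notMem (hM.oldSubset (hM.old_mem _ hc))
  · exact hM.newNotMem _ hh (hM.old_mem _ hc)

/-- Any node that the new centers do not cover may be near `f`, so the remaining old clusters, the
list of the header and the free list are all searched. Their active nodes are uncovered by `ns`,
which bounds the cost by a multiple of `|W ∪ U|`. The set `W` stays, because no old center is
revealed. -/
theorem hit_spec (hD : LevelData Dst ρ N A h) {s : State} {a f v : ℕ} {ns cs l : List ℕ}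
    {W : Finset ℕ} (hM : Mid ans Dst ρ N A h k s (a + 1) ns cs W)
    (hl : Chain (s.narr 1) (s.narr 2 0) l) (hv : s.nvar 15 = v) (hvl : v < l.length)
    (hlen : l.length ≤ (uncovList (Near Dst ρ) A ns).card)
    (hlv : l[v] = f) (hf : f ∈ uncovList (Near Dst ρ) A ns \ W) :
    Det ans hit s fun s' t =>
      Mid ans Dst ρ N A h k s' a (ns ++ [f]) cs W ∧ LevelFrame (headers N h) s s' ∧
      t + 64 * garbage N s'.narr ≤
        64 * garbage N s.narr + 500 * (W ∪ uncovList (Near Dst ρ) A ns).card := by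
  rw [Finset.mem_sdiff] at hf
  have hfA : f ∈ A := (mem_uncovList.1 hf.1).1
  have hfN : f ∈ N := hD.subset hfA
  have hf0 : f ≠ 0 := hD.ne_zero hfN
  have hfh : f ≠ h := hD.ne_header hfN
  have hfcs : f ∉ cs := fun hh => hf.2 (hM.old_mem f hh)
  have hfns : f ∉ ns := fun hh => (mem_uncovList.1 hf.1).2 f hh (hD.refl f)
  have hhcs : h ∉ cs := fun hh => hD.header_notMem (hM.oldSubset (hM.old_mem h hh))
  have h0cs : 0 ∉ cs := fun hh => hD.zero_notMem (hM.oldSubset (hM.old_mem 0 hh))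
  have hcsN : ∀ c ∈ cs, c ∈ N := fun c hc => hM.oldSubset (hM.old_mem c hc)
  have hcsnd : cs.Nodup := by
    obtain ⟨b, hb⟩ := hM.oldGreedy
    exact hb.nodup hD.refl
  have hcslen : cs.length ≤ W.card := by
    rw [← List.toFinset_card_of_nodup hcsnd]
    exact Finset.card_le_card fun x hx => hM.old_mem x (List.mem_toFinset.1 hx)
  set N' := (W ∪ uncovList (Near Dst ρ) A ns).card with hN'
  have hUN : (uncovList (Near Dst ρ) A ns).card ≤ N' := Finset.card_le_card Finset.subset_union_right
  have hWN : W.card ≤ N' := Finset.card_le_card Finset.subset_union_left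
  have hN1 : 1 ≤ N' := le_trans (Finset.card_pos.2 ⟨f, hf.1⟩) hUN
  unfold hit
  refine Det.seq ((walk_spec hl hv hvl).mono ?_)
  rintro s₁ t₁ ⟨rfl, ht₁⟩
  rw [hlv]
  refine Det.seq (Det.setN (Det.seq (Det.storeN (Det.seq (Det.setN (Det.seq (Det.setN
    (Det.seq ?_))))))))
  set s₂ : State := ((((((s.setN 15 0).setN 16 f).setN 20 f).storeN 7 (s.nvar 12) f).setN 12 f).setN
    13 a) with hs₂
  have hb := hM.budget
  have h7 : s₂.narr 7 = Function.update (s.narr 7) (s.nvar 12) f := by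
    simp [hs₂, State.setN, State.storeN]
  have hne : ∀ b, b ≠ 7 → s₂.narr b = s.narr b := by
    intro b hb
    simp [hs₂, State.setN, State.storeN, hb]
  have hnv : ∀ x, x ≤ 11 ∨ x = 14 → s₂.nvar x = s.nvar x := by
    intro x hx
    have h1 : x ≠ 12 := by omega
    have h2 : x ≠ 13 := by omega
    have h3 : x ≠ 15 := by omega
    have h4 : x ≠ 16 := by omega
    have h5 : x ≠ 20 := by omega
    simp [hs₂, State.setN, State.storeN, h1, h2, h3, h4, h5]
  have hlf₂ : LevelFrame (headers N h) s s₂ :=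
    (((((LevelFrame.refl _ s).setN (by decide)).setN (by decide)).setN (by decide)).storeN
      (by decide) (hM.last_mem_headers hD)).setN (by decide) |>.setN (by decide)
  have hL₂ : Linked N (headers N h) A s₂.narr := hM.linked.congr (hne 1 (by decide))
    (hne 2 (by decide)) (hne 3 (by decide)) (hne 5 (by decide)) (hne 6 (by decide))
  have hstate : ∀ x : State, x = s₂ → ∀ q Q, Det ans q s₂ Q → Det ans q x Q := by
    rintro x rfl q Q hq
    exact hq
  refine hstate _ ?_ _ _ ?_
  · rw [hs₂]
    simp [NExpr.eval, State.setN, State.storeN, hb]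
  refine (sweep_spec (Dst := Dst) (ρ := ρ) (f := f) (h := h) hD.zero_notMem subset_headers
    header_mem_headers (fun _ => hfA) hD.subset cs hcsnd hcsN hfcs hhcs s₂ hL₂ ?_ ?_ ?_ ?_ ?_).mono ?_
  · rw [h7, hnv 11 (by decide)]
    refine hM.oldChain.congr fun y hy => Function.update_of_ne ?_ _ _
    rintro rfl
    exact hM.last_notMem hD hy
  · rw [hnv 9 (by decide), hM.header]
  · simp [hs₂, State.setN, State.storeN]
  · exact hM.radius
  · rw [hne 8 (by decide)]
    exact hM.oracle
  rintro s₃ t₃ ⟨hL₃, hfr₃, hl₃, ht₃⟩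
  have e8 : s₃.narr 8 = s.narr 8 := by
    rw [hfr₃.arr _ (by decide) (by decide) (by decide) (by decide) (by decide), hne 8 (by decide)]
  have n20 : s₃.nvar 20 = f := by
    rw [hfr₃.nvar _ (by decide)]
    simp [hs₂, State.setN, State.storeN]
  have n9 : s₃.nvar 9 = h := by
    rw [hfr₃.nvar _ (by decide), hnv 9 (by decide), hM.header]
  have r3 : s₃.rvar 3 = ρ := by
    rw [hfr₃.rvar _ (by decide)]
    exact hM.radius
  refine Det.seq (Det.setN (Det.seq (Det.setN (Det.seq ((pour_spec (H := headers N h) (Dst := Dst) (ρ := ρ) (src := h)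
    (f := f) (g := h) hD.zero_notMem subset_headers header_mem_headers header_mem_headers
    (fun _ => hfA) hD.subset (N := N) ?_ ?_ ?_ ?_ ?_ ?_).mono ?_)))))
  · exact hL₃
  · simp [State.setN, NExpr.eval, n9]
  · simp [State.setN, n20]
  · simp [State.setN, NExpr.eval, n9]
  · exact r3
  · show ∀ x ∈ A, ∀ y ∈ A, ans (s₃.narr 8 x) (s₃.narr 8 y) (Dst x y)
    rw [e8]
    exact hM.oracle
  rintro s₄ t₄ ⟨hL₄, hfr₄, hl₄, ht₄⟩
  have hl₄' : ∀ y ∈ A, s₄.narr 5 y =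
    if s₃.narr 5 y = h then target Dst ρ f h y else s₃.narr 5 y := hl₄
  have ht₄' : t₄ + 64 * garbage N s₄.narr ≤ 64 * garbage N s₃.narr +
        64 * (A.filter fun y => s₃.narr 5 y = h).card + 20 := ht₄
  have hfr₄' : SweepFrame (headers N h) A s₃ s₄ :=
    (((SweepFrame.refl _ A s₃).setN 19 _ (by decide) (by decide)).setN 21 _ (by decide)
      (by decide)).trans hfr₄.sweepFrame
  refine Det.seq (Det.setN (Det.seq (Det.setN (Det.seq ((pour_spec (H := headers N h) (Dst := Dst) (ρ := ρ) (src := 0)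
    (f := f) (g := 0) hD.zero_notMem subset_headers zero_mem_headers zero_mem_headers
    (fun _ => hfA) hD.subset (N := N) ?_ ?_ ?_ ?_ ?_ ?_).mono ?_)))))
  · exact hL₄
  · simp [State.setN, NExpr.eval]
  · have := hfr₄'.nvar 20 (by decide)
    simp [State.setN, this, n20]
  · simp [State.setN, NExpr.eval]
  · rw [← r3]
    exact hfr₄'.rvar 3 (by decide)
  · show ∀ x ∈ A, ∀ y ∈ A, ans (s₄.narr 8 x) (s₄.narr 8 y) (Dst x y)
    rw [hfr₄'.arr _ (by decide) (by decide) (by decide) (by decide) (by decide), e8]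
    exact hM.oracle
  rintro s₅ t₅ ⟨hL₅, hfr₅, hl₅, ht₅⟩
  have hl₅' : ∀ y ∈ A, s₅.narr 5 y =
    if s₄.narr 5 y = 0 then target Dst ρ f 0 y else s₄.narr 5 y := hl₅
  have ht₅' : t₅ + 64 * garbage N s₅.narr ≤ 64 * garbage N s₄.narr +
        64 * (A.filter fun y => s₄.narr 5 y = 0).card + 20 := ht₅
  have hfr₅' : SweepFrame (headers N h) A s₄ s₅ :=
    (((SweepFrame.refl _ A s₄).setN 19 _ (by decide) (by decide)).setN 21 _ (by decide)
      (by decide)).trans hfr₅.sweepFrame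
  have hfr : SweepFrame (headers N h) A s₂ s₅ := (hfr₃.trans hfr₄').trans hfr₅'
  have n20' : s₅.nvar 20 = f := by
    rw [hfr.nvar _ (by decide)]
    simp [hs₂, State.setN, State.storeN]
  have harr : ∀ b, b ≠ 1 → b ≠ 2 → b ≠ 3 → b ≠ 5 → b ≠ 6 → b ≠ 7 → s₅.narr b = s.narr b := by
    intro b h1 h2 h3 h5 h6 h7
    rw [hfr.arr b h1 h2 h3 h5 h6, hne b h7]
  have hl₃' : ∀ y ∈ A, s₃.narr 5 y = if s.narr 5 y ∈ cs then
        target Dst ρ f (s.narr 5 y) y else s.narr 5 y := by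
    intro y hy
    rw [hl₃ y hy, hne 5 (by decide), if_neg hf0]
  -- The three kinds of pours act on disjoint sets of lists and combine to one rule: an uncovered
  -- node near `f` moves to `f`, all others keep their lists.
  have hlead : ∀ y ∈ A, s₅.narr 5 y = leadOf (Near Dst ρ) h (ns ++ [f]) cs W y := by
    intro y hy
    rw [hl₅' y hy, hl₄' y hy, hl₃' y hy, hM.lead y hy]
    by_cases hcov : ∃ n ∈ ns, Near Dst ρ n y
    · have hm := (leader_mem (h := h) hcov).1
      have hcov' : ∃ n ∈ ns ++ [f], Near Dst ρ n y := by
        obtain ⟨n, hn, hny⟩ := hcov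
        exact ⟨n, by simp [hn], hny⟩
      rw [leadOf, if_pos hcov, leadOf, if_pos hcov', leader_append, if_pos hcov]
      have hmA := hM.newMem _ hm
      rw [if_neg fun hh => hM.newNotMem _ hm (hM.old_mem _ hh),
        if_neg (hD.ne_header (hD.subset hmA)), if_neg (hD.ne_zero (hD.subset hmA))]
    · by_cases hfy : Near Dst ρ f y
      · have hcov' : ∃ n ∈ ns ++ [f], Near Dst ρ n y := ⟨f, by simp, hfy⟩
        simp only [target_of_near hf0 hfy]
        rw [leadOf, if_neg hcov, leadOf, if_pos hcov', leader_append, if_neg hcov, if_pos hfy]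
        split_ifs <;> simp_all
        · next h1 _ _ => rcases leader_mem_or (adj := Near Dst ρ) h cs y with h' | h' <;> simp_all
      · have hcov' : ¬ ∃ n ∈ ns ++ [f], Near Dst ρ n y := by
          rintro ⟨n, hn, hny⟩
          rw [List.mem_append, List.mem_singleton] at hn
          rcases hn with hn | rfl
          · exact hcov ⟨n, hn, hny⟩
          · exact hfy hny
        simp only [target_of_not_near hfy]
        rw [leadOf, if_neg hcov, leadOf, if_neg hcov', ite_self]
        generalize (if y ∈ W then leader (Near Dst ρ) h cs y else 0) = L
        clear * -
        split_ifs <;> omega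
  refine Det.storeN ⟨?_, ?_, ?_⟩
  · refine hM.push hD hf.1 (fun c hc => hc) subset_rfl hf.2 hM.oldGreedy (fun _ _ => rfl) ?_ ?_ ?_ ?_ ?_
      ?_ ?_ ?_ ?_ ?_ ?_ ?_
    · exact hL₅.congr rfl rfl rfl rfl rfl
    · exact hlead
    · show s₅.nvar 13 = a
      rw [hfr.nvar _ (by decide)]
      simp [hs₂, State.setN]
    · show s₅.nvar 14 = _
      rw [hfr.nvar _ (by decide), hnv _ (by decide), hM.oldCard]
    · show s₅.nvar 9 = _
      rw [hfr.nvar _ (by decide), hnv _ (by decide), hM.header]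
    · show Chain _ (s₅.nvar 11) _
      rw [hfr.nvar _ (by decide), hnv _ (by decide)]
      exact hM.oldChain
    · show s₅.nvar 12 = _
      rw [hfr.nvar _ (by decide)]
      simp [hs₂, State.setN]
    · show s₅.narr 7 = _
      rw [hfr.arr _ (by decide) (by decide) (by decide) (by decide) (by decide), h7]
    · simp only [State.storeN, NExpr.eval, n20', Function.update_self]
      rw [Function.update_of_ne (by decide), harr 4 (by decide) (by decide) (by decide) (by decide)
        (by decide) (by decide)]
    · exact harr 8 (by decide) (by decide) (by decide) (by decide) (by decide) (by decide)
    · intro z hz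
      show s₅.narr 5 z = _
      rw [hfr.lead z hz, hne 5 (by decide)]
    · show s₅.rvar 3 = _
      rw [hfr.rvar _ (by decide)]
      rfl
  · refine (hlf₂.trans hfr.levelFrame).storeN (by decide) ?_
    simp only [NExpr.eval, n20']
    exact subset_headers hfN
  · have c1 : (A.filter fun y => s₂.narr 5 y ∈ cs).card ≤ N' := by
      refine le_trans (Finset.card_le_card ?_) ((hM.card_le (· ∈ cs) fun n hn hh =>
        hM.newNotMem n hn (hM.old_mem n hh)).trans hUN)
      intro y
      simp only [Finset.mem_filter, hne 5 (by decide : (5 : ℕ) ≠ 7)]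
      exact id
    have c2 : (A.filter fun y => s₃.narr 5 y = h).card ≤ N' := by
      refine le_trans (Finset.card_le_card ?_) ((hM.card_le (fun x => x ∈ cs ∨ x = h)
        fun n hn hh => ?_).trans hUN)
      · intro y
        simp only [Finset.mem_filter]
        rintro ⟨hy, h1⟩
        refine ⟨hy, ?_⟩
        rw [hl₃' y hy] at h1
        split_ifs at h1 with h2
        · exact .inl h2
        · exact .inr h1
      · rcases hh with hh | rfl
        · exact hM.newNotMem n hn (hM.old_mem n hh)
        · exact hD.header_notMem (hD.subset (hM.newMem n hn))
    have c3 : (A.filter fun y => s₄.narr 5 y = 0).card ≤ N' := by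
      refine le_trans (Finset.card_le_card ?_) ((hM.card_le (fun x => x ∈ cs ∨ x = h ∨ x = 0)
        fun n hn hh => ?_).trans hUN)
      · intro y
        simp only [Finset.mem_filter]
        rintro ⟨hy, h1⟩
        refine ⟨hy, ?_⟩
        rw [hl₄' y hy, hl₃' y hy] at h1
        split_ifs at h1 <;> tauto
      · rcases hh with hh | rfl | rfl
        · exact hM.newNotMem n hn (hM.old_mem n hh)
        · exact hD.header_notMem (hD.subset (hM.newMem n hn))
        · exact hD.zero_notMem (hD.subset (hM.newMem 0 hn))
    have g2 : garbage N s₂.narr = garbage N s.narr := by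
      unfold garbage
      rw [hne 6 (by decide)]
    have h3 : t₃ + 64 * garbage N s₃.narr ≤ 64 * garbage N s.narr + 64 * N' + 50 * N' + 10 := by
      rw [← g2]
      refine ht₃.trans ?_
      have := hcslen.trans hWN
      gcongr
    have h4 : t₄ + 64 * garbage N s₄.narr ≤ 64 * garbage N s₃.narr + 64 * N' + 20 :=
      ht₄'.trans (by gcongr)
    have h5 : t₅ + 64 * garbage N s₅.narr ≤ 64 * garbage N s₄.narr + 64 * N' + 20 :=
      ht₅'.trans (by gcongr)
    have h1 : t₁ ≤ 20 * N' + 10 := by omega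
    rw [show garbage N (s₅.storeN 4 _ _).narr = garbage N s₅.narr from rfl]
    simp only [NExpr.cost]
    clear_value N'
    clear * - h1 h3 h4 h5 hN1
    omega

end Level

end DynKCenter

/-! ### Revealing the next old center, and the end of the old sequence -/

namespace DynKCenter

variable {ans : ℕ → ℕ → ℝ → Prop}

section Level
open Classical

variable {Dst : ℕ → ℕ → ℝ} {ρ : ℝ} {N A : Finset ℕ} {h k : ℕ}

theorem leader_cons_eq_iff {adj : ℕ → ℕ → Prop} {c : ℕ} {cs : List ℕ} (hc : c ∉ cs) (hch : c ≠ h)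
    {y : ℕ} : leader adj h (c :: cs) y = c ↔ adj c y := by
  rw [leader]
  split_ifs with hh
  · simp [hh]
  · simp only [hh, iff_false]
    rintro e
    rcases leader_mem_or (adj := adj) h cs y with h' | h'
    · rw [e] at h'
      exact hc h'
    · exact hch (e.symm.trans h')

/-- Removing the first center together with all that it covers does not change the clusters of later
centers, so their stored sizes stay valid. -/
theorem card_leader_cons {adj : ℕ → ℕ → Prop} {c d : ℕ} {cs : List ℕ} (hd : d ≠ c)
    (W : Finset ℕ) :
    ((uncov adj W c).filter fun y => leader adj h cs y = d).card =
      (W.filter fun y => leader adj h (c :: cs) y = d).card := by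
  congr 1
  ext y
  rw [Finset.mem_filter, Finset.mem_filter, mem_uncov, leader]
  by_cases hy : adj c y
  · simp [hy, hd.symm]
  · simp [hy]

theorem Mid.head_facts (hD : LevelData Dst ρ N A h) {s : State} {a c : ℕ} {ns cs : List ℕ}
    {W : Finset ℕ} (hM : Mid ans Dst ρ N A h k s a ns (c :: cs) W) :
    c ∈ W ∧ c ∈ N ∧ c ∉ cs ∧ c ≠ h ∧ c ≠ 0 ∧ c ∉ ns ∧
      (∃ b, Greedy (Near Dst ρ) b cs (uncov (Near Dst ρ) W c)) ∧
      (∀ d ∈ cs, ((uncov (Near Dst ρ) W c).filter fun y => leader (Near Dst ρ) h cs y = d).card =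
        (W.filter fun y => leader (Near Dst ρ) h (c :: cs) y = d).card) ∧
      W.card - s.narr 4 c = (uncov (Near Dst ρ) W c).card := by
  have hcW := hM.old_mem c (by simp)
  have hcN := hM.oldSubset hcW
  obtain ⟨b, hb⟩ := hM.oldGreedy
  have hnd := hb.nodup hD.refl
  rw [List.nodup_cons] at hnd
  obtain ⟨b', -, -, hb'⟩ := hb
  refine ⟨hcW, hcN, hnd.1, hD.ne_header hcN, hD.ne_zero hcN, fun hh => hM.newNotMem c hh hcW,
    ⟨b', hb'⟩, fun d hd => card_leader_cons (by rintro rfl; exact hnd.1 hd) W, ?_⟩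
  rw [hM.oldSize c (by simp), Finset.filter_congr fun y _ =>
    leader_cons_eq_iff (adj := Near Dst ρ) (y := y) hnd.1 (hD.ne_header hcN)]
  have := Finset.card_filter_add_card_filter_not (s := W) (fun y => Near Dst ρ c y)
  exact Nat.sub_eq_of_eq_add (by rw [← this, add_comm]; rfl)

/-- This justifies the constant-time test of `advance`. The next old center is not covered by
earlier old ones, so it leads itself unless it was deleted, when its entry is `0`, or a new center
has taken it over. -/
theorem Mid.head_lead_iff (hD : LevelData Dst ρ N A h) {s : State} {a c : ℕ} {ns cs : List ℕ}
    {W : Finset ℕ} (hM : Mid ans Dst ρ N A h k s a ns (c :: cs) W) :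
    s.narr 5 c = c ↔ c ∈ uncovList (Near Dst ρ) A ns := by
  obtain ⟨hcW, hcN, -, -, hc0, hcns, -⟩ := hM.head_facts hD
  by_cases hcA : c ∈ A
  · rw [hM.lead c hcA, leadOf, mem_uncovList]
    by_cases hcov : ∃ n ∈ ns, Near Dst ρ n c
    · rw [if_pos hcov]
      refine ⟨fun hh => ?_, fun hh => ?_⟩
      · have := (leader_mem (h := h) hcov).1
        rw [hh] at this
        exact absurd this hcns
      · obtain ⟨n, hn, hnc⟩ := hcov
        exact absurd hnc (hh.2 n hn)
    · rw [if_neg hcov, if_pos hcW, leader, if_pos (hD.refl c)]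
      simpa [hcA] using hcov
  · rw [hM.deleted c hcW hcA]
    exact ⟨fun hh => absurd hh.symm hc0, fun hh => absurd (mem_uncovList.1 hh).1 hcA⟩

theorem Mid.setN {s : State} {a : ℕ} {ns cs : List ℕ} {W : Finset ℕ}
    (hM : Mid ans Dst ρ N A h k s a ns cs W) {x v : ℕ} (hx : 15 ≤ x) :
    Mid ans Dst ρ N A h k (s.setN x v) a ns cs W := by
  have e : ∀ y, y < 15 → (s.setN x v).nvar y = s.nvar y := fun y hy =>
    Function.update_of_ne (by omega) _ _
  exact { hM with
    budget := (e 13 (by decide)).trans hM.budget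
    oldCard := (e 14 (by decide)).trans hM.oldCard
    header := (e 9 (by decide)).trans hM.header
    oldChain := by rw [e 11 (by decide)]; exact hM.oldChain
    newSeg := by rw [e 12 (by decide)]; exact hM.newSeg }

/-- The memory after `advance` passed to the next old center. -/
def nextOld (s : State) (c w : ℕ) : State :=
  ((s.setN 16 c).setN 14 w).setN 11 (s.narr 7 c)

/-- This is the cheap case of the coupling. The active nodes of `W` that `c` covers and no new
center covers are in the list of `c` already, so only the free nodes, that is `U \ W`, are compared
with `c`. -/
theorem keep_spec (hD : LevelData Dst ρ N A h) {s : State} {a c w : ℕ} {ns cs : List ℕ}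
    {W : Finset ℕ} (hM : Mid ans Dst ρ N A h k s (a + 1) ns (c :: cs) W)
    (hw : w = (uncov (Near Dst ρ) W c).card) (hc : c ∈ uncovList (Near Dst ρ) A ns) :
    Det ans keep (nextOld s c w) fun s' t =>
      Mid ans Dst ρ N A h k s' a (ns ++ [c]) cs (uncov (Near Dst ρ) W c) ∧
      LevelFrame (headers N h) s s' ∧ t + 64 * garbage N s'.narr ≤
        64 * garbage N s.narr + 100 * (1 + (uncovList (Near Dst ρ) A ns \ W).card) := by
  obtain ⟨hcW, hcN, hccs, hch, hc0, hcns, hG, hsz, hcard⟩ := hM.head_facts hD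
  have hcA : c ∈ A := (mem_uncovList.1 hc).1
  have hb := hM.budget
  unfold keep
  refine Det.seq (Det.storeN (Det.seq (Det.setN (Det.seq (Det.setN (Det.seq (Det.setN
    (Det.seq (Det.setN (Det.seq (Det.setN (Det.seq ?_))))))))))))
  set s₂ : State := (((((((nextOld s c w).storeN 7 (s.nvar 12) c).setN 12 c).setN 13 a).setN 20
    c).setN 19 0).setN 21 0) with hs₂
  have h7 : s₂.narr 7 = Function.update (s.narr 7) (s.nvar 12) c := by
    simp [hs₂, State.setN, State.storeN, nextOld]
  have hne : ∀ b, b ≠ 7 → s₂.narr b = s.narr b := by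
    intro b hb
    simp [hs₂, State.setN, State.storeN, nextOld, hb]
  have hlf₂ : LevelFrame (headers N h) s s₂ :=
    ((((((((((LevelFrame.refl _ s).setN (by decide)).setN (by decide)).setN (by decide)).storeN
      (by decide) (hM.last_mem_headers hD)).setN (by decide)).setN (by decide)).setN
      (by decide)).setN (by decide)).setN (by decide))
  have hL₂ : Linked N (headers N h) A s₂.narr := hM.linked.congr (hne 1 (by decide))
    (hne 2 (by decide)) (hne 3 (by decide)) (hne 5 (by decide)) (hne 6 (by decide))
  have hstate : ∀ x : State, x = s₂ → ∀ q Q, Det ans q s₂ Q → Det ans q x Q := by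
    rintro x rfl q Q hq
    exact hq
  refine hstate _ ?_ _ _ ?_
  · rw [hs₂]
    simp [NExpr.eval, State.setN, State.storeN, nextOld, hb]
  refine (pour_spec (s := s₂) (N := N) (H := headers N h) (Dst := Dst) (ρ := ρ) (src := 0)
    (f := c) (g := 0) hD.zero_notMem subset_headers zero_mem_headers zero_mem_headers
    (fun _ => hcA) hD.subset hL₂ ?_ ?_ ?_ ?_ ?_).mono ?_
  · simp [hs₂, State.setN]
  · simp [hs₂, State.setN]
  · simp [hs₂, State.setN]
  · exact hM.radius
  · rw [hne 8 (by decide)]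
    exact hM.oracle
  rintro s₃ t₃ ⟨hL₃, hfr, hl₃, ht₃⟩
  have hfr' := hfr.sweepFrame
  have n16 : s₃.nvar 16 = c := by
    rw [hfr.nvar _ (by decide) (by decide) (by decide)]
    simp [hs₂, State.setN, State.storeN, nextOld]
  refine Det.storeN ⟨?_, ?_, ?_⟩
  · refine hM.push hD hc (fun d hd => by simp [hd]) uncov_subset
      (fun hh => (mem_uncov.1 hh).2 (hD.refl c)) hG hsz ?_ ?_ ?_ ?_ ?_ ?_ ?_ ?_ ?_ ?_ ?_ ?_
    · exact hL₃.congr rfl rfl rfl rfl rfl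
    · intro y hy
      show s₃.narr 5 y = _
      rw [hl₃ y hy, hne 5 (by decide), hM.lead y hy]
      by_cases hcov : ∃ n ∈ ns, Near Dst ρ n y
      · have hm := (leader_mem (h := h) hcov).1
        have hcov' : ∃ n ∈ ns ++ [c], Near Dst ρ n y := by
          obtain ⟨n, hn, hny⟩ := hcov
          exact ⟨n, by simp [hn], hny⟩
        rw [leadOf, if_pos hcov, leadOf, if_pos hcov', leader_append, if_pos hcov,
          if_neg (hD.ne_zero (hD.subset (hM.newMem _ hm)))]
      · by_cases hcy : Near Dst ρ c y
        · have hcov' : ∃ n ∈ ns ++ [c], Near Dst ρ n y := ⟨c, by simp, hcy⟩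
          rw [target_of_near hc0 hcy, leadOf, if_neg hcov, leadOf, if_pos hcov', leader_append,
            if_neg hcov, if_pos hcy, leader, if_pos hcy]
          split_ifs <;> simp_all
        · have hcov' : ¬ ∃ n ∈ ns ++ [c], Near Dst ρ n y := by
            rintro ⟨n, hn, hny⟩
            rw [List.mem_append, List.mem_singleton] at hn
            rcases hn with hn | rfl
            · exact hcov ⟨n, hn, hny⟩
            · exact hcy hny
          rw [target_of_not_near hcy, leadOf, if_neg hcov, leadOf, if_neg hcov', leader,
            if_neg hcy]
          have : y ∈ uncov (Near Dst ρ) W c ↔ y ∈ W := by simp [mem_uncov, hcy]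
          rw [if_congr this rfl rfl]
          generalize (if y ∈ W then leader (Near Dst ρ) h cs y else 0) = z
          clear * -
          split_ifs <;> omega
    · show s₃.nvar 13 = a
      rw [hfr'.nvar _ (by decide)]
      simp [hs₂, State.setN]
    · show s₃.nvar 14 = _
      rw [hfr'.nvar _ (by decide), ← hw]
      simp [hs₂, State.setN, State.storeN, nextOld]
    · show s₃.nvar 9 = _
      rw [hfr'.nvar _ (by decide), ← hM.header]
      simp [hs₂, State.setN, State.storeN, nextOld]
    · show Chain _ (s₃.nvar 11) _
      rw [hfr'.nvar _ (by decide)]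
      simpa [hs₂, State.setN, State.storeN, nextOld] using hM.oldChain.2.2
    · show s₃.nvar 12 = _
      rw [hfr'.nvar _ (by decide)]
      simp [hs₂, State.setN]
    · show s₃.narr 7 = _
      rw [hfr.arr _ (by decide) (by decide) (by decide) (by decide) (by decide), h7]
    · simp only [State.storeN, NExpr.eval, n16, Function.update_self]
      rw [Function.update_of_ne (by decide), hfr.arr 4 (by decide) (by decide) (by decide)
        (by decide) (by decide), hne 4 (by decide)]
    · show s₃.narr 8 = _
      rw [hfr.arr _ (by decide) (by decide) (by decide) (by decide) (by decide), hne 8 (by decide)]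
    · intro z hz
      show s₃.narr 5 z = _
      rw [hfr.lead z hz, hne 5 (by decide)]
    · show s₃.rvar 3 = _
      rw [hfr.rvar _ (by decide)]
      rfl
  · refine (hlf₂.trans hfr'.levelFrame).storeN (by decide) ?_
    simp only [NExpr.eval, n16]
    exact subset_headers hcN
  · have c3 : (A.filter fun y => s₂.narr 5 y = 0).card ≤ (uncovList (Near Dst ρ) A ns \ W).card := by
      refine Finset.card_le_card fun y => ?_
      rw [Finset.mem_filter, hne 5 (by decide)]
      rintro ⟨hy, hy'⟩
      exact (hM.free_iff hD hy).1 hy'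
    have g2 : garbage N s₂.narr = garbage N s.narr := by
      unfold garbage
      rw [hne 6 (by decide)]
    have h3 : t₃ + 64 * garbage N s₃.narr ≤ 64 * garbage N s.narr +
        64 * (uncovList (Near Dst ρ) A ns \ W).card + 20 := by
      rw [← g2]
      exact ht₃.trans (by gcongr)
    rw [show garbage N (s₃.storeN 4 _ _).narr = garbage N s₃.narr from rfl]
    simp only [NExpr.cost]
    clear * - h3
    omega

/-- The nodes that `c` covers leave `W`, but those that no new center covers stay in `U`, so the
cluster of `c` is moved to the free list. The new budget is not touched. -/
theorem retire_spec (hD : LevelData Dst ρ N A h) {s : State} {a c w : ℕ} {ns cs : List ℕ}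
    {W : Finset ℕ} (hM : Mid ans Dst ρ N A h k s a ns (c :: cs) W)
    (hw : w = (uncov (Near Dst ρ) W c).card) :
    Det ans retire (nextOld s c w) fun s' t =>
      Mid ans Dst ρ N A h k s' a ns cs (uncov (Near Dst ρ) W c) ∧
      LevelFrame (headers N h) s s' ∧ t + 64 * garbage N s'.narr ≤
        64 * garbage N s.narr + 100 * (W ∪ uncovList (Near Dst ρ) A ns).card := by
  obtain ⟨hcW, hcN, hccs, hch, hc0, hcns, hG, hsz, hcard⟩ := hM.head_facts hD
  unfold retire
  refine Det.seq (Det.setN (Det.seq (Det.setN (Det.seq (Det.setN ?_)))))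
  set s₂ : State := (((nextOld s c w).setN 19 c).setN 20 0).setN 21 0 with hs₂
  have hlf₂ : LevelFrame (headers N h) s s₂ :=
    ((((((LevelFrame.refl _ s).setN (by decide)).setN (by decide)).setN (by decide)).setN
      (by decide)).setN (by decide)).setN (by decide)
  have hstate : ∀ x : State, x = s₂ → ∀ q Q, Det ans q s₂ Q → Det ans q x Q := by
    rintro x rfl q Q hq
    exact hq
  refine hstate _ ?_ _ _ ?_
  · rw [hs₂]
    simp [NExpr.eval, State.setN, nextOld]
  have hne : s₂.narr = s.narr := rfl
  refine (pour_spec (s := s₂) (N := N) (H := headers N h) (Dst := Dst) (ρ := ρ) (src := c)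
    (f := 0) (g := 0) hD.zero_notMem subset_headers (subset_headers hcN) zero_mem_headers
    (fun hh => absurd rfl hh) hD.subset hM.linked ?_ ?_ ?_ hM.radius hM.oracle).mono ?_
  · simp [hs₂, State.setN]
  · simp [hs₂, State.setN]
  · simp [hs₂, State.setN]
  rintro s₃ t₃ ⟨hL₃, hfr, hl₃, ht₃⟩
  have hfr' := hfr.sweepFrame
  have hnv : ∀ x, x < 14 → x ≠ 11 → s₃.nvar x = s.nvar x := by
    intro x hx hx'
    rw [hfr'.nvar _ (by omega)]
    simp [hs₂, State.setN, nextOld, show x ≠ 16 by omega, show x ≠ 14 by omega,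
      show x ≠ 19 by omega, show x ≠ 20 by omega, show x ≠ 21 by omega, hx']
  have harr : ∀ b, b ≠ 1 → b ≠ 2 → b ≠ 3 → b ≠ 5 → b ≠ 6 → s₃.narr b = s.narr b := by
    intro b h1 h2 h3 h5 h6
    rw [hfr.arr b h1 h2 h3 h5 h6, hne]
  refine ⟨⟨hL₃, ?_, ?_, ?_, ?_, ?_, ?_, ?_, ?_, hG, hM.newGreedy, ?_, hM.newMem, hM.newNodup,
    uncov_subset.trans hM.oldSubset, ?_, ?_, ?_⟩, hlf₂.trans hfr'.levelFrame, ?_⟩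
  · intro y hy
    rw [hl₃ y hy, hne, hM.lead y hy, target_zero]
    by_cases hcov : ∃ n ∈ ns, Near Dst ρ n y
    · have hm := (leader_mem (h := h) hcov).1
      rw [leadOf, if_pos hcov, leadOf, if_pos hcov, if_neg]
      rintro hh
      rw [hh] at hm
      exact hcns hm
    · rw [leadOf, if_neg hcov, leadOf, if_neg hcov]
      by_cases hyW : y ∈ W
      · rw [if_pos hyW]
        have := leader_cons_eq_iff (adj := Near Dst ρ) (y := y) hccs hch
        by_cases hcy : Near Dst ρ c y
        · rw [if_pos (this.2 hcy), if_neg]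
          exact fun hh => (mem_uncov.1 hh).2 hcy
        · rw [if_neg (fun hh => hcy (this.1 hh)), if_pos (mem_uncov.2 ⟨hyW, hcy⟩), leader,
            if_neg hcy]
      · rw [if_neg hyW, if_neg hc0.symm, if_neg]
        exact fun hh => hyW (mem_uncov.1 hh).1
  · rw [hnv _ (by decide) (by decide), hM.budget]
  · rw [hfr'.nvar _ (by decide), ← hw]
    simp [hs₂, State.setN, nextOld]
  · rw [hnv _ (by decide) (by decide), hM.header]
  · rw [harr _ (by decide) (by decide) (by decide) (by decide) (by decide), hfr'.nvar _ (by decide)]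
    simpa [hs₂, State.setN, nextOld] using hM.oldChain.2.2
  · rw [harr _ (by decide) (by decide) (by decide) (by decide) (by decide),
      hnv _ (by decide) (by decide)]
    exact hM.newSeg
  · intro d hd
    rw [harr _ (by decide) (by decide) (by decide) (by decide) (by decide),
      hM.oldSize d (by simp [hd]), hsz d hd]
  · intro n hn
    rw [harr _ (by decide) (by decide) (by decide) (by decide) (by decide), hM.newSize n hn]
  · exact fun n hn hh => hM.newNotMem n hn (uncov_subset hh)
  · intro z hz hzA
    rw [hfr.lead z hzA, hne]
    exact hM.deleted z (uncov_subset hz) hzA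
  · rw [hfr'.rvar _ (by decide)]
    exact hM.radius
  · rw [harr _ (by decide) (by decide) (by decide) (by decide) (by decide)]
    exact hM.oracle
  · have h1 : 1 ≤ (W ∪ uncovList (Near Dst ρ) A ns).card :=
      Finset.card_pos.2 ⟨c, Finset.mem_union_left _ hcW⟩
    have c3 : (A.filter fun y => s₂.narr 5 y = c).card ≤
        (W ∪ uncovList (Near Dst ρ) A ns).card :=
      le_trans (Finset.card_le_card fun y hy => by simpa [hne] using hy)
        ((hM.card_le (· = c) fun n hn hh => hcns (hh ▸ hn)).trans
          (Finset.card_le_card Finset.subset_union_right))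
    have h3 : t₃ + 64 * garbage N s₃.narr ≤ 64 * garbage N s.narr +
        64 * (W ∪ uncovList (Near Dst ρ) A ns).card + 20 := by
      rw [← hne]
      exact ht₃.trans (by gcongr)
    simp only [NExpr.cost]
    clear * - h3 h1
    omega

theorem advance_spec (hD : LevelData Dst ρ N A h) {s : State} {a c : ℕ} {ns cs : List ℕ}
    {W : Finset ℕ} (hM : Mid ans Dst ρ N A h k s (a + 1) ns (c :: cs) W) :
    Det ans advance s fun s' t => LevelFrame (headers N h) s s' ∧
      if c ∈ uncovList (Near Dst ρ) A ns then
        Mid ans Dst ρ N A h k s' a (ns ++ [c]) cs (uncov (Near Dst ρ) W c) ∧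
        t + 64 * garbage N s'.narr ≤
          64 * garbage N s.narr + 200 * (1 + (uncovList (Near Dst ρ) A ns \ W).card)
      else
        Mid ans Dst ρ N A h k s' (a + 1) ns cs (uncov (Near Dst ρ) W c) ∧
        t + 64 * garbage N s'.narr ≤
          64 * garbage N s.narr + 200 * (W ∪ uncovList (Near Dst ρ) A ns).card := by
  obtain ⟨hcW, hcN, hccs, hch, hc0, hcns, hG, hsz, hcard⟩ := hM.head_facts hD
  have h11 : s.nvar 11 = c := hM.oldChain.1
  have h14 := hM.oldCard
  have hiff := hM.head_lead_iff hD
  unfold advance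
  refine Det.seq (Det.setN (Det.seq (Det.setN (Det.seq (Det.setN ?_)))))
  have hstate : ∀ x : State, x = nextOld s c (W.card - s.narr 4 c) → ∀ q Q,
      Det ans q (nextOld s c (W.card - s.narr 4 c)) Q → Det ans q x Q := by
    rintro x rfl q Q hq
    exact hq
  refine hstate _ ?_ _ _ ?_
  · simp [NExpr.eval, State.setN, nextOld, h11, h14]
  refine Det.cond (fun ht => ?_) fun ht => ?_
  · have hc : c ∈ uncovList (Near Dst ρ) A ns := by
      rw [← hiff]
      simpa [Test.Holds, NExpr.eval, nextOld, State.setN] using ht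
    refine (keep_spec hD hM hcard hc).mono ?_
    rintro s' t ⟨h1, h2, h3⟩
    rw [if_pos hc]
    refine ⟨h2, h1, ?_⟩
    simp only [NExpr.cost, Test.cost]
    clear * - h3
    omega
  · have hc : c ∉ uncovList (Near Dst ρ) A ns := by
      rw [← hiff]
      simpa [Test.Holds, NExpr.eval, nextOld, State.setN] using ht
    refine (retire_spec hD hM hcard).mono ?_
    rintro s' t ⟨h1, h2, h3⟩
    rw [if_neg hc]
    refine ⟨h2, h1, ?_⟩
    have h0 : 1 ≤ (W ∪ uncovList (Near Dst ρ) A ns).card :=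
      Finset.card_pos.2 ⟨c, Finset.mem_union_left _ hcW⟩
    simp only [NExpr.cost, Test.cost]
    clear * - h3 h0
    omega

/-- Without remaining old centers there is nothing left to share. The nodes of `W` that no new
center covers are in the list of the header; once they are free, the construction continues with `W
= ∅`. -/
theorem release_spec (hD : LevelData Dst ρ N A h) {s : State} {a : ℕ} {ns : List ℕ}
    {W : Finset ℕ} (hM : Mid ans Dst ρ N A h k s a ns [] W) :
    Det ans release s fun s' t =>
      Mid ans Dst ρ N A h k s' a ns [] ∅ ∧
      LevelFrame (headers N h) s s' ∧ t + 64 * garbage N s'.narr ≤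
        64 * garbage N s.narr + 100 * (1 + (W ∪ uncovList (Near Dst ρ) A ns).card) := by
  unfold release
  refine Det.seq (Det.setN (Det.seq (Det.setN (Det.seq (Det.setN (Det.seq ?_))))))
  set s₂ : State := ((s.setN 19 h).setN 20 0).setN 21 0 with hs₂
  have hlf₂ : LevelFrame (headers N h) s s₂ :=
    (((LevelFrame.refl _ s).setN (by decide)).setN (by decide)).setN (by decide)
  have hstate : ∀ x : State, x = s₂ → ∀ q Q, Det ans q s₂ Q → Det ans q x Q := by
    rintro x rfl q Q hq
    exact hq
  refine hstate _ ?_ _ _ ?_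
  · rw [hs₂]
    simp [NExpr.eval, State.setN, hM.header]
  have hne : s₂.narr = s.narr := rfl
  have hhns : h ∉ ns := fun hh => hD.header_notMem (hD.subset (hM.newMem h hh))
  refine (pour_spec (s := s₂) (N := N) (H := headers N h) (Dst := Dst) (ρ := ρ) (src := h)
    (f := 0) (g := 0) hD.zero_notMem subset_headers header_mem_headers zero_mem_headers
    (fun hh => absurd rfl hh) hD.subset hM.linked ?_ ?_ ?_ hM.radius hM.oracle).mono ?_
  · simp [hs₂, State.setN]
  · simp [hs₂, State.setN]
  · simp [hs₂, State.setN]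
  rintro s₃ t₃ ⟨hL₃, hfr, hl₃, ht₃⟩
  have hfr' := hfr.sweepFrame
  have hnv : ∀ x, x < 16 → s₃.nvar x = s.nvar x := by
    intro x hx
    rw [hfr'.nvar _ (by omega)]
    simp [hs₂, State.setN, show x ≠ 19 by omega, show x ≠ 20 by omega, show x ≠ 21 by omega]
  have hnv' : ∀ x v, x ≠ 14 → (s₃.setN 14 v).nvar x = s₃.nvar x := fun x v hx =>
    Function.update_of_ne hx _ _
  have harr : ∀ b, b ≠ 1 → b ≠ 2 → b ≠ 3 → b ≠ 5 → b ≠ 6 → s₃.narr b = s.narr b := by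
    intro b h1 h2 h3 h5 h6
    rw [hfr.arr b h1 h2 h3 h5 h6, hne]
  refine Det.setN ⟨⟨hL₃, ?_, ?_, ?_, ?_, ?_, ?_, ?_, ?_, ⟨0, .inl rfl⟩, hM.newGreedy, ?_, hM.newMem,
    hM.newNodup, by simp, ?_, ?_, ?_⟩, (hlf₂.trans hfr'.levelFrame).setN (by decide), ?_⟩
  · intro y hy
    show s₃.narr 5 y = _
    rw [hl₃ y hy, hne, hM.lead y hy, target_zero]
    by_cases hcov : ∃ n ∈ ns, Near Dst ρ n y
    · have hm := (leader_mem (h := h) hcov).1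
      rw [leadOf, if_pos hcov, leadOf, if_pos hcov, if_neg]
      rintro hh
      rw [hh] at hm
      exact hhns hm
    · rw [leadOf, if_neg hcov, leadOf, if_neg hcov]
      have := hD.header_ne
      simp only [leader, Finset.notMem_empty, if_false]
      split_ifs <;> first | rfl | contradiction
  · rw [hnv' _ _ (by decide), hnv _ (by decide), hM.budget]
  · simp [State.setN, NExpr.eval]
  · rw [hnv' _ _ (by decide), hnv _ (by decide), hM.header]
  · rw [hnv' _ _ (by decide), hnv _ (by decide)]
    exact hM.oldChain
  · show Seg (s₃.narr 7) _ _ _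
    rw [harr _ (by decide) (by decide) (by decide) (by decide) (by decide), hnv' _ _ (by decide),
      hnv _ (by decide)]
    exact hM.newSeg
  · simp
  · intro n hn
    show s₃.narr 4 n = _
    rw [harr _ (by decide) (by decide) (by decide) (by decide) (by decide), hM.newSize n hn]
  · simp
  · simp
  · show s₃.rvar 3 = _
    rw [hfr'.rvar _ (by decide)]
    exact hM.radius
  · show ∀ x ∈ A, ∀ y ∈ A, ans (s₃.narr 8 x) (s₃.narr 8 y) (Dst x y)
    rw [harr _ (by decide) (by decide) (by decide) (by decide) (by decide)]
    exact hM.oracle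
  · have c3 : (A.filter fun y => s₂.narr 5 y = h).card ≤
        (W ∪ uncovList (Near Dst ρ) A ns).card :=
      le_trans (Finset.card_le_card fun y hy => by simpa [hne] using hy)
        ((hM.card_le (· = h) fun n hn hh => hhns (hh ▸ hn)).trans
          (Finset.card_le_card Finset.subset_union_right))
    have h3 : t₃ + 64 * garbage N s₃.narr ≤ 64 * garbage N s.narr +
        64 * (W ∪ uncovList (Near Dst ρ) A ns).card + 20 := by
      rw [← hne]
      exact ht₃.trans (by gcongr)
    rw [show garbage N (s₃.setN 14 _).narr = garbage N s₃.narr from rfl]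
    simp only [NExpr.cost]
    clear * - h3
    omega

end Level

end DynKCenter

/-! ### The loop of a level, and closing a level -/

namespace DynKCenter

/-- The next step if a center may still be added and there are nodes to choose from. -/
def levelBody : Program :=
  .cond (.and (.natEq (.var 11) (.lit 0)) (.natLt (.lit 0) (.var 14))) release
    (.random 15 (.sub (.add (.var 14) (.cell 3 (.lit 0))) (.lit 1)) ;;
      .cond (.natLt (.var 15) (.cell 3 (.lit 0))) hit advance)

/-- Find the new centers. -/
def levelLoop : Program :=
  .loop (.and (.natLt (.lit 0) (.var 13)) (.natLt (.lit 0) (.add (.var 14) (.cell 3 (.lit 0)))))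
    levelBody

/-- Close the list of the new centers and collect the nodes that they do not cover. -/
def finish : Program :=
  .storeN 7 (.var 12) (.lit 0) ;;
  .setN 20 (.lit 0) ;;
  sweep ;;
  .setN 19 (.lit 0) ;;
  .setN 21 (.var 9) ;;
  pour

variable {ans : ℕ → ℕ → ℝ → Prop}

section Level
open Classical

variable {Dst : ℕ → ℕ → ℝ} {ρ : ℝ} {N A : Finset ℕ} {h k : ℕ}

/-- The memory of a level with the centers `cs` between two updates. -/
structure LevelInv (Dst : ℕ → ℕ → ℝ) (ρ : ℝ) (N A : Finset ℕ) (h k : ℕ) (m : ℕ → ℕ → ℕ)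
    (cs : List ℕ) : Prop where
  linked : Linked N (headers N h) A m
  free : m 2 0 = 0
  lead : ∀ y ∈ A, m 5 y = leader (Near Dst ρ) h cs y
  chain : Chain (m 7) (m 7 h) cs
  size : ∀ c ∈ cs, m 4 c = (A.filter fun y => leader (Near Dst ρ) h cs y = c).card
  greedy : Greedy (Near Dst ρ) k cs A

/-- A node of the free list cannot be deleted by `Links.dead`, and an active one would have the
entry `0`. All levels share this list, so each has to leave it empty. -/
theorem Linked.head_eq_zero {H : Finset ℕ} {m : ℕ → ℕ → ℕ} (hL : Linked N H A m) (h0 : 0 ∈ H)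
    (hA : ∀ y ∈ A, m 5 y ≠ 0) : m 2 0 = 0 := by
  obtain ⟨Lst, hL⟩ := hL
  have hc := hL.chain 0 h0
  cases hl : Lst 0 with
  | nil => rw [hl] at hc; exact hc
  | cons y l =>
    have hy : y ∈ Lst 0 := by simp [hl]
    by_cases hyA : y ∈ A
    · exact absurd (hL.alive 0 h0 y hy hyA) (hA y hyA)
    · exact absurd rfl (hL.dead 0 h0 y hy hyA).1

/-- The free list is free of deleted nodes. Hence its stored count is its true length, and a uniform
position in it is a uniform element of `U \ W`. -/
theorem Mid.free_list (hD : LevelData Dst ρ N A h) {s : State} {a : ℕ} {ns cs : List ℕ}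
    {W : Finset ℕ} (hM : Mid ans Dst ρ N A h k s a ns cs W) :
    ∃ l : List ℕ, Chain (s.narr 1) (s.narr 2 0) l ∧ l.Nodup ∧
      l.toFinset = uncovList (Near Dst ρ) A ns \ W ∧ s.narr 3 0 = l.length := by
  obtain ⟨Lst, hL⟩ := hM.linked
  have h0 : 0 ∈ headers N h := zero_mem_headers
  have hA : ∀ y ∈ Lst 0, y ∈ A := by
    intro y hy
    by_contra hyA
    exact (hL.dead 0 h0 y hy hyA).1 rfl
  refine ⟨Lst 0, hL.chain 0 h0, hL.nodup 0 h0, ?_, ?_⟩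
  · ext y
    rw [List.mem_toFinset]
    refine ⟨fun hy => ?_, fun hy => ?_⟩
    · exact (hM.free_iff hD (hA y hy)).1 (hL.alive 0 h0 y hy (hA y hy))
    · have hyA := (mem_uncovList.1 (Finset.mem_sdiff.1 hy).1).1
      exact (hL.mem_iff h0 hyA).2 ((hM.free_iff hD hyA).2 hy)
  · rw [hL.count 0 h0, List.filter_eq_self.2]
    intro y hy
    simpa using hA y hy

/-- The cost of closing a level, up to a constant factor. -/
noncomputable def stopCost (cs : List ℕ) (W U : Finset ℕ) : ℕ :=
  if cs = [] then 1 + (U \ W).card else 1 + (W ∪ U).card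

/-- If old centers remain, their clusters are dissolved into the list of the header, which may
concern all of `U`. If none remains, only the free list has to be moved; hence the distinction in
`stopCost`. -/
theorem finish_spec (hD : LevelData Dst ρ N A h) {s : State} {a : ℕ} {ns cs : List ℕ}
    {W : Finset ℕ} (hM : Mid ans Dst ρ N A h k s a ns cs W)
    (hdone : a = 0 ∨ W ∪ uncovList (Near Dst ρ) A ns = ∅) :
    Det ans finish s fun s' t =>
      LevelInv Dst ρ N A h k s'.narr ns ∧ LevelFrame (headers N h) s s' ∧
      t + 64 * garbage N s'.narr ≤
        64 * garbage N s.narr + 200 * stopCost cs W (uncovList (Near Dst ρ) A ns) := by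
  have hhcs : h ∉ cs := fun hh => hD.header_notMem (hM.oldSubset (hM.old_mem h hh))
  have h0cs : 0 ∉ cs := fun hh => hD.zero_notMem (hM.oldSubset (hM.old_mem 0 hh))
  have hcsN : ∀ c ∈ cs, c ∈ N := fun c hc => hM.oldSubset (hM.old_mem c hc)
  have hhns : h ∉ ns := fun hh => hD.header_notMem (hD.subset (hM.newMem h hh))
  have h0ns : 0 ∉ ns := fun hh => hD.zero_notMem (hD.subset (hM.newMem 0 hh))
  have hcsnd : cs.Nodup := by
    obtain ⟨b, hb⟩ := hM.oldGreedy
    exact hb.nodup hD.refl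
  have hcslen : cs.length ≤ W.card := by
    rw [← List.toFinset_card_of_nodup hcsnd]
    exact Finset.card_le_card fun x hx => hM.old_mem x (List.mem_toFinset.1 hx)
  unfold finish
  refine Det.seq (Det.storeN (Det.seq (Det.setN (Det.seq ?_))))
  set s₂ : State := (s.storeN 7 (s.nvar 12) 0).setN 20 0 with hs₂
  have h7 : s₂.narr 7 = Function.update (s.narr 7) (s.nvar 12) 0 := by
    simp [hs₂, State.setN, State.storeN]
  have hne : ∀ b, b ≠ 7 → s₂.narr b = s.narr b := by
    intro b hb
    simp [hs₂, State.setN, State.storeN, hb]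
  have hnv : ∀ x, x ≠ 20 → s₂.nvar x = s.nvar x := by
    intro x hx
    simp [hs₂, State.setN, State.storeN, hx]
  have hlf₂ : LevelFrame (headers N h) s s₂ :=
    ((LevelFrame.refl _ s).storeN (by decide) (hM.last_mem_headers hD)).setN (by decide)
  have hL₂ : Linked N (headers N h) A s₂.narr := hM.linked.congr (hne 1 (by decide))
    (hne 2 (by decide)) (hne 3 (by decide)) (hne 5 (by decide)) (hne 6 (by decide))
  refine (sweep_spec (s := s₂) (Dst := Dst) (ρ := ρ) (f := 0) (h := h) hD.zero_notMem subset_headers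
    header_mem_headers (fun hh => absurd rfl hh) hD.subset cs hcsnd hcsN h0cs hhcs hL₂
    ?_ ?_ ?_ ?_ ?_).mono ?_
  · rw [h7, hnv 11 (by decide)]
    refine hM.oldChain.congr fun y hy => Function.update_of_ne ?_ _ _
    rintro rfl
    exact hM.last_notMem hD hy
  · rw [hnv 9 (by decide), hM.header]
  · simp [hs₂, State.setN]
  · exact hM.radius
  · rw [hne 8 (by decide)]
    exact hM.oracle
  rintro s₃ t₃ ⟨hL₃, hfr₃, hl₃, ht₃⟩
  have n9 : s₃.nvar 9 = h := by
    rw [hfr₃.nvar _ (by decide), hnv 9 (by decide), hM.header]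
  have n20 : s₃.nvar 20 = 0 := by
    rw [hfr₃.nvar _ (by decide)]
    simp [hs₂, State.setN]
  refine Det.seq (Det.setN (Det.seq (Det.setN ?_)))
  set s₄ : State := (s₃.setN 19 0).setN 21 h with hs₄
  have hstate : ∀ x : State, x = s₄ → ∀ q Q, Det ans q s₄ Q → Det ans q x Q := by
    rintro x rfl q Q hq
    exact hq
  refine hstate _ ?_ _ _ ?_
  · rw [hs₄]
    simp [NExpr.eval, State.setN, n9]
  refine (pour_spec (s := s₄) (N := N) (H := headers N h) (Dst := Dst) (ρ := ρ) (src := 0)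
    (f := 0) (g := h) hD.zero_notMem subset_headers zero_mem_headers header_mem_headers
    (fun hh => absurd rfl hh) hD.subset hL₃ ?_ ?_ ?_ ?_ ?_).mono ?_
  · simp [hs₄, State.setN]
  · simp [hs₄, State.setN, n20]
  · simp [hs₄, State.setN]
  · show s₃.rvar 3 = ρ
    rw [hfr₃.rvar _ (by decide)]
    exact hM.radius
  · show ∀ x ∈ A, ∀ y ∈ A, ans (s₃.narr 8 x) (s₃.narr 8 y) (Dst x y)
    rw [hfr₃.arr _ (by decide) (by decide) (by decide) (by decide) (by decide), hne 8 (by decide)]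
    exact hM.oracle
  rintro s₅ t₅ ⟨hL₅, hfr₅, hl₅, ht₅⟩
  have hl₅' : ∀ y ∈ A, s₅.narr 5 y = if s₃.narr 5 y = 0 then target Dst ρ 0 h y else s₃.narr 5 y :=
    hl₅
  have hfr₅' : SweepFrame (headers N h) A s₃ s₅ :=
    (((SweepFrame.refl _ A s₃).setN 19 _ (by decide) (by decide)).setN 21 _ (by decide)
      (by decide)).trans hfr₅.sweepFrame
  have hfr := hfr₃.trans hfr₅'
  have hlead : ∀ y ∈ A, s₅.narr 5 y = leader (Near Dst ρ) h ns y := by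
    intro y hy
    rw [hl₅' y hy, hl₃ y hy, hne 5 (by decide), hM.lead y hy, target_zero, target_zero, if_pos rfl]
    by_cases hcov : ∃ n ∈ ns, Near Dst ρ n y
    · have hm := (leader_mem (h := h) hcov).1
      rw [leadOf, if_pos hcov, if_neg fun hh => hM.newNotMem _ hm (hM.old_mem _ hh),
        if_neg (hD.ne_zero (hD.subset (hM.newMem _ hm)))]
    · rw [leadOf, if_neg hcov, leader_eq_of_not (l := ns) (by simpa using hcov)]
      have := hD.header_ne
      by_cases hyW : y ∈ W
      · rw [if_pos hyW]
        rcases leader_mem_or (adj := Near Dst ρ) h cs y with h' | h'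
        · rw [if_pos h', if_neg this]
        · rw [h', if_neg hhcs, if_neg this]
      · rw [if_neg hyW, if_neg h0cs, if_pos rfl]
  refine ⟨⟨hL₅, ?_, hlead, ?_, ?_, ?_⟩, hlf₂.trans hfr.levelFrame, ?_⟩
  · refine hL₅.head_eq_zero zero_mem_headers fun y hy => ?_
    rw [hlead y hy]
    exact leader_ne_zero hD (fun c hc => hD.subset (hM.newMem c hc)) y
  · rw [hfr.arr _ (by decide) (by decide) (by decide) (by decide) (by decide), h7]
    exact hM.newSeg.close (List.nodup_cons.2 ⟨hhns, hM.newNodup⟩) h0ns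
  · intro c hc
    rw [hfr.arr _ (by decide) (by decide) (by decide) (by decide) (by decide), hne 4 (by decide)]
    exact hM.newSize c hc
  · have := hM.newGreedy []
    rw [List.append_nil] at this
    refine this (hdone.imp_right fun hh => ?_)
    rw [Finset.union_eq_empty] at hh
    exact hh.2
  · have c0 : (A.filter fun y => s₃.narr 5 y = 0).card ≤
        (uncovList (Near Dst ρ) A ns \ W).card := by
      refine Finset.card_le_card fun y => ?_
      rw [Finset.mem_filter]
      rintro ⟨hy, hy'⟩
      refine (hM.free_iff hD hy).1 ?_
      rw [hl₃ y hy, hne 5 (by decide), target_zero, if_pos rfl] at hy'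
      split_ifs at hy' with h1
      · exact absurd hy' hD.header_ne
      · exact hy'
    have c1 : (A.filter fun y => s₂.narr 5 y ∈ cs).card ≤ (uncovList (Near Dst ρ) A ns).card := by
      refine le_trans (Finset.card_le_card ?_) (hM.card_le (· ∈ cs) fun n hn hh =>
        hM.newNotMem n hn (hM.old_mem n hh))
      intro y
      simp only [Finset.mem_filter, hne 5 (by decide : (5 : ℕ) ≠ 7)]
      exact id
    have c2 : cs = [] → (A.filter fun y => s₂.narr 5 y ∈ cs).card = 0 := by
      rintro rfl
      simp
    have g2 : garbage N s₂.narr = garbage N s.narr := by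
      unfold garbage
      rw [hne 6 (by decide)]
    have h5 : t₅ + 64 * garbage N s₅.narr ≤ 64 * garbage N s₃.narr +
        64 * (uncovList (Near Dst ρ) A ns \ W).card + 20 :=
      ht₅.trans (Nat.add_le_add_right (Nat.add_le_add_left (Nat.mul_le_mul_left 64 c0) _) 20)
    rw [g2] at ht₃
    have u1 : (uncovList (Near Dst ρ) A ns \ W).card ≤ (uncovList (Near Dst ρ) A ns).card :=
      Finset.card_le_card Finset.sdiff_subset
    have u2 : (uncovList (Near Dst ρ) A ns).card ≤ (W ∪ uncovList (Near Dst ρ) A ns).card :=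
      Finset.card_le_card Finset.subset_union_right
    have u3 : W.card ≤ (W ∪ uncovList (Near Dst ρ) A ns).card :=
      Finset.card_le_card Finset.subset_union_left
    simp only [NExpr.cost]
    unfold stopCost
    split_ifs with hcs
    · have := c2 hcs
      rw [this, hcs] at ht₃
      simp only [List.length_nil] at ht₃
      clear * - ht₃ h5
      omega
    · clear * - ht₃ h5 c1 u1 u2 u3 hcslen
      omega

end Level

end DynKCenter

/-! ### The expected running time of a level -/

namespace DynKCenter

variable {ans : ℕ → ℕ → ℝ → Prop}

theorem sum_getD_range {M : Type*} [AddCommMonoid M] (g : ℕ → M) {l : List ℕ} (hl : l.Nodup) :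
    ∑ v ∈ Finset.range l.length, g (l.getD v 0) = ∑ f ∈ l.toFinset, g f := by
  induction l with
  | nil => simp
  | cons y l ih =>
    rw [List.nodup_cons] at hl
    rw [List.length_cons, Finset.sum_range_succ', List.toFinset_cons, Finset.sum_insert (by simpa using hl.1),
      ← ih hl.2, add_comm]
    simp

section Level
open Classical

variable {Dst : ℕ → ℕ → ℝ} {ρ : ℝ} {N A : Finset ℕ} {h k : ℕ}

/-- The draw is uniform among `|W ∪ U|` numbers: those below `|U \ W|` are positions of free nodes,
and the other `|W|` numbers all lead to `advance`. Here `G f` and `g` bound the costs that follow,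
the former without garbage. The tests and the draw cost at most 30, which fits between the 500 per
element of `hit` and the 600 of the recursion. -/
theorem levelLoop_step (hans : Functional ans) (hD : LevelData Dst ρ N A h) {s : State} {a : ℕ}
    {ns cs : List ℕ} {W : Finset ℕ} (hM : Mid ans Dst ρ N A h k s (a + 1) ns cs W)
    (hne : (W ∪ uncovList (Near Dst ρ) A ns).Nonempty) (hcs : cs = [] → W = ∅)
    (G : ℕ → ℝ≥0∞) (g : ℝ≥0∞) (R : State → ℝ≥0∞ → Prop)
    (hhit : ∀ f ∈ uncovList (Near Dst ρ) A ns \ W, ∀ s', LevelFrame (headers N h) s s' →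
      Mid ans Dst ρ N A h k s' a (ns ++ [f]) cs W →
      Trip ans levelLoop s' R (G f + (64 * garbage N s'.narr : ℕ)))
    (hadv : W.Nonempty → ∀ v, Det ans advance (s.setN 15 v) fun s' t =>
      ∃ b, Trip ans levelLoop s' R b ∧ b + t ≤ g + (64 * garbage N s.narr : ℕ)) :
    Trip ans levelLoop s R
      ((∑ f ∈ uncovList (Near Dst ρ) A ns \ W,
          ((600 * (W ∪ uncovList (Near Dst ρ) A ns).card : ℕ) + G f) + W.card * (g + 30)) /
        (W ∪ uncovList (Near Dst ρ) A ns).card + (64 * garbage N s.narr : ℕ)) := by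
  obtain ⟨l, hlc, hln, hlU, hl3⟩ := hM.free_list hD
  have h13 := hM.budget
  have h14 := hM.oldCard
  have hMcard : (W ∪ uncovList (Near Dst ρ) A ns).card = l.length + W.card := by
    rw [← List.toFinset_card_of_nodup hln, hlU, ← Finset.card_union_of_disjoint
      Finset.sdiff_disjoint, Finset.sdiff_union_self_eq_union, Finset.union_comm]
  have hMpos : 1 ≤ (W ∪ uncovList (Near Dst ρ) A ns).card := Finset.card_pos.2 hne
  set M := (W ∪ uncovList (Near Dst ρ) A ns).card with hM'
  set U := uncovList (Near Dst ρ) A ns with hU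
  set Γ : ℝ≥0∞ := ((64 * garbage N s.narr : ℕ) : ℝ≥0∞) with hΓ
  have hloop : (Test.and (.natLt (.lit 0) (.var 13))
      (.natLt (.lit 0) (.add (.var 14) (.cell 3 (.lit 0))))).Holds s := by
    simp only [Test.Holds, NExpr.eval, h13, h14, hl3]
    omega
  let y : ℕ → ℝ≥0∞ := fun v => if v < l.length then (500 * M : ℕ) + G (l.getD v 0) else g
  have hM0 : (M : ℝ≥0∞) ≠ 0 := by
    simp only [ne_eq, Nat.cast_eq_zero]
    omega
  have hev : (NExpr.sub (.add (.var 14) (.cell 3 (.lit 0))) (.lit 1)).eval s + 1 = M := by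
    simp only [NExpr.eval, h14, hl3]
    omega
  have hsum : (∑ v ∈ Finset.range M, (y v + (Γ + 4))) / M + 26 ≤
      (∑ f ∈ U \ W, ((600 * M : ℕ) + G f) + W.card * (g + 30)) / M + Γ := by
    have e1 : (∑ v ∈ Finset.range M, (y v + (Γ + 4))) / M + 26 =
        (∑ v ∈ Finset.range M, (y v + 30)) / M + Γ := by
      have hc : ∀ z : ℝ≥0∞, (∑ _v ∈ Finset.range M, z) / M = z := fun z => by
        rw [Finset.sum_const, Finset.card_range, nsmul_eq_mul, mul_comm,
          ENNReal.mul_div_cancel_right hM0 (by simp)]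
      rw [Finset.sum_add_distrib, ENNReal.add_div, hc, Finset.sum_add_distrib, ENNReal.add_div, hc]
      rw [show (30 : ℝ≥0∞) = 4 + 26 by norm_num]
      ring
    rw [e1]
    gcongr
    rw [hMcard, Finset.sum_range_add, ← hMcard]
    gcongr
    · rw [← hlU, ← sum_getD_range (fun f => ((600 * M : ℕ) : ℝ≥0∞) + G f) hln]
      refine Finset.sum_le_sum fun v hv => ?_
      simp only [y, if_pos (Finset.mem_range.1 hv)]
      rw [add_right_comm]
      gcongr
      have : 500 * M + 30 ≤ 600 * M := by omega
      exact_mod_cast this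
    · rw [← nsmul_eq_mul, ← Finset.card_range W.card, ← Finset.sum_const, Finset.card_range]
      refine Finset.sum_le_sum fun v _ => ?_
      simp [y]
  unfold levelLoop
  refine Trip.loop_step hans (R := fun s' b => Trip ans levelLoop s' R b)
    (B' := (∑ v ∈ Finset.range M, (y v + (Γ + 4))) / M + 14) hloop ?_ ?_ fun s' b hb => hb
  · refine le_trans ?_ hsum
    simp only [Test.cost, NExpr.cost]
    rw [add_left_comm]
    gcongr
    norm_num
  unfold levelBody
  refine Trip.cond (B' := (∑ v ∈ Finset.range M, (y v + (Γ + 4))) / M + 7) ?_ (fun hb => ?_)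
    fun _ => ?_
  · simp only [Test.cost, NExpr.cost]
    rw [add_left_comm]
    gcongr
    norm_num
  -- This branch calls `release`; it is excluded because `W` is empty once the old centers are used
  -- up.
  · simp only [Test.Holds, NExpr.eval] at hb
    have h11 : cs = [] := by
      have := hM.oldChain
      rw [hb.1] at this
      cases cs with
      | nil => rfl
      | cons c cs => exact absurd this.1.symm this.2.1
    rw [h14, hcs h11] at hb
    simp at hb
  refine Trip.seq hans (R := fun s' b => Trip ans (.cond (.natLt (.var 15) (.cell 3 (.lit 0))) hit
    advance) s' (fun s' b => Trip ans levelLoop s' R b) b) (Trip.random (fun v => y v + (Γ + 4)) ?_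
    ?_) fun s' b hb => hb
  · intro v hv
    have hlc' : Chain ((s.setN 15 v).narr 1) ((s.setN 15 v).narr 2 0) l := hlc
    have hv15 : (s.setN 15 v).nvar 15 = v := by simp [State.setN]
    have hM15 := hM.setN (x := 15) (v := v) le_rfl
    refine Trip.cond (B' := y v + Γ) ?_ (fun hb => ?_) fun hb => ?_
    · simp only [Test.cost, NExpr.cost]
      rw [add_comm, add_assoc]
      norm_num
    · have hvl : v < l.length := by
        simp only [Test.Holds, NExpr.eval, hv15] at hb
        rw [← hl3]
        exact hb
      have hf : l.getD v 0 ∈ U \ W := by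
        rw [← hlU, List.mem_toFinset, List.getD_eq_getElem _ _ hvl]
        exact List.getElem_mem hvl
      refine Trip.of_det ((hit_spec hD hM15 hlc' hv15 hvl ?_ (List.getD_eq_getElem l 0 hvl).symm
        hf).mono ?_)
      · rw [← List.toFinset_card_of_nodup hln, hlU]
        exact Finset.card_le_card Finset.sdiff_subset
      rintro s' t ⟨h1, h2, h3⟩
      refine ⟨_, hhit _ hf s' ?_ h1, ?_⟩
      · exact ((LevelFrame.refl _ s).setN (by decide)).trans h2
      · simp only [y, if_pos hvl]
        have h3' : ((64 * garbage N s'.narr : ℕ) : ℝ≥0∞) + t ≤ (500 * M : ℕ) + Γ := by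
          rw [hΓ]
          have h4 : 64 * garbage N s'.narr + t ≤ 500 * M + 64 * garbage N s.narr := by
            rw [add_comm, add_comm (500 * M)]
            exact h3
          exact_mod_cast h4
        calc G (l.getD v 0) + (64 * garbage N s'.narr : ℕ) + t
            = G (l.getD v 0) + ((64 * garbage N s'.narr : ℕ) + t) := by rw [add_assoc]
          _ ≤ G (l.getD v 0) + ((500 * M : ℕ) + Γ) := by gcongr
          _ = (500 * M : ℕ) + G (l.getD v 0) + Γ := by ring
    · have hvl : ¬ v < l.length := by
        simp only [Test.Holds, NExpr.eval, hv15] at hb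
        rw [← hl3]
        exact hb
      have hW : W.Nonempty := by
        rw [← Finset.card_pos]
        simp only [NExpr.eval, h14, hl3] at hv
        omega
      refine Trip.of_det ((hadv hW v).mono ?_)
      rintro s' t ⟨b, h1, h2⟩
      refine ⟨b, h1, ?_⟩
      simp only [y, if_neg hvl]
      exact h2
  · rw [hev]
    gcongr
    simp only [NExpr.cost]
    norm_num

/-- The memory at the end of `levelLoop` and a bound for `F` at the new centers plus the cost of
`finish`. -/
def Stopped (ans : ℕ → ℕ → ℝ → Prop) (Dst : ℕ → ℕ → ℝ) (ρ : ℝ) (N A : Finset ℕ) (h k : ℕ)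
    (F : List ℕ → ℝ≥0∞) (s₀ s : State) (b : ℝ≥0∞) : Prop :=
  ∃ a ns cs W, Mid ans Dst ρ N A h k s a ns cs W ∧ LevelFrame (headers N h) s₀ s ∧
    (a = 0 ∨ W ∪ uncovList (Near Dst ρ) A ns = ∅) ∧
    F ns + (300 * stopCost cs W (uncovList (Near Dst ρ) A ns) : ℕ) + (64 * garbage N s.narr : ℕ) ≤ b

/-- Half of the amount is passed on in `Stopped` for the sake of `finish`; the other half covers the
failing test. -/
theorem levelLoop_exit (hD : LevelData Dst ρ N A h) {s₀ s : State} {a : ℕ}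
    {ns cs : List ℕ} {W : Finset ℕ} (hM : Mid ans Dst ρ N A h k s a ns cs W)
    (hfr : LevelFrame (headers N h) s₀ s) (hdone : a = 0 ∨ W ∪ uncovList (Near Dst ρ) A ns = ∅)
    (F : List ℕ → ℝ≥0∞) :
    Trip ans levelLoop s (Stopped ans Dst ρ N A h k F s₀)
      (F ns + (600 * stopCost cs W (uncovList (Near Dst ρ) A ns) : ℕ) +
        (64 * garbage N s.narr : ℕ)) := by
  obtain ⟨l, hlc, hln, hlU, hl3⟩ := hM.free_list hD
  refine Trip.loop_exit ?_ ⟨a, ns, cs, W, hM, hfr, hdone, le_rfl⟩ ?_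
  · simp only [Test.Holds, NExpr.eval, hM.budget, hM.oldCard, hl3]
    rcases hdone with rfl | hU
    · simp
    · rw [Finset.union_eq_empty] at hU
      have : l.length = 0 := by
        rw [← List.toFinset_card_of_nodup hln, hlU, hU.2]
        simp
      simp [hU.1, this]
  · rw [← add_assoc, ← add_assoc, add_comm _ (F ns), add_assoc (F ns)]
    gcongr
    have : 1 ≤ stopCost cs W (uncovList (Near Dst ρ) A ns) := by
      unfold stopCost
      split_ifs <;> omega
    have h2 : 10 + 300 * stopCost cs W (uncovList (Near Dst ρ) A ns) ≤
        600 * stopCost cs W (uncovList (Near Dst ρ) A ns) := by omega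
    simp only [Test.cost, NExpr.cost]
    exact_mod_cast h2

theorem levelLoop_fresh (hans : Functional ans) (hD : LevelData Dst ρ N A h) {s₀ : State}
    (F : List ℕ → ℝ≥0∞) (a : ℕ) :
    ∀ (s : State) (ns : List ℕ), Mid ans Dst ρ N A h k s a ns [] ∅ →
      LevelFrame (headers N h) s₀ s →
      Trip ans levelLoop s (Stopped ans Dst ρ N A h k F s₀)
        (freshCost (Near Dst ρ) 600 a (uncovList (Near Dst ρ) A ns) (fun l => F (ns ++ l)) +
          (64 * garbage N s.narr : ℕ)) := by
  induction a with
  | zero =>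
    intro s ns hM hfr
    refine (levelLoop_exit hD hM hfr (.inl rfl) F).mono ?_ fun s' b hb => ⟨b, le_rfl, hb⟩
    simp [freshCost, stopCost]
  | succ a ih =>
    intro s ns hM hfr
    by_cases hU : uncovList (Near Dst ρ) A ns = ∅
    · refine (levelLoop_exit hD hM hfr (.inr (by simp [hU])) F).mono ?_
        fun s' b hb => ⟨b, le_rfl, hb⟩
      simp [freshCost, stopCost, hU]
    · refine (levelLoop_step hans hD hM (by simpa using Finset.nonempty_iff_ne_empty.2 hU)
        (fun _ => rfl) (fun f => freshCost (Near Dst ρ) 600 a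
          (uncov (Near Dst ρ) (uncovList (Near Dst ρ) A ns) f) fun l => F (ns ++ f :: l)) 0 _
        ?_ (by simp)).mono ?_ fun s' b hb => ⟨b, le_rfl, hb⟩
      · intro f _ s' hfr' hM'
        have := ih s' _ hM' (hfr.trans hfr')
        rw [uncovList_append] at this
        simpa using this
      · rw [freshCost, if_neg hU]
        simp

/-- Each iteration realizes one line of the recursion for `adaptCost`. It shortens the old sequence,
lowers the new budget, or releases `W` and enters the fresh loop, whose budget decreases as well. So
the loop ends with certainty, not only in expectation. -/
theorem levelLoop_spec (hans : Functional ans) (hD : LevelData Dst ρ N A h) {s₀ : State}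
    (F : List ℕ → ℝ≥0∞) (n : ℕ) :
    ∀ (s : State) (a : ℕ) (ns cs : List ℕ) (W : Finset ℕ), cs.length + a = n →
      Mid ans Dst ρ N A h k s a ns cs W → LevelFrame (headers N h) s₀ s →
      Trip ans levelLoop s (Stopped ans Dst ρ N A h k F s₀)
        (adaptCost (Near Dst ρ) 600 cs a W (uncovList (Near Dst ρ) A ns) (fun l => F (ns ++ l)) +
          (64 * garbage N s.narr : ℕ)) := by
  induction n using Nat.strong_induction_on with
  | _ n ih =>
  intro s a ns cs W hn hM hfr
  cases a with
  | zero =>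
    refine (levelLoop_exit hD hM hfr (.inl rfl) F).mono ?_ fun s' b hb => ⟨b, le_rfl, hb⟩
    cases cs <;> simp [adaptCost, stopCost]
  | succ a =>
  cases cs with
  | nil =>
    by_cases hW : W = ∅
    · subst hW
      rw [adaptCost, if_pos rfl]
      exact levelLoop_fresh hans hD F (a + 1) s ns hM hfr
    · rw [adaptCost, if_neg hW]
      obtain ⟨l, -, -, -, hl3⟩ := hM.free_list hD
      have hWpos : 0 < W.card := Finset.card_pos.2 (Finset.nonempty_iff_ne_empty.2 hW)
      have h11 : s.nvar 11 = 0 := hM.oldChain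
      unfold levelLoop
      refine Trip.loop_step hans (R := fun s' b => Trip ans levelLoop s'
        (Stopped ans Dst ρ N A h k F s₀) b)
        (B' := (freshCost (Near Dst ρ) 600 (a + 1) (uncovList (Near Dst ρ) A ns)
          (fun l => F (ns ++ l)) + (64 * garbage N s.narr : ℕ)) +
          (7 + 100 * (1 + (W ∪ uncovList (Near Dst ρ) A ns).card) : ℕ)) ?_ ?_ ?_ fun s' b hb => hb
      · simp only [Test.Holds, NExpr.eval, hM.budget, hM.oldCard]
        omega
      · have h1 : ((10 : ℕ) : ℝ≥0∞) +
            (7 + 100 * (1 + (W ∪ uncovList (Near Dst ρ) A ns).card) : ℕ) ≤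
            (600 * (1 + (W ∪ uncovList (Near Dst ρ) A ns).card) : ℕ) := by
          rw [← Nat.cast_add, Nat.cast_le]
          omega
        simp only [Test.cost, NExpr.cost]
        rw [add_left_comm, add_assoc (Nat.cast _) (freshCost _ _ _ _ _),
          add_comm (Nat.cast (600 * _))]
        gcongr
      · unfold levelBody
        refine Trip.cond (B' := (freshCost (Near Dst ρ) 600 (a + 1) (uncovList (Near Dst ρ) A ns)
          (fun l => F (ns ++ l)) + (64 * garbage N s.narr : ℕ)) +
          (100 * (1 + (W ∪ uncovList (Near Dst ρ) A ns).card) : ℕ)) ?_ (fun _ => ?_)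
          fun hb => absurd ?_ hb
        · simp only [Test.cost, NExpr.cost]
          rw [add_left_comm, ← Nat.cast_add]
        · refine Trip.of_det ((release_spec hD hM).mono ?_)
          rintro s' t ⟨h1, h2, h3⟩
          refine ⟨_, levelLoop_fresh hans hD F (a + 1) s' ns h1 (hfr.trans h2), ?_⟩
          have h3' : ((64 * garbage N s'.narr : ℕ) : ℝ≥0∞) + t ≤ (64 * garbage N s.narr : ℕ) +
              (100 * (1 + (W ∪ uncovList (Near Dst ρ) A ns).card) : ℕ) := by
            rw [← Nat.cast_add, ← Nat.cast_add, Nat.cast_le, add_comm]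
            exact h3
          rw [add_assoc, add_assoc]
          gcongr
        · simp only [Test.Holds, NExpr.eval, hM.oldCard]
          exact ⟨h11, hWpos⟩
  | cons c cs =>
    have hcW : c ∈ W := hM.old_mem c (by simp)
    set U := uncovList (Near Dst ρ) A ns with hU
    have hMpos : 1 ≤ (W ∪ U).card := Finset.card_pos.2 ⟨c, Finset.mem_union_left _ hcW⟩
    have e : ∀ f, uncovList (Near Dst ρ) A (ns ++ [f]) = uncov (Near Dst ρ) U f := fun f =>
      uncovList_append
    refine (levelLoop_step hans hD hM ⟨c, Finset.mem_union_left _ hcW⟩ (by simp)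
        (fun f => adaptCost (Near Dst ρ) 600 (c :: cs) a W (uncov (Near Dst ρ) U f)
          fun l => F (ns ++ f :: l))
        (if c ∈ U then (200 * (1 + (U \ W).card) : ℕ) +
          adaptCost (Near Dst ρ) 600 cs a (uncov (Near Dst ρ) W c) (uncov (Near Dst ρ) U c)
            fun l => F (ns ++ c :: l)
        else (200 * (W ∪ U).card : ℕ) + adaptCost (Near Dst ρ) 600 cs (a + 1)
          (uncov (Near Dst ρ) W c) U fun l => F (ns ++ l)) _ ?_ ?_).mono ?_
        fun s' b hb => ⟨b, le_rfl, hb⟩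
    · intro f _ s' hfr' hM'
      have := ih _ (by rw [← hn, List.length_cons]; omega) s' a (ns ++ [f]) (c :: cs) W rfl hM' (hfr.trans hfr')
      rw [e] at this
      simpa using this
    · intro _ v
      refine (advance_spec hD (hM.setN (x := 15) (v := v) le_rfl)).mono ?_
      rintro s' t ⟨h1, h2⟩
      have hfr' := hfr.trans (((LevelFrame.refl (headers N h) s).setN (x := 15) (v := v)
        (by decide)).trans h1)
      by_cases hc : c ∈ U
      · rw [if_pos hc] at h2
        rw [if_pos hc]
        obtain ⟨h2, h3⟩ := h2
        have := ih _ (by rw [← hn, List.length_cons]; omega) s' a (ns ++ [c]) cs _ rfl h2 hfr'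
        rw [e] at this
        simp only [List.append_assoc, List.singleton_append] at this
        refine ⟨_, this, ?_⟩
        have h3' : ((64 * garbage N s'.narr : ℕ) : ℝ≥0∞) + t ≤
            (200 * (1 + (U \ W).card) : ℕ) + (64 * garbage N s.narr : ℕ) := by
          have h4 : 64 * garbage N s'.narr + t ≤ 200 * (1 + (U \ W).card) +
              64 * garbage N s.narr := by
            rw [add_comm, add_comm (200 * _)]
            exact h3
          exact_mod_cast h4
        rw [add_assoc, add_right_comm, add_comm (adaptCost _ _ _ _ _ _ _)]
        gcongr
      · rw [if_neg hc] at h2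
        rw [if_neg hc]
        obtain ⟨h2, h3⟩ := h2
        have := ih _ (by rw [← hn, List.length_cons]; omega) s' (a + 1) ns cs _ rfl h2 hfr'
        refine ⟨_, this, ?_⟩
        have h3' : ((64 * garbage N s'.narr : ℕ) : ℝ≥0∞) + t ≤
            (200 * (W ∪ U).card : ℕ) + (64 * garbage N s.narr : ℕ) := by
          have h4 : 64 * garbage N s'.narr + t ≤ 200 * (W ∪ U).card +
              64 * garbage N s.narr := by
            rw [add_comm, add_comm (200 * _)]
            exact h3
          exact_mod_cast h4
        rw [add_assoc, add_right_comm, add_comm (adaptCost _ _ _ _ _ _ _)]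
        gcongr
    · rw [adaptCost]
      gcongr
      split_ifs
      · rw [add_right_comm]
        gcongr
        have : 200 * (1 + (U \ W).card) + 30 ≤ 600 * (1 + (U \ W).card) := by omega
        exact_mod_cast this
      · rw [add_right_comm]
        gcongr
        have : 200 * (W ∪ U).card + 30 ≤ 600 * (W ∪ U).card := by omega
        exact_mod_cast this

end Level

end DynKCenter

/-! ### An update at one level -/

namespace DynKCenter

/-- Add the node in variable `10`, whose point has the name in variable `2`, to a level. -/
def levelInsert : Program :=
  .storeN 8 (.var 10) (.var 2) ;;
  .storeN 1 (.var 10) (.lit 0) ;;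
  .storeN 2 (.lit 0) (.var 10) ;;
  .storeN 3 (.lit 0) (.lit 1) ;;
  .storeN 5 (.var 10) (.lit 0)

/-- Mark the node in variable `10` as deleted. -/
def levelDelete : Program :=
  .storeN 6 (.var 10) (.lit 1) ;;
  .storeN 3 (.cell 5 (.var 10)) (.sub (.cell 3 (.cell 5 (.var 10))) (.lit 1)) ;;
  .storeN 5 (.var 10) (.lit 0)

/-- Set the variables that are used to process the level in variable `8`. -/
def levelSetup : Program :=
  .setN 11 (.cell 7 (.var 9)) ;;
  .setN 12 (.var 9) ;;
  .setN 13 (.var 0) ;;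
  .setN 14 (.var 5)

/-- Prepare the level in variable `8` for the update. -/
def levelPrep : Program :=
  .setN 9 (.add (.var 8) (.lit 1)) ;;
  .setN 10 (.add (.var 7) (.var 8)) ;;
  .setR 3 (.cell 0 (.var 8)) ;;
  .cond (.natEq (.var 1) (.lit 0)) levelInsert levelDelete ;;
  levelSetup

/-- Process the update in the level in variable `8`, and pass to the next level. -/
def levelRoutine : Program :=
  levelPrep ;;
  levelLoop ;;
  finish ;;
  .setN 8 (.add (.var 8) (.lit 1))

variable {ans : ℕ → ℕ → ℝ → Prop}

section Level
open Classical

variable {Dst : ℕ → ℕ → ℝ} {ρ : ℝ} {N A : Finset ℕ} {h k : ℕ}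

theorem headers_insert {x : ℕ} : headers (insert x N) h = insert x (headers N h) := by
  unfold headers
  rw [Finset.insert_comm h x, Finset.insert_comm 0 x]

/-- The free list is empty between updates, so the new node can be its only element. The cells of
the node are still zero, so the list that it heads is empty too. The proof first regards `x` as
pending in a list that is being poured and then applies `Links.push`. -/
theorem Linked.insert_node (hD : LevelData Dst ρ N A h) {x : ℕ} (hx0 : x ≠ 0) (hxh : x ≠ h) (hxN : x ∉ N)
    {m m' : ℕ → ℕ → ℕ} (hL : Linked N (headers N h) A m) (hm0 : m 2 0 = 0) (hm2 : m 2 x = 0)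
    (hm3 : m 3 x = 0) (h1 : m' 1 = Function.update (m 1) x 0)
    (h2 : m' 2 = Function.update (m 2) 0 x) (h3 : m' 3 = Function.update (m 3) 0 1)
    (h5 : m' 5 = Function.update (m 5) x 0) (h6 : m' 6 = m 6) :
    Linked (insert x N) (headers (insert x N) h) (insert x A) m' := by
  obtain ⟨Lst, hL⟩ := hL
  have h0 : 0 ∈ headers N h := zero_mem_headers
  have hxH : x ∉ headers N h := by
    simp only [headers, Finset.mem_insert, not_or]
    exact ⟨hx0, hxh, hxN⟩
  have hxA : x ∉ A := fun hh => hxN (hD.subset hh)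
  have hL0 : Lst 0 = [] := by
    have := hL.chain 0 h0
    rw [hm0] at this
    cases hl : Lst 0 with
    | nil => rfl
    | cons y l =>
      rw [hl] at this
      exact absurd this.1.symm this.2.1
  have hm30 : m 3 0 = 0 := by
    rw [hL.count 0 h0, hL0]
    rfl
  have hxL : ∀ g ∈ headers N h, ∀ y ∈ Lst g, y ≠ x := by
    rintro g hg y hy rfl
    exact hxN (hL.sub g hg y hy)
  have hgx : ∀ g ∈ headers N h, g ≠ x := by
    rintro g hg rfl
    exact hxH hg
  let m₁ : ℕ → ℕ → ℕ := Function.update m 5 (Function.update (m 5) x 0)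
  have e5 : m₁ 5 = Function.update (m 5) x 0 := Function.update_self ..
  have e : ∀ b, b ≠ 5 → m₁ b = m b := fun b hb => Function.update_of_ne hb _ _
  have e5' : ∀ z, z ≠ x → m₁ 5 z = m 5 z := fun z hz => by rw [e5, Function.update_of_ne hz]
  have key : Links (insert x N) (headers (insert x N) h) (insert x A) m₁ 0 [x]
      (Function.update Lst x []) := by
    rw [headers_insert]
    have hH : ∀ {P : ℕ → List ℕ → Prop}, P x [] → (∀ g ∈ headers N h, P g (Lst g)) →
        ∀ g ∈ insert x (headers N h), P g (Function.update Lst x [] g) := by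
      intro P hP hP' g hg
      rw [Finset.mem_insert] at hg
      rcases hg with rfl | hg
      · rwa [Function.update_self]
      · rw [Function.update_of_ne (hgx g hg)]
        exact hP' g hg
    constructor
    · rw [e 1 (by decide), e 2 (by decide)]
      exact hH (P := fun g l => Chain (m 1) (m 2 g) l) hm2 hL.chain
    · exact hH (P := fun g l => ∀ y ∈ l, y ∈ insert x N) (by simp) fun g hg y hy =>
        Finset.mem_insert_of_mem (hL.sub g hg y hy)
    · exact hH (P := fun g l => l.Nodup) (by simp) hL.nodup
    · refine hH (P := fun g l => ∀ g' ∈ insert x (headers N h), ∀ y ∈ l,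
        y ∈ Function.update Lst x [] g' → g = g') (by simp) fun g hg => ?_
      exact hH (P := fun g' l => ∀ y ∈ Lst g, y ∈ l → g = g') (by simp) fun g' hg' =>
        hL.disj g hg g' hg'
    · rw [e 3 (by decide)]
      refine hH (P := fun g l => m 3 g = (l.filter (· ∈ insert x A)).length) (by simpa using hm3)
        fun g hg => ?_
      rw [hL.count g hg]
      congr 1
      refine List.filter_congr fun y hy => ?_
      simp [hxL g hg y hy]
    · intro y hy
      rw [Finset.mem_insert] at hy
      by_cases hyx : y = x
      · subst hyx
        rw [e5, Function.update_self]
        exact ⟨by simp [h0], .inr ⟨rfl, by simp⟩⟩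
      · obtain ⟨a, b⟩ := hL.lead y (hy.resolve_left hyx)
        rw [e5' y hyx, Function.update_of_ne (hgx _ a)]
        exact ⟨by simp [a], .inl (by simpa using b)⟩
    · refine hH (P := fun g l => ∀ y ∈ l, y ∈ insert x A → m₁ 5 y = g) (by simp)
        fun g hg y hy hyA => ?_
      rw [e5' y (hxL g hg y hy)]
      exact hL.alive g hg y hy (Finset.mem_of_mem_insert_of_ne hyA (hxL g hg y hy))
    · refine hH (P := fun g l => ∀ y ∈ l, y ∉ insert x A → g ≠ 0 ∧ m₁ 6 y = 1 ∧ m₁ 5 y ≠ g) (by simp)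
        fun g hg y hy hyA => ?_
      rw [e5' y (hxL g hg y hy), e 6 (by decide)]
      exact hL.dead g hg y hy fun hh => hyA (by simp [hh])
    · simp
    · simp [e5]
    · simp
    · simp only [List.mem_singleton, forall_eq]
      exact hH (P := fun g l => x ∉ l) (by simp) fun g hg hh => hxL g hg x hh rfl
    · simp
  refine ⟨_, key.push (tg := 0) (m' := m') ?_ (by simp) zero_mem_headers ?_ ?_ ?_ ?_ ?_⟩
  · simp only [Finset.mem_insert, not_or]
    exact ⟨hx0.symm, hD.zero_notMem⟩
  · rw [e 1 (by decide), e 2 (by decide), hm0, h1]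
  · rw [e 2 (by decide), h2]
  · rw [e 3 (by decide), h3, hm30]
  · rw [h5, e5, Function.update_idem]
  · rw [h6, e 6 (by decide)]

/-- The node stays in its list; the count of the list and the marks of the node change. The
condition `m 5 x ≠ 0` keeps deleted nodes out of the free list. -/
theorem Linked.erase_node {x : ℕ} (hxA : x ∈ A) {H : Finset ℕ}
    {m m' : ℕ → ℕ → ℕ} (hL : Linked N H A m) (hx : m 5 x ≠ 0) (h1 : m' 1 = m 1)
    (h2 : m' 2 = m 2) (h3 : m' 3 = Function.update (m 3) (m 5 x) (m 3 (m 5 x) - 1))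
    (h5 : m' 5 = Function.update (m 5) x 0) (h6 : m' 6 = Function.update (m 6) x 1) :
    Linked N H (A.erase x) m' := by
  obtain ⟨Lst, hL⟩ := hL
  have e5 : ∀ z, z ≠ x → m' 5 z = m 5 z := fun z hz => by rw [h5, Function.update_of_ne hz]
  refine ⟨Lst, ?_, hL.sub, hL.nodup, hL.disj, ?_, ?_, ?_, ?_, by simp, by simp, by simp, by simp,
    by simp⟩
  · rw [h1, h2]
    exact hL.chain
  · intro g hg
    have e : (Lst g).filter (· ∈ A.erase x) = ((Lst g).filter (· ∈ A)).erase x := by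
      rw [((hL.nodup g hg).filter _).erase_eq_filter, List.filter_filter]
      refine List.filter_congr fun y _ => ?_
      rw [Bool.eq_iff_iff]
      simp
    rw [h3, e]
    by_cases hgx : g = m 5 x
    · subst hgx
      rw [Function.update_self, List.length_erase_of_mem, ← hL.count _ hg]
      have := (hL.lead x hxA).2
      simpa [hxA] using this
    · rw [Function.update_of_ne hgx, hL.count g hg, List.erase_of_not_mem]
      intro hh
      rw [List.mem_filter] at hh
      exact hgx (hL.alive g hg x hh.1 hxA).symm
  · intro y hy
    rw [Finset.mem_erase] at hy
    rw [e5 y hy.1]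
    simpa using hL.lead y hy.2
  · intro g hg y hy hyA
    rw [Finset.mem_erase] at hyA
    rw [e5 y hyA.1]
    exact hL.alive g hg y hy hyA.2
  · intro g hg y hy hyA
    by_cases hyx : y = x
    · subst hyx
      have := hL.alive g hg y hy hxA
      rw [h5, h6, Function.update_self, Function.update_self]
      rw [this] at hx
      exact ⟨hx, rfl, hx.symm⟩
    · rw [e5 y hyx, h6, Function.update_of_ne hyx]
      exact hL.dead g hg y hy fun hh => hyA (by simp [hh, hyx])

/-- What `levelRoutine` leaves unchanged. -/
structure RoutineFrame (H : Finset ℕ) (s s' : State) : Prop where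
  nvar : ∀ x, x ≤ 7 → s'.nvar x = s.nvar x
  rvar : ∀ x, x ≠ 3 → x ≠ 4 → s'.rvar x = s.rvar x
  rarr : s'.rarr = s.rarr
  arr : ∀ a, a = 0 ∨ 9 ≤ a → s'.narr a = s.narr a
  out : ∀ a i, i ∉ H → s'.narr a i = s.narr a i

theorem Mid.of_prep {s : State} {cs : List ℕ} {W : Finset ℕ}
    (hL : Linked N (headers N h) A s.narr)
    (hlead : ∀ y ∈ A, s.narr 5 y = if y ∈ W then leader (Near Dst ρ) h cs y else 0)
    (h13 : s.nvar 13 = k) (h14 : s.nvar 14 = W.card) (h9 : s.nvar 9 = h) (h12 : s.nvar 12 = h)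
    (hc : Chain (s.narr 7) (s.nvar 11) cs)
    (hs : ∀ c ∈ cs, s.narr 4 c = (W.filter fun y => leader (Near Dst ρ) h cs y = c).card)
    (hG : Greedy (Near Dst ρ) k cs W) (hW : W ⊆ N) (hdel : ∀ z ∈ W, z ∉ A → s.narr 5 z = 0)
    (hρ : s.rvar 3 = ρ) (hans : ∀ x ∈ A, ∀ y ∈ A, ans (s.narr 8 x) (s.narr 8 y) (Dst x y)) :
    Mid ans Dst ρ N A h k s k [] cs W where
  linked := hL
  lead y hy := by rw [hlead y hy]; simp [leadOf]
  budget := h13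
  oldCard := h14
  header := h9
  oldChain := hc
  newSeg := h12
  oldSize := hs
  newSize := by simp
  oldGreedy := ⟨k, hG⟩
  newGreedy l hl := by simpa using hl
  newNotMem := by simp
  newMem := by simp
  newNodup := by simp
  oldSubset := hW
  deleted := hdel
  radius := hρ
  oracle := hans

/-- The old sequence was chosen for `W = A` and the new one is meant for `insert x A`, so the
coupling starts with `x` as the only free node. -/
theorem levelPrep_insert (hD : LevelData Dst ρ N A h) {x : ℕ} (hx0 : x ≠ 0) (hxh : x ≠ h)
    (hxN : x ∉ N) {s : State} {cs : List ℕ} (hI : LevelInv Dst ρ N A h k s.narr cs) (nm : ℕ → ℕ)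
    (hnm : ∀ y ∈ N, s.narr 8 y = nm y) (hx : s.nvar 2 = nm x) (hm2 : s.narr 2 x = 0)
    (hm3 : s.narr 3 x = 0) (hm6 : s.narr 6 x = 0)
    (hans : ∀ y ∈ insert x A, ∀ z ∈ insert x A, ans (nm y) (nm z) (Dst y z))
    (h0 : s.nvar 0 = k) (h1 : s.nvar 1 = 0) (h5 : s.nvar 5 = A.card)
    (h8 : s.nvar 8 + 1 = h) (h7 : s.nvar 7 + s.nvar 8 = x) (hρ : s.rarr 0 (s.nvar 8) = ρ) :
    Det ans levelPrep s fun s' t => Mid ans Dst ρ (insert x N) (insert x A) h k s' k [] cs A ∧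
      RoutineFrame (headers (insert x N) h) s s' ∧ (∀ y ∈ insert x N, s'.narr 8 y = nm y) ∧
      s'.nvar 8 = s.nvar 8 ∧
      t + 64 * garbage (insert x N) s'.narr ≤ 64 * garbage N s.narr + 200 := by
  set s₂ : State := ((((((((((((s.setN 9 h).setN 10 x).setR 3 ρ).storeN 8 x (nm x)).storeN 1 x
    0).storeN 2 0 x).storeN 3 0 1).storeN 5 x 0).setN 11 (s.narr 7 h)).setN 12 h).setN 13 k).setN 14
    A.card) with hs₂
  have hdet : Det ans levelPrep s fun s' t => s' = s₂ ∧ t ≤ 100 := by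
    unfold levelPrep
    refine Det.seq (Det.setN (Det.seq (Det.setN (Det.seq (Det.setR (Det.seq (Det.cond (fun _ => ?_)
      fun hb => absurd ?_ hb)))))))
    swap
    · simp [Test.Holds, NExpr.eval, State.setN, State.setR, h1]
    unfold levelInsert levelSetup
    iterate 4 refine Det.seq (Det.storeN ?_)
    refine Det.storeN ?_
    iterate 3 refine Det.seq (Det.setN ?_)
    refine Det.setN ?_
    refine ⟨?_, ?_⟩
    · rw [hs₂]
      simp [NExpr.eval, RExpr.eval, State.setN, State.setR, State.storeN, h0, h5, h7, h8, hρ, hx]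
    · simp [NExpr.cost, RExpr.cost, Test.cost]
  refine hdet.mono ?_
  rintro s' t ⟨rfl, ht⟩
  clear hdet
  have a1 : s₂.narr 1 = Function.update (s.narr 1) x 0 := by
    simp [hs₂, State.setN, State.setR, State.storeN]
  have a2 : s₂.narr 2 = Function.update (s.narr 2) 0 x := by
    simp [hs₂, State.setN, State.setR, State.storeN]
  have a3 : s₂.narr 3 = Function.update (s.narr 3) 0 1 := by
    simp [hs₂, State.setN, State.setR, State.storeN]
  have a5 : s₂.narr 5 = Function.update (s.narr 5) x 0 := by
    simp [hs₂, State.setN, State.setR, State.storeN]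
  have a8 : s₂.narr 8 = Function.update (s.narr 8) x (nm x) := by
    simp [hs₂, State.setN, State.setR, State.storeN]
  have ha : ∀ b, b ≠ 1 → b ≠ 2 → b ≠ 3 → b ≠ 5 → b ≠ 8 → s₂.narr b = s.narr b := by
    intro b h1 h2 h3 h5 h8
    simp [hs₂, State.setN, State.setR, State.storeN, h1, h2, h3, h5, h8]
  have hname : ∀ y ∈ insert x N, s₂.narr 8 y = nm y := by
    intro y hy
    rw [a8]
    by_cases hyx : y = x
    · rw [hyx, Function.update_self]
    · rw [Function.update_of_ne hyx]
      exact hnm y (Finset.mem_of_mem_insert_of_ne hy hyx)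
  have hcsA := hI.greedy.mem
  have hxA : x ∉ A := fun hh => hxN (hD.subset hh)
  have hsub : insert x A ⊆ insert x N := Finset.insert_subset_insert x hD.subset
  refine ⟨Mid.of_prep ?_ ?_ ?_ ?_ ?_ ?_ ?_ ?_ hI.greedy ?_ ?_ ?_ ?_, ⟨?_, ?_, rfl, ?_, ?_⟩, hname, ?_,
    ?_⟩
  · exact hI.linked.insert_node hD hx0 hxh hxN hI.free hm2 hm3 a1 a2 a3 a5
      (ha 6 (by decide) (by decide) (by decide) (by decide) (by decide))
  · intro y hy
    rw [a5]
    by_cases hyx : y = x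
    · rw [hyx, Function.update_self, if_neg hxA]
    · have hyA := Finset.mem_of_mem_insert_of_ne hy hyx
      rw [Function.update_of_ne hyx, hI.lead y hyA, if_pos hyA]
  · simp [hs₂, State.setN]
  · simp [hs₂, State.setN]
  · simp [hs₂, State.setN, State.setR, State.storeN]
  · simp [hs₂, State.setN]
  · rw [ha 7 (by decide) (by decide) (by decide) (by decide) (by decide)]
    simpa [hs₂, State.setN] using hI.chain
  · intro c hc
    rw [ha 4 (by decide) (by decide) (by decide) (by decide) (by decide), hI.size c hc]
  · exact hD.subset.trans (Finset.subset_insert _ _)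
  · intro z hz hzA
    exact absurd (Finset.mem_insert_of_mem hz) hzA
  · simp [hs₂, State.setN, State.setR, State.storeN]
  · intro y hy z hz
    rw [hname y (hsub hy), hname z (hsub hz)]
    exact hans y hy z hz
  · intro z hz
    simp [hs₂, State.setN, State.setR, State.storeN, show z ≠ 9 by omega, show z ≠ 10 by omega,
      show z ≠ 11 by omega, show z ≠ 12 by omega, show z ≠ 13 by omega, show z ≠ 14 by omega]
  · intro z hz hz'
    simp [hs₂, State.setN, State.setR, State.storeN, hz]
  · intro a hz
    exact ha a (by omega) (by omega) (by omega) (by omega) (by omega)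
  · intro a i hi
    have hix : x ≠ i := by
      rintro rfl
      exact hi (subset_headers (by simp))
    have hi0 : 0 ≠ i := by
      rintro rfl
      exact hi zero_mem_headers
    show State.narr (((((((s.setN 9 h).setN 10 x).setR 3 ρ).storeN 8 x (nm x)).storeN 1 x
      0).storeN 2 0 x).storeN 3 0 1 |>.storeN 5 x 0) a i = _
    rw [State.narr_storeN_of_ne hix.symm, State.narr_storeN_of_ne hi0.symm,
      State.narr_storeN_of_ne hi0.symm, State.narr_storeN_of_ne hix.symm,
      State.narr_storeN_of_ne hix.symm]
    rfl
  · simp [hs₂, State.setN, State.setR, State.storeN]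
  · have g : garbage (insert x N) s₂.narr = garbage N s.narr := by
      unfold garbage
      rw [ha 6 (by decide) (by decide) (by decide) (by decide) (by decide), Finset.filter_insert,
        if_neg (by rw [hm6]; decide)]
    rw [g]
    omega

/-- The deleted node remains in `W`, from which the old sequence was drawn, and leaves only the
active set. It may add one unit of `garbage`; the charge of 64 is part of the 200. -/
theorem levelPrep_delete (hD : LevelData Dst ρ N A h) {x : ℕ} (hxA : x ∈ A) {s : State}
    {cs : List ℕ} (hI : LevelInv Dst ρ N A h k s.narr cs) (nm : ℕ → ℕ)
    (hnm : ∀ y ∈ N, s.narr 8 y = nm y)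
    (hans : ∀ y ∈ A, ∀ z ∈ A, ans (nm y) (nm z) (Dst y z))
    (h0 : s.nvar 0 = k) (h1 : s.nvar 1 = 1) (h5 : s.nvar 5 = A.card)
    (h8 : s.nvar 8 + 1 = h) (h7 : s.nvar 7 + s.nvar 8 = x) (hρ : s.rarr 0 (s.nvar 8) = ρ) :
    Det ans levelPrep s fun s' t => Mid ans Dst ρ N (A.erase x) h k s' k [] cs A ∧
      RoutineFrame (headers N h) s s' ∧ (∀ y ∈ N, s'.narr 8 y = nm y) ∧
      s'.nvar 8 = s.nvar 8 ∧
      t + 64 * garbage N s'.narr ≤ 64 * garbage N s.narr + 200 := by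
  have hcsA := hI.greedy.mem
  have hlx : s.narr 5 x ≠ 0 := by
    rw [hI.lead x hxA]
    exact leader_ne_zero hD (fun c hc => hD.subset (hcsA c hc)) x
  set s₂ : State := ((((((((((s.setN 9 h).setN 10 x).setR 3 ρ).storeN 6 x 1).storeN 3 (s.narr 5 x)
    (s.narr 3 (s.narr 5 x) - 1)).storeN 5 x 0).setN 11 (s.narr 7 h)).setN 12 h).setN 13 k).setN 14
    A.card) with hs₂
  have hdet : Det ans levelPrep s fun s' t => s' = s₂ ∧ t ≤ 100 := by
    unfold levelPrep
    refine Det.seq (Det.setN (Det.seq (Det.setN (Det.seq (Det.setR (Det.seq (Det.cond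
      (fun hb => absurd hb ?_) (fun _ => ?_))))))))
    · simp [Test.Holds, NExpr.eval, State.setN, State.setR, h1]
    unfold levelDelete levelSetup
    iterate 2 refine Det.seq (Det.storeN ?_)
    refine Det.storeN ?_
    iterate 3 refine Det.seq (Det.setN ?_)
    refine Det.setN ?_
    refine ⟨?_, ?_⟩
    · rw [hs₂]
      simp [NExpr.eval, RExpr.eval, State.setN, State.setR, State.storeN, h0, h5, h7, h8, hρ]
    · simp [NExpr.cost, RExpr.cost, Test.cost]
  refine hdet.mono ?_
  rintro s' t ⟨rfl, ht⟩
  clear hdet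
  have a3 : s₂.narr 3 = Function.update (s.narr 3) (s.narr 5 x) (s.narr 3 (s.narr 5 x) - 1) := by
    simp [hs₂, State.setN, State.setR, State.storeN]
  have a5 : s₂.narr 5 = Function.update (s.narr 5) x 0 := by
    simp [hs₂, State.setN, State.setR, State.storeN]
  have a6 : s₂.narr 6 = Function.update (s.narr 6) x 1 := by
    simp [hs₂, State.setN, State.setR, State.storeN]
  have ha : ∀ b, b ≠ 3 → b ≠ 5 → b ≠ 6 → s₂.narr b = s.narr b := by
    intro b h3 h5 h6
    simp [hs₂, State.setN, State.setR, State.storeN, h3, h5, h6]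
  have hname : ∀ y ∈ N, s₂.narr 8 y = nm y := by
    intro y hy
    rw [ha 8 (by decide) (by decide) (by decide)]
    exact hnm y hy
  have hsub : A.erase x ⊆ A := Finset.erase_subset x A
  refine ⟨Mid.of_prep ?_ ?_ ?_ ?_ ?_ ?_ ?_ ?_ hI.greedy hD.subset ?_ ?_ ?_, ⟨?_, ?_, rfl, ?_, ?_⟩, hname,
    ?_, ?_⟩
  · exact hI.linked.erase_node hxA hlx (ha 1 (by decide) (by decide) (by decide))
      (ha 2 (by decide) (by decide) (by decide)) a3 a5 a6
  · intro y hy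
    rw [Finset.mem_erase] at hy
    rw [a5, Function.update_of_ne hy.1, if_pos hy.2, hI.lead y hy.2]
  · simp [hs₂, State.setN]
  · simp [hs₂, State.setN]
  · simp [hs₂, State.setN, State.setR, State.storeN]
  · simp [hs₂, State.setN]
  · rw [ha 7 (by decide) (by decide) (by decide)]
    simpa [hs₂, State.setN] using hI.chain
  · intro c hc
    rw [ha 4 (by decide) (by decide) (by decide), hI.size c hc]
  · intro z hz hzA
    have : z = x := by
      by_contra hzx
      exact hzA (Finset.mem_erase.2 ⟨hzx, hz⟩)
    rw [this, a5, Function.update_self]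
  · simp [hs₂, State.setN, State.setR, State.storeN]
  · intro y hy z hz
    rw [hname y (hD.subset (hsub hy)), hname z (hD.subset (hsub hz))]
    exact hans y (hsub hy) z (hsub hz)
  · intro z hz
    simp [hs₂, State.setN, State.setR, State.storeN, show z ≠ 9 by omega, show z ≠ 10 by omega,
      show z ≠ 11 by omega, show z ≠ 12 by omega, show z ≠ 13 by omega, show z ≠ 14 by omega]
  · intro z hz hz'
    simp [hs₂, State.setN, State.setR, State.storeN, hz]
  · intro a hz
    exact ha a (by omega) (by omega) (by omega)
  · intro a i hi
    have hix : x ≠ i := by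
      rintro rfl
      exact hi (subset_headers (hD.subset hxA))
    have hi0 : s.narr 5 x ≠ i := by
      rintro rfl
      exact hi (hI.linked.lead_mem hxA)
    show State.narr (((((s.setN 9 h).setN 10 x).setR 3 ρ).storeN 6 x 1).storeN 3 (s.narr 5 x)
      (s.narr 3 (s.narr 5 x) - 1) |>.storeN 5 x 0) a i = _
    rw [State.narr_storeN_of_ne hix.symm, State.narr_storeN_of_ne hi0.symm,
      State.narr_storeN_of_ne hix.symm]
    rfl
  · simp [hs₂, State.setN, State.setR, State.storeN]
  · have g : garbage N s₂.narr ≤ garbage N s.narr + 1 := by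
      unfold garbage
      refine le_trans (Finset.card_le_card ?_)
        (Finset.card_insert_le x (N.filter fun y => s.narr 6 y = 1))
      intro y
      simp only [Finset.mem_filter, Finset.mem_insert, a6]
      by_cases hyx : y = x
      · simp [hyx]
      · simp [hyx]
    clear * - g ht
    omega

/-- The function `F` of the new centers stands for the expected cost of the future, about which
nothing is assumed. -/
theorem levelRoutine_spec (hans : Functional ans) {A' N' : Finset ℕ}
    (hD : LevelData Dst ρ N' A' h) {s : State} {cs : List ℕ} {c : ℕ} (nm : ℕ → ℕ)
    (F : List ℕ → ℝ≥0∞)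
    (hprep : Det ans levelPrep s fun s' t => Mid ans Dst ρ N' A' h k s' k [] cs A ∧
      RoutineFrame (headers N' h) s s' ∧ (∀ y ∈ N', s'.narr 8 y = nm y) ∧
      s'.nvar 8 = s.nvar 8 ∧ t + 64 * garbage N' s'.narr ≤ c) :
    Trip ans levelRoutine s (fun s' b => ∃ cs', LevelInv Dst ρ N' A' h k s'.narr cs' ∧
        RoutineFrame (headers N' h) s s' ∧ (∀ y ∈ N', s'.narr 8 y = nm y) ∧
        s'.nvar 8 = s.nvar 8 + 1 ∧ F cs' + (64 * garbage N' s'.narr : ℕ) ≤ b)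
      (adaptCost (Near Dst ρ) 600 cs k A A' F + c) := by
  unfold levelRoutine
  refine Trip.seq hans (R := fun s₁ b => Mid ans Dst ρ N' A' h k s₁ k [] cs A ∧
      RoutineFrame (headers N' h) s s₁ ∧ (∀ y ∈ N', s₁.narr 8 y = nm y) ∧
      s₁.nvar 8 = s.nvar 8 ∧ adaptCost (Near Dst ρ) 600 cs k A A' F +
        (64 * garbage N' s₁.narr : ℕ) ≤ b) (Trip.of_det (hprep.mono ?_)) ?_
  · rintro s₁ t ⟨h1, h2, h3, h4, h5⟩
    refine ⟨_, ⟨h1, h2, h3, h4, le_rfl⟩, ?_⟩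
    rw [add_assoc]
    gcongr
    rw [← Nat.cast_add, Nat.cast_le, add_comm]
    exact h5
  rintro s₁ b ⟨h1, h2, h3, h4, h5⟩
  refine Trip.seq hans (R := Stopped ans Dst ρ N' A' h k F s₁) ?_ ?_
  · have := levelLoop_spec hans hD F _ s₁ k [] cs A rfl h1 (LevelFrame.refl _ _)
    refine this.mono ?_ fun s' b hb => ⟨b, le_rfl, hb⟩
    simpa using h5
  rintro s₂ b' ⟨a, ns, cs', W, hM, hfr, hdone, hb'⟩
  refine Trip.of_det (Det.seq ((finish_spec hD hM hdone).mono ?_))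
  rintro s₃ t ⟨g1, g2, g3⟩
  have hfr' := hfr.trans g2
  refine Det.setN ⟨_, ⟨ns, g1, ⟨?_, ?_, ?_, ?_, ?_⟩, ?_, ?_, le_rfl⟩, ?_⟩
  · intro x hx
    rw [← h2.nvar x hx, ← hfr'.nvar x (by omega)]
    exact Function.update_of_ne (by omega) _ _
  · intro x hx hx'
    rw [← h2.rvar x hx hx', ← hfr'.rvar x hx']
    rfl
  · exact hfr'.rarr.trans h2.rarr
  · intro a ha
    rw [← h2.arr a ha, ← hfr'.arr a (by omega)]
    rfl
  · intro a i hi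
    rw [← h2.out a i hi, ← hfr'.out a i hi]
    rfl
  · intro y hy
    rw [← h3 y hy, ← hfr'.arr 8 (by decide)]
    rfl
  · rw [← h4, ← hfr'.nvar 8 (by decide)]
    simp [State.setN, NExpr.eval]
  · refine le_trans ?_ hb'
    rw [add_assoc, add_assoc]
    refine add_le_add le_rfl ?_
    rw [← Nat.cast_add, ← Nat.cast_add, Nat.cast_le]
    have : 1 ≤ stopCost cs' W (uncovList (Near Dst ρ) A' ns) := by
      unfold stopCost
      split_ifs <;> omega
    rw [show garbage N' (s₃.setN 8 _).narr = garbage N' s₃.narr from rfl]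
    simp only [NExpr.cost]
    clear * - g3 this
    omega

end Level

end DynKCenter

/-! ### Processing all levels -/

namespace DynKCenter

/-- Process the update in all levels from the level in variable `8` on. -/
def allLevels : Program :=
  .loop (.natLt (.var 8) (.var 4)) levelRoutine

variable {ans : ℕ → ℕ → ℝ → Prop}

theorem bestBound_add_le (R : State → ℝ≥0∞ → Prop) (Z : ℝ≥0∞) (s : State) :
    bestBound (fun s' b => ∃ b', R s' b' ∧ b = b' + Z) s ≤ bestBound R s + Z := by
  unfold bestBound
  rw [ENNReal.iInf_add]
  refine le_iInf fun b' => ?_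
  rw [ENNReal.iInf_add]
  exact le_iInf fun hb' => iInf₂_le (b' + Z) ⟨b', hb', rfl⟩

theorem expect_add_const (μ : PMF (State × ℕ)) (Q : State → ℝ≥0∞) (Z : ℝ≥0∞) :
    expect μ (fun s => Q s + Z) = expect μ Q + Z := by
  have h : Z = ∑' r, μ r * Z := by rw [ENNReal.tsum_mul_right, μ.tsum_coe, one_mul]
  unfold expect
  rw [h, ← ENNReal.tsum_add, ← h]
  refine tsum_congr fun r => ?_
  ring

/-- A frame rule for costs: while one level is processed, the bounds for the other levels are
carried along as a constant. -/
theorem Trip.add_const {p : Program} {s : State} {R : State → ℝ≥0∞ → Prop} {B : ℝ≥0∞}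
    (h : Trip ans p s R B) (Z : ℝ≥0∞) :
    Trip ans p s (fun s' b => ∃ b', R s' b' ∧ b = b' + Z) (B + Z) := by
  obtain ⟨μ, he, hs, hE⟩ := h
  refine ⟨μ, he, fun r hr => ?_, ?_⟩
  · obtain ⟨b, hb⟩ := hs r hr
    exact ⟨b + Z, b, hb, rfl⟩
  · refine (expect_mono_support (Q' := fun s => bestBound R s + Z)
      fun r _ => bestBound_add_le R Z r.1).trans ?_
    rw [expect_add_const]
    gcongr

theorem RoutineFrame.refl (H : Finset ℕ) (s : State) : RoutineFrame H s s :=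
  ⟨fun _ _ => rfl, fun _ _ _ => rfl, rfl, fun _ _ => rfl, fun _ _ _ => rfl⟩

theorem RoutineFrame.trans {H : Finset ℕ} {s₁ s₂ s₃ : State} (h : RoutineFrame H s₁ s₂)
    (h' : RoutineFrame H s₂ s₃) : RoutineFrame H s₁ s₃ where
  nvar x h1 := (h'.nvar x h1).trans (h.nvar x h1)
  rvar x h1 h2 := (h'.rvar x h1 h2).trans (h.rvar x h1 h2)
  rarr := h'.rarr.trans h.rarr
  arr a h1 := (h'.arr a h1).trans (h.arr a h1)
  out a i hi := (h'.out a i hi).trans (h.out a i hi)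

theorem RoutineFrame.mono {H H' : Finset ℕ} {s s' : State} (h : RoutineFrame H s s') (hH : H ⊆ H') :
    RoutineFrame H' s s' :=
  { h with out := fun a i hi => h.out a i fun hh => hi (hH hh) }

theorem garbage_congr {N : Finset ℕ} {m m' : ℕ → ℕ → ℕ} (h : ∀ i ∈ N, m' 6 i = m 6 i) :
    garbage N m' = garbage N m := by
  unfold garbage
  rw [Finset.filter_congr fun y hy => by rw [h y hy]]

section Level
open Classical

variable {Dst : ℕ → ℕ → ℝ} {ρ : ℝ} {N A : Finset ℕ} {h k : ℕ}

theorem LevelInv.count_zero (hD : LevelData Dst ρ N A h) {m : ℕ → ℕ → ℕ} {cs : List ℕ}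
    (hI : LevelInv Dst ρ N A h k m cs) : m 3 0 = 0 := by
  rw [hI.linked.count zero_mem_headers, Finset.card_eq_zero, Finset.filter_eq_empty_iff]
  intro y hy
  rw [hI.lead y hy]
  exact leader_ne_zero hD (fun c hc => hD.subset (hI.greedy.mem c hc)) y

/-- A level depends only on the cells of its header and its nodes, apart from the shared free list,
which is empty between the levels. -/
theorem LevelInv.congr (hD : LevelData Dst ρ N A h) {m m' : ℕ → ℕ → ℕ} {cs : List ℕ}
    (hI : LevelInv Dst ρ N A h k m cs) (he : ∀ a, 1 ≤ a ∧ a ≤ 8 → ∀ i ∈ insert h N, m' a i = m a i)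
    (h2 : m' 2 0 = 0) (h3 : m' 3 0 = 0) : LevelInv Dst ρ N A h k m' cs := by
  have hc0 := hI.count_zero hD
  have heN : ∀ a, 1 ≤ a ∧ a ≤ 8 → ∀ i ∈ N, m' a i = m a i := fun a ha i hi =>
    he a ha i (Finset.mem_insert_of_mem hi)
  have heA : ∀ a, 1 ≤ a ∧ a ≤ 8 → ∀ i ∈ A, m' a i = m a i := fun a ha i hi => heN a ha i (hD.subset hi)
  refine ⟨?_, h2, ?_, ?_, ?_, hI.greedy⟩
  · obtain ⟨Lst, hL⟩ := hI.linked
    refine ⟨Lst, ?_, hL.sub, hL.nodup, hL.disj, ?_, ?_, ?_, ?_, by simp, by simp, by simp, by simp,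
      by simp⟩
    · intro g hg
      have hch := (hL.chain g hg).congr (nx' := m' 1) fun y hy => heN 1 (by decide) y (hL.sub g hg y hy)
      by_cases hg0 : g = 0
      · subst hg0
        rw [hI.free] at hch
        rw [h2]
        exact hch
      · rw [he 2 (by decide) g]
        · exact hch
        · simpa [headers, hg0] using hg
    · intro g hg
      by_cases hg0 : g = 0
      · subst hg0
        rw [h3, ← hL.count 0 hg]
        exact hc0.symm
      · rw [he 3 (by decide) g]
        · exact hL.count g hg
        · simpa [headers, hg0] using hg
    · intro y hy
      rw [heA 5 (by decide) y hy]
      exact hL.lead y hy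
    · intro g hg y hy hyA
      rw [heA 5 (by decide) y hyA]
      exact hL.alive g hg y hy hyA
    · intro g hg y hy hyA
      rw [heN 5 (by decide) y (hL.sub g hg y hy), heN 6 (by decide) y (hL.sub g hg y hy)]
      exact hL.dead g hg y hy hyA
  · intro y hy
    rw [heA 5 (by decide) y hy]
    exact hI.lead y hy
  · rw [he 7 (by decide) h (by simp)]
    exact hI.chain.congr fun y hy => heA 7 (by decide) y (hI.greedy.mem y hy)
  · intro c hc
    rw [heA 4 (by decide) c (hI.greedy.mem c hc)]
    exact hI.size c hc

end Level

open Classical in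
/-- The work on the level `j` if the levels below `ℓ` are processed already: the bound for `F` and
the potential for the deleted nodes. -/
noncomputable def levelTerm (Dst : ℕ → ℕ → ℝ) (ρ : ℕ → ℝ) (N A N' A' : ℕ → Finset ℕ) (k : ℕ)
    (F : ℕ → List ℕ → ℝ≥0∞) (m : ℕ → ℕ → ℕ) (cen : ℕ → List ℕ) (ℓ j : ℕ) : ℝ≥0∞ :=
  if j < ℓ then F j (cen j) + (64 * garbage (N' j) m : ℕ)
  else adaptCost (Near Dst (ρ j)) 600 (cen j) k (A j) (A' j) (F j) +
    (64 * garbage (N j) m + 205 : ℕ)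

/-- The bounds of the levels are added, so linearity of expectation suffices and no independence of
the levels is claimed. Processing one level keeps the cells of the others, which preserves both
their invariants and their terms of the sum. -/
theorem allLevels_spec (hans : Functional ans) {Dst : ℕ → ℕ → ℝ} {ρ : ℕ → ℝ}
    {N A N' A' : ℕ → Finset ℕ} {k L : ℕ} {nm : ℕ → ℕ} {H : Finset ℕ} {s₀ : State}
    (hD : ∀ j < L, LevelData Dst (ρ j) (N j) (A j) (j + 1))
    (hD' : ∀ j < L, LevelData Dst (ρ j) (N' j) (A' j) (j + 1)) (hN : ∀ j < L, N j ⊆ N' j)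
    (hdisj : ∀ ℓ < L, ∀ j < L, j ≠ ℓ → ∀ i ∈ insert (j + 1) (N' j), i ∉ headers (N' ℓ) (ℓ + 1))
    (hH : ∀ j < L, headers (N' j) (j + 1) ⊆ H) (hL : s₀.nvar 4 = L)
    (hprep : ∀ ℓ < L, ∀ s cs, RoutineFrame H s₀ s → s.nvar 8 = ℓ →
      LevelInv Dst (ρ ℓ) (N ℓ) (A ℓ) (ℓ + 1) k s.narr cs → (∀ y ∈ N ℓ, s.narr 8 y = nm y) →
      (∀ y ∈ N' ℓ, y ∉ N ℓ → ∀ a, 1 ≤ a → a ≤ 8 → s.narr a y = 0) →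
      Det ans levelPrep s fun s' t =>
        Mid ans Dst (ρ ℓ) (N' ℓ) (A' ℓ) (ℓ + 1) k s' k [] cs (A ℓ) ∧
        RoutineFrame (headers (N' ℓ) (ℓ + 1)) s s' ∧ (∀ y ∈ N' ℓ, s'.narr 8 y = nm y) ∧
        s'.nvar 8 = s.nvar 8 ∧
        t + 64 * garbage (N' ℓ) s'.narr ≤ 64 * garbage (N ℓ) s.narr + 200)
    (F : ℕ → List ℕ → ℝ≥0∞) (n : ℕ) :
    ∀ (ℓ : ℕ) (s : State) (cen : ℕ → List ℕ), ℓ + n = L → s.nvar 8 = ℓ → RoutineFrame H s₀ s →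
      (∀ j < L, j < ℓ → LevelInv Dst (ρ j) (N' j) (A' j) (j + 1) k s.narr (cen j) ∧
        ∀ y ∈ N' j, s.narr 8 y = nm y) →
      (∀ j < L, ¬ j < ℓ → LevelInv Dst (ρ j) (N j) (A j) (j + 1) k s.narr (cen j) ∧
        (∀ y ∈ N j, s.narr 8 y = nm y) ∧ ∀ y ∈ N' j, y ∉ N j → ∀ a, 1 ≤ a → a ≤ 8 → s.narr a y = 0) →
      Trip ans allLevels s (fun s' b => ∃ cen : ℕ → List ℕ, RoutineFrame H s₀ s' ∧
          (∀ j < L, LevelInv Dst (ρ j) (N' j) (A' j) (j + 1) k s'.narr (cen j) ∧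
            ∀ y ∈ N' j, s'.narr 8 y = nm y) ∧
          ∑ j ∈ Finset.range L, (F j (cen j) + (64 * garbage (N' j) s'.narr : ℕ)) ≤ b)
        (∑ j ∈ Finset.range L, levelTerm Dst ρ N A N' A' k F s.narr cen ℓ j + 5) := by
  induction n with
  | zero =>
    intro ℓ s cen hn h8 hfr hnew hold
    obtain rfl : ℓ = L := by omega
    refine Trip.loop_exit ?_ ⟨cen, hfr, fun j hj => hnew j hj hj, le_rfl⟩ ?_
    · simp [Test.Holds, NExpr.eval, h8, hfr.nvar 4 (by decide), hL]
    · rw [add_comm]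
      gcongr with j hj
      · rw [levelTerm, if_pos (Finset.mem_range.1 hj)]
      · simp only [Test.cost, NExpr.cost]
        norm_num
  | succ n ih =>
    intro ℓ s cen hn h8 hfr hnew hold
    have hℓ : ℓ < L := by omega
    obtain ⟨hI, hnm, hfresh⟩ := hold ℓ hℓ (lt_irrefl ℓ)
    have hspec := levelRoutine_spec hans (A := A ℓ) (hD' ℓ hℓ) (cs := cen ℓ) nm (F ℓ)
      (hprep ℓ hℓ s (cen ℓ) hfr h8 hI hnm hfresh)
    set Z : ℝ≥0∞ := ∑ j ∈ (Finset.range L).erase ℓ,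
      levelTerm Dst ρ N A N' A' k F s.narr cen ℓ j with hZ
    have hZ' : levelTerm Dst ρ N A N' A' k F s.narr cen ℓ ℓ + Z =
        ∑ j ∈ Finset.range L, levelTerm Dst ρ N A N' A' k F s.narr cen ℓ j :=
      Finset.add_sum_erase _ _ (Finset.mem_range.2 hℓ)
    refine Trip.loop_step hans (R := fun s' b => Trip ans allLevels s' _ b) ?_ ?_
      ((hspec.add_const (Z + 5)).mono le_rfl ?_) fun s' b hb => hb
    · simp [Test.Holds, NExpr.eval, h8, hfr.nvar 4 (by decide), hL, hℓ]
    · rw [← hZ', levelTerm, if_neg (lt_irrefl ℓ)]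
      simp only [Test.cost, NExpr.cost]
      push_cast
      generalize adaptCost (Near Dst (ρ ℓ)) 600 (cen ℓ) k (A ℓ) (A' ℓ) (F ℓ) = x
      generalize (garbage (N ℓ) s.narr : ℝ≥0∞) = g
      calc (3 : ℝ≥0∞) + (x + (64 * g + 200) + (Z + 5)) = x + 64 * g + Z + 5 + 203 := by ring
        _ ≤ x + 64 * g + Z + 5 + 205 := by gcongr; norm_num
        _ = x + (64 * g + 205) + Z + 5 := by ring
    · rintro s' b ⟨b', ⟨cs', g1, g2, g3, g4, g5⟩, rfl⟩
      have hfr' := hfr.trans (g2.mono (hH ℓ hℓ))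
      have hkeep : ∀ j < L, j ≠ ℓ → ∀ a, ∀ i ∈ insert (j + 1) (N' j), s'.narr a i = s.narr a i :=
        fun j hj hjℓ a i hi => g2.out a i (hdisj ℓ hℓ j hj hjℓ i hi)
      have hkeep' : ∀ j < L, j ≠ ℓ → ∀ a, ∀ i ∈ N' j, s'.narr a i = s.narr a i :=
        fun j hj hjℓ a i hi => hkeep j hj hjℓ a i (Finset.mem_insert_of_mem hi)
      have g6 := g1.count_zero (hD' ℓ hℓ)
      refine ⟨_, ?_, ih (ℓ + 1) s' (Function.update cen ℓ cs') (by omega) (by rw [g4, h8]) hfr' ?_ ?_⟩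
      · rw [← add_assoc]
        gcongr
        rw [← Finset.add_sum_erase _ _ (Finset.mem_range.2 hℓ)]
        gcongr
        · rw [levelTerm, if_pos (Nat.lt_succ_self ℓ), Function.update_self]
          exact g5
        · rw [hZ]
          refine Finset.sum_le_sum fun j hj => ?_
          rw [Finset.mem_erase, Finset.mem_range] at hj
          have hiff : j < ℓ + 1 ↔ j < ℓ := by omega
          simp only [levelTerm, Function.update_of_ne hj.1, hiff]
          split_ifs
          · rw [garbage_congr (hkeep' j hj.2 hj.1 6)]
          · rw [garbage_congr fun i hi => hkeep' j hj.2 hj.1 6 i (hN j hj.2 hi)]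
      · intro j hj hjℓ
        by_cases hjℓ' : j = ℓ
        · subst hjℓ'
          rw [Function.update_self]
          exact ⟨g1, g3⟩
        · rw [Function.update_of_ne hjℓ']
          obtain ⟨q1, q2⟩ := hnew j hj (by omega)
          refine ⟨q1.congr (hD' j hj) (fun a _ => hkeep j hj hjℓ' a) g1.free g6, fun y hy => ?_⟩
          rw [hkeep' j hj hjℓ' 8 y hy]
          exact q2 y hy
      · intro j hj hjℓ
        have hjℓ' : j ≠ ℓ := by omega
        rw [Function.update_of_ne hjℓ']
        obtain ⟨q1, q2, q3⟩ := hold j hj (by omega)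
        refine ⟨q1.congr (hD j hj) (fun a _ i hi => hkeep j hj hjℓ' a i
          (Finset.insert_subset_insert _ (hN j hj) hi)) g1.free g6, fun y hy => ?_,
          fun y hy hyN a ha ha' => ?_⟩
        · rw [hkeep' j hj hjℓ' 8 y (hN j hj hy)]
          exact q2 y hy
        · rw [hkeep' j hj hjℓ' a y hy]
          exact q3 y hy hyN a ha ha'

end DynKCenter

/-! ### The numbering of the nodes, and an update of all levels -/

namespace DynKCenter

/-- Put the first node of the updated point into variable `7`. -/
def findPoint : Program :=
  .cond (.natEq (.var 1) (.lit 0))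
    (.storeN 9 (.var 2) (.var 6) ;; .setN 7 (.var 6) ;; .setN 6 (.add (.var 6) (.var 4)))
    (.setN 7 (.cell 9 (.var 2)))

/-- Count the active points. -/
def countPoint : Program :=
  .cond (.natEq (.var 1) (.lit 0)) (.setN 5 (.add (.var 5) (.lit 1)))
    (.setN 5 (.sub (.var 5) (.lit 1)))

/-- Process an update in all levels. -/
def updateLevels : Program :=
  findPoint ;; .setN 8 (.lit 0) ;; allLevels ;; countPoint

/-- The radius of a level. -/
noncomputable def radius (ℓ : ℕ) : ℝ :=
  if ℓ = 0 then 0 else 2 ^ (ℓ - 1)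

theorem radius_nonneg (ℓ : ℕ) : 0 ≤ radius ℓ := by
  unfold radius
  split_ifs <;> positivity

/-- The nodes at the level `ℓ` of the inserted points with the numbers in `I`. -/
def nodes (L : ℕ) (I : Finset ℕ) (ℓ : ℕ) : Finset ℕ :=
  I.image fun i => i * L + 1 + ℓ

/-- The number of the inserted point to which the node `y` belongs. -/
def pointOf (L y : ℕ) : ℕ :=
  (y - 1) / L

theorem pointOf_node {L i ℓ : ℕ} (hℓ : ℓ < L) : pointOf L (i * L + 1 + ℓ) = i := by
  unfold pointOf
  rw [show i * L + 1 + ℓ - 1 = ℓ + L * i by rw [mul_comm]; omega, Nat.add_mul_div_left _ _ (by omega),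
    Nat.div_eq_of_lt hℓ, zero_add]

theorem mem_nodes {L ℓ y : ℕ} {I : Finset ℕ} : y ∈ nodes L I ℓ ↔ ∃ i ∈ I, i * L + 1 + ℓ = y := by
  simp [nodes]

theorem node_injective {L ℓ : ℕ} (hℓ : ℓ < L) : Function.Injective fun i => i * L + 1 + ℓ := by
  intro i j hij
  have := congrArg (pointOf L) hij
  simpa only [pointOf_node hℓ] using this

theorem card_nodes {L ℓ : ℕ} (hℓ : ℓ < L) (I : Finset ℕ) : (nodes L I ℓ).card = I.card :=
  Finset.card_image_of_injective _ (node_injective hℓ)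

theorem nodes_mono {L ℓ : ℕ} {I J : Finset ℕ} (h : I ⊆ J) : nodes L I ℓ ⊆ nodes L J ℓ :=
  Finset.image_subset_image h

theorem nodes_insert {L ℓ i : ℕ} {I : Finset ℕ} :
    nodes L (insert i I) ℓ = insert (i * L + 1 + ℓ) (nodes L I ℓ) :=
  Finset.image_insert _ _ _

theorem nodes_erase {L ℓ i : ℕ} (hℓ : ℓ < L) {I : Finset ℕ} :
    nodes L (I.erase i) ℓ = (nodes L I ℓ).erase (i * L + 1 + ℓ) :=
  Finset.image_erase (node_injective hℓ) _ _

theorem le_of_mem_nodes {L ℓ q y : ℕ} (hy : y ∈ nodes L (Finset.Icc 1 q) ℓ) : L + 1 + ℓ ≤ y := by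
  rw [mem_nodes] at hy
  obtain ⟨i, hi, rfl⟩ := hy
  rw [Finset.mem_Icc] at hi
  have : 1 * L ≤ i * L := Nat.mul_le_mul_right L hi.1
  omega

theorem lt_of_mem_nodes {L ℓ q y : ℕ} (hℓ : ℓ < L) (hy : y ∈ nodes L (Finset.Icc 1 q) ℓ) :
    y < (q + 1) * L + 1 := by
  rw [mem_nodes] at hy
  obtain ⟨i, hi, rfl⟩ := hy
  rw [Finset.mem_Icc] at hi
  have : i * L ≤ q * L := Nat.mul_le_mul_right L hi.2
  rw [add_mul]
  omega

/-- Nodes of different levels differ modulo `L`. The headers occupy the numbers from `1` to `L`, the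
block that a point with number `0` would have, and the points are numbered from `1`. -/
theorem nodes_disjoint {L ℓ j q : ℕ} (hℓ : ℓ < L) (hj : j < L) (hjℓ : j ≠ ℓ) {i : ℕ}
    (hi : i ∈ insert (j + 1) (nodes L (Finset.Icc 1 q) j)) :
    i ∉ headers (nodes L (Finset.Icc 1 q) ℓ) (ℓ + 1) := by
  intro hh
  simp only [headers, Finset.mem_insert] at hh hi
  rcases hi with rfl | hi
  · rcases hh with hh | hh | hh
    · omega
    · omega
    · have := le_of_mem_nodes hh
      omega
  · have h1 := le_of_mem_nodes hi
    rcases hh with hh | hh | hh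
    · omega
    · omega
    · rw [mem_nodes] at hh hi
      obtain ⟨a, -, rfl⟩ := hi
      obtain ⟨b, -, hb⟩ := hh
      have e : (b * L + ℓ) % L = (a * L + j) % L := by
        congr 1
        omega
      rw [Nat.mul_add_mod', Nat.mul_add_mod', Nat.mod_eq_of_lt hℓ, Nat.mod_eq_of_lt hj] at e
      exact hjℓ e.symm

theorem headers_subset_range {L ℓ q : ℕ} (hℓ : ℓ < L) :
    headers (nodes L (Finset.Icc 1 q) ℓ) (ℓ + 1) ⊆ Finset.range ((q + 1) * L + 1) := by
  intro i hi
  rw [Finset.mem_range]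
  simp only [headers, Finset.mem_insert] at hi
  have : 1 * L ≤ (q + 1) * L := Nat.mul_le_mul_right L (by omega)
  rcases hi with rfl | rfl | hi
  · omega
  · omega
  · exact lt_of_mem_nodes hℓ hi

theorem levelData {d : ℕ → ℕ → ℝ} (hs : ∀ i j, d i j = d j i) (h0 : ∀ i, d i i = 0) {L ℓ q : ℕ}
    {I : Finset ℕ} (hI : I ⊆ Finset.Icc 1 q) (hℓ : ℓ < L) :
    LevelData (fun y z => d (pointOf L y) (pointOf L z)) (radius ℓ) (nodes L (Finset.Icc 1 q) ℓ)
      (nodes L I ℓ) (ℓ + 1) where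
  header_ne := by omega
  zero_notMem hh := by
    have := le_of_mem_nodes hh
    omega
  header_notMem hh := by
    have := le_of_mem_nodes hh
    omega
  subset := nodes_mono hI
  symm x y hxy := by
    unfold Near at *
    beta_reduce
    rwa [hs]
  refl x := by
    unfold Near
    beta_reduce
    rw [h0]
    exact radius_nonneg ℓ

/-- The memory between two updates: `q` points with the names `nm` and the distances `d` were
inserted, the points in `I` are active, and `cen` contains the centers of the levels. -/
structure Steady (d : ℕ → ℕ → ℝ) (nm : ℕ → ℕ) (k L q : ℕ) (I : Finset ℕ) (s : State)
    (cen : ℕ → List ℕ) : Prop where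
  centers : s.nvar 0 = k
  levels : s.nvar 4 = L
  count : s.nvar 5 = I.card
  top : s.nvar 6 = (q + 1) * L + 1
  radii : ∀ ℓ < L, s.rarr 0 ℓ = radius ℓ
  base : ∀ i ∈ I, s.narr 9 (nm i) = i * L + 1
  fresh : ∀ y, (q + 1) * L + 1 ≤ y → ∀ a, 1 ≤ a → a ≤ 8 → s.narr a y = 0
  inv : ∀ ℓ < L, LevelInv (fun y z => d (pointOf L y) (pointOf L z)) (radius ℓ)
    (nodes L (Finset.Icc 1 q) ℓ) (nodes L I ℓ) (ℓ + 1) k s.narr (cen ℓ)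
  names : ∀ ℓ < L, ∀ y ∈ nodes L (Finset.Icc 1 q) ℓ, s.narr 8 y = nm (pointOf L y)

open Classical in
/-- A bound for the expected cost of an update of the levels, and for `F` afterwards. -/
noncomputable def updateBound (d : ℕ → ℕ → ℝ) (k L q : ℕ) (I I' : Finset ℕ)
    (F : ℕ → List ℕ → ℝ≥0∞) (m : ℕ → ℕ → ℕ) (cen : ℕ → List ℕ) : ℝ≥0∞ :=
  ∑ ℓ ∈ Finset.range L,
    (adaptCost (Near (fun y z => d (pointOf L y) (pointOf L z)) (radius ℓ)) 600 (cen ℓ) k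
      (nodes L I ℓ) (nodes L I' ℓ) (F ℓ) + (64 * garbage (nodes L (Finset.Icc 1 q) ℓ) m + 205 : ℕ))

variable {ans : ℕ → ℕ → ℝ → Prop} {d : ℕ → ℕ → ℝ} {nm : ℕ → ℕ} {k L q : ℕ} {I : Finset ℕ}

/-- The common part of insertions and deletions; the effects of `findPoint`, `levelPrep` and
`countPoint`, in which they differ, are hypotheses. -/
theorem updateLevels_spec (hans : Functional ans) (hs : ∀ i j, d i j = d j i)
    (h0 : ∀ i, d i i = 0) {q' : ℕ} {I' : Finset ℕ} (hI : I ⊆ Finset.Icc 1 q)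
    (hI' : I' ⊆ Finset.Icc 1 q') (hq : q ≤ q') {s s₁ : State} {cen : ℕ → List ℕ}
    (hS : Steady d nm k L q I s cen)
    (hdet : Det ans findPoint s fun s' t => s'.setN 8 0 = s₁ ∧ t ≤ 20)
    (e : ∀ a, a ≠ 9 → s₁.narr a = s.narr a)
    (en : ∀ x, x ≠ 6 → x ≠ 7 → x ≠ 8 → s₁.nvar x = s.nvar x) (er : s₁.rarr = s.rarr)
    (h8 : s₁.nvar 8 = 0) (h6 : s₁.nvar 6 = (q' + 1) * L + 1)
    (hbase : ∀ i ∈ I', s₁.narr 9 (nm i) = i * L + 1)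
    (hcount : ∀ s₂ : State, s₂.nvar 1 = s.nvar 1 → s₂.nvar 5 = I.card →
      Det ans countPoint s₂ fun s' t => s' = s₂.setN 5 I'.card ∧ t ≤ 10)
    (hprep : ∀ ℓ < L, ∀ s' cs, s'.nvar 0 = k → s'.nvar 1 = s.nvar 1 → s'.nvar 2 = s.nvar 2 →
      s'.nvar 5 = (nodes L I ℓ).card → s'.nvar 7 = s₁.nvar 7 → s'.rarr 0 ℓ = radius ℓ →
      s'.nvar 8 = ℓ → LevelInv (fun y z => d (pointOf L y) (pointOf L z)) (radius ℓ)
        (nodes L (Finset.Icc 1 q) ℓ) (nodes L I ℓ) (ℓ + 1) k s'.narr cs →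
      (∀ y ∈ nodes L (Finset.Icc 1 q) ℓ, s'.narr 8 y = nm (pointOf L y)) →
      (∀ y ∈ nodes L (Finset.Icc 1 q') ℓ, y ∉ nodes L (Finset.Icc 1 q) ℓ →
        ∀ a, 1 ≤ a → a ≤ 8 → s'.narr a y = 0) →
      Det ans levelPrep s' fun s'' t =>
        Mid ans (fun y z => d (pointOf L y) (pointOf L z)) (radius ℓ) (nodes L (Finset.Icc 1 q') ℓ)
          (nodes L I' ℓ) (ℓ + 1) k s'' k [] cs (nodes L I ℓ) ∧
        RoutineFrame (headers (nodes L (Finset.Icc 1 q') ℓ) (ℓ + 1)) s' s'' ∧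
        (∀ y ∈ nodes L (Finset.Icc 1 q') ℓ, s''.narr 8 y = nm (pointOf L y)) ∧
        s''.nvar 8 = s'.nvar 8 ∧ t + 64 * garbage (nodes L (Finset.Icc 1 q') ℓ) s''.narr ≤
          64 * garbage (nodes L (Finset.Icc 1 q) ℓ) s'.narr + 200)
    (F : ℕ → List ℕ → ℝ≥0∞) :
    Trip ans updateLevels s (fun s' b => ∃ cen', Steady d nm k L q' I' s' cen' ∧
      ∑ ℓ ∈ Finset.range L,
        (F ℓ (cen' ℓ) + (64 * garbage (nodes L (Finset.Icc 1 q') ℓ) s'.narr : ℕ)) ≤ b)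
      (updateBound d k L q I I' F s.narr cen + 50) := by
  have hqq : Finset.Icc 1 q ⊆ Finset.Icc 1 q' := Finset.Icc_subset_Icc le_rfl hq
  have hle : (q + 1) * L ≤ (q' + 1) * L := Nat.mul_le_mul_right L (by omega)
  have hm : ∀ j, garbage (nodes L (Finset.Icc 1 q) j) s₁.narr =
      garbage (nodes L (Finset.Icc 1 q) j) s.narr := fun j =>
    garbage_congr fun i _ => by rw [e 6 (by decide)]
  have hmain := allLevels_spec hans (s₀ := s₁) (nm := fun y => nm (pointOf L y)) (k := k) (L := L)
    (H := Finset.range ((q' + 1) * L + 1)) (ρ := radius)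
    (Dst := fun y z => d (pointOf L y) (pointOf L z))
    (N := nodes L (Finset.Icc 1 q)) (A := nodes L I) (N' := nodes L (Finset.Icc 1 q'))
    (A' := nodes L I') (fun j hj => levelData hs h0 hI hj)
    (fun j hj => levelData hs h0 hI' hj) (fun j _ => nodes_mono hqq)
    (fun ℓ hℓ j hj hjℓ i hi => nodes_disjoint hℓ hj hjℓ hi)
    (fun j hj => headers_subset_range hj)
    (by rw [en 4 (by decide) (by decide) (by decide), hS.levels]) ?_ F L 0 s₁ cen (zero_add L)
    h8 (RoutineFrame.refl _ _) (fun j _ hj => absurd hj (by omega)) ?_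
  · unfold updateLevels
    refine Trip.seq hans (R := fun s' b => s'.setN 8 0 = s₁ ∧ updateBound d k L q I I'
      F s.narr cen + 30 ≤ b) (Trip.of_det (hdet.mono ?_)) ?_
    · rintro s' t ⟨h3, h4⟩
      refine ⟨_, ⟨h3, le_rfl⟩, ?_⟩
      rw [add_assoc]
      gcongr
      have : 30 + t ≤ 50 := by omega
      exact_mod_cast this
    rintro s' b ⟨h3, h4⟩
    refine Trip.seq hans (R := fun s' b => s' = s₁ ∧ updateBound d k L q I I'
      F s.narr cen + 20 ≤ b) (Trip.of_det (Det.setN ⟨_, ⟨h3, le_rfl⟩, ?_⟩)) ?_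
    · refine le_trans ?_ h4
      rw [add_assoc]
      gcongr
      simp only [NExpr.cost]
      norm_num
    rintro s' b' ⟨rfl, h5⟩
    refine Trip.seq hans ((hmain.add_const 10).mono ?_ fun s' b hb => ⟨b, le_rfl, hb⟩) ?_
    · refine le_trans ?_ h5
      rw [add_assoc]
      unfold updateBound
      gcongr with j _
      · simp [levelTerm, hm]
      · norm_num
    rintro s₂ b ⟨b₁, ⟨cen', hfr, hlev, hb₁⟩, rfl⟩
    refine Trip.of_det ((hcount s₂ ?_ ?_).mono ?_)
    · rw [hfr.nvar 1 (by decide), en 1 (by decide) (by decide) (by decide)]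
    · rw [hfr.nvar 5 (by decide), en 5 (by decide) (by decide) (by decide), hS.count]
    rintro s₃ t ⟨rfl, ht⟩
    refine ⟨_, ⟨cen', ?_, hb₁⟩, ?_⟩
    · have hnv : ∀ x v, x ≠ 5 → (s₂.setN 5 v).nvar x = s₂.nvar x := fun x v hx =>
        Function.update_of_ne hx _ _
      refine ⟨?_, ?_, ?_, ?_, ?_, ?_, ?_, fun ℓ hℓ => (hlev ℓ hℓ).1, fun ℓ hℓ => (hlev ℓ hℓ).2⟩
      · rw [hnv _ _ (by decide), hfr.nvar 0 (by decide), en 0 (by decide) (by decide) (by decide),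
          hS.centers]
      · rw [hnv _ _ (by decide), hfr.nvar 4 (by decide), en 4 (by decide) (by decide) (by decide),
          hS.levels]
      · simp [State.setN]
      · rw [hnv _ _ (by decide), hfr.nvar 6 (by decide), h6]
      · intro ℓ hℓ
        show s₂.rarr 0 ℓ = _
        rw [hfr.rarr, er]
        exact hS.radii ℓ hℓ
      · intro i hi
        show s₂.narr 9 _ = _
        rw [hfr.arr 9 (by decide)]
        exact hbase i hi
      · intro y hy a ha ha'
        show s₂.narr a y = 0
        rw [hfr.out a y (by rw [Finset.mem_range]; omega), e a (by omega)]
        exact hS.fresh y (by omega) a ha ha'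
    · gcongr
      exact_mod_cast ht
  · intro ℓ hℓ s' cs hfr h8 hinv hnames hfresh
    refine hprep ℓ hℓ s' cs ?_ ?_ ?_ ?_ ?_ ?_ h8 hinv hnames hfresh
    · rw [hfr.nvar 0 (by decide), en 0 (by decide) (by decide) (by decide), hS.centers]
    · rw [hfr.nvar 1 (by decide), en 1 (by decide) (by decide) (by decide)]
    · rw [hfr.nvar 2 (by decide), en 2 (by decide) (by decide) (by decide)]
    · rw [hfr.nvar 5 (by decide), en 5 (by decide) (by decide) (by decide), hS.count, card_nodes hℓ]
    · rw [hfr.nvar 7 (by decide)]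
    · rw [hfr.rarr, er]
      exact hS.radii ℓ hℓ
  · intro j hj _
    have hI := hS.inv j hj
    have hD := levelData hs h0 (L := L) ‹I ⊆ Finset.Icc 1 q› hj
    refine ⟨hI.congr hD (fun a ha i hi => ?_) ?_ ?_, fun y hy => ?_, fun y hy hyN a ha ha' => ?_⟩
    · rw [e a (by omega)]
    · rw [e 2 (by decide), hI.free]
    · rw [e 3 (by decide), hI.count_zero hD]
    · rw [e 8 (by decide), hS.names j hj y hy]
    · rw [e a (by omega)]
      refine hS.fresh y ?_ a ha ha'
      -- A node that is new in this update belongs to a point with a number greater than `q`, so it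
      -- lies beyond the cells used so far.
      by_contra hlt
      refine hyN ?_
      rw [mem_nodes] at hy ⊢
      obtain ⟨i, hi, rfl⟩ := hy
      refine ⟨i, ?_, rfl⟩
      rw [Finset.mem_Icc] at hi ⊢
      refine ⟨hi.1, ?_⟩
      by_contra hiq
      have : (q + 1) * L ≤ i * L := Nat.mul_le_mul_right L (by omega)
      omega

/-- A point that is inserted again gets a new number and fresh nodes, so nodes of its earlier life
that are still linked do no harm. Only the names of active points have to differ from the name of
the new one. -/
theorem insertLevels_spec (hans : Functional ans) (hs : ∀ i j, d i j = d j i)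
    (h0 : ∀ i, d i i = 0) (hI : I ⊆ Finset.Icc 1 q) {s : State} {cen : ℕ → List ℕ}
    (hS : Steady d nm k L q I s cen) (h1 : s.nvar 1 = 0) (h2 : s.nvar 2 = nm (q + 1))
    (hnm : ∀ i ∈ I, nm i ≠ nm (q + 1))
    (hor : ∀ i ∈ insert (q + 1) I, ∀ j ∈ insert (q + 1) I, ans (nm i) (nm j) (d i j))
    (F : ℕ → List ℕ → ℝ≥0∞) :
    Trip ans updateLevels s (fun s' b => ∃ cen', Steady d nm k L (q + 1) (insert (q + 1) I) s' cen' ∧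
      ∑ ℓ ∈ Finset.range L,
        (F ℓ (cen' ℓ) + (64 * garbage (nodes L (Finset.Icc 1 (q + 1)) ℓ) s'.narr : ℕ)) ≤ b)
      (updateBound d k L q I (insert (q + 1) I) F s.narr cen + 50) := by
  have hq : Finset.Icc 1 (q + 1) = insert (q + 1) (Finset.Icc 1 q) := by
    ext i
    simp only [Finset.mem_Icc, Finset.mem_insert]
    omega
  have hqI : q + 1 ∉ I := fun hh => by
    have := hI hh
    rw [Finset.mem_Icc] at this
    omega
  have hI' : insert (q + 1) I ⊆ Finset.Icc 1 (q + 1) := by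
    rw [hq]
    exact Finset.insert_subset_insert _ hI
  set s₁ : State := (((s.storeN 9 (nm (q + 1)) ((q + 1) * L + 1)).setN 7 ((q + 1) * L + 1)).setN 6
    ((q + 1 + 1) * L + 1)).setN 8 0 with hs₁
  refine updateLevels_spec hans hs h0 (s₁ := s₁) hI hI' (by omega) hS ?_ ?_ ?_ rfl ?_ ?_ ?_ ?_ ?_ F
  · unfold findPoint
    refine Det.cond (fun _ => Det.seq (Det.storeN (Det.seq (Det.setN (Det.setN ⟨?_, ?_⟩)))))
      fun hb => absurd ?_ hb
    · rw [hs₁]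
      have : (q + 1) * L + 1 + L = (q + 1 + 1) * L + 1 := by ring
      simp [NExpr.eval, State.setN, State.storeN, h2, hS.top, hS.levels, this]
    · simp [NExpr.cost, Test.cost]
    · simp [Test.Holds, NExpr.eval, h1]
  · intro a ha
    simp [hs₁, State.setN, State.storeN, ha]
  · intro x h6 h7 h8
    simp [hs₁, State.setN, State.storeN, h6, h7, h8]
  · simp [hs₁, State.setN]
  · simp [hs₁, State.setN]
  · intro i hi
    rw [Finset.mem_insert] at hi
    rcases hi with rfl | hi
    · simp [hs₁, State.setN, State.storeN]
    · rw [← hS.base i hi]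
      simp [hs₁, State.setN, State.storeN, hnm i hi]
  · intro s₂ h3 h4
    unfold countPoint
    refine Det.cond (fun _ => Det.setN ⟨?_, ?_⟩) fun hb => absurd ?_ hb
    · simp [NExpr.eval, h4, Finset.card_insert_of_notMem hqI]
    · simp [NExpr.cost, Test.cost]
    · simp [Test.Holds, NExpr.eval, h3, h1]
  · intro ℓ hℓ s' cs g0 g1 g2 g5 g7 gr g8 hinv hnames hfresh
    have hx : (q + 1) * L + 1 + ℓ ∉ nodes L (Finset.Icc 1 q) ℓ := fun hh => by
      have := lt_of_mem_nodes hℓ hh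
      omega
    have hx' : (q + 1) * L + 1 + ℓ ∈ nodes L (Finset.Icc 1 (q + 1)) ℓ :=
      mem_nodes.2 ⟨q + 1, by simp, rfl⟩
    have hle := le_of_mem_nodes hx'
    rw [hq, nodes_insert, nodes_insert]
    refine levelPrep_insert (levelData hs h0 hI hℓ) (by omega) (by omega) hx hinv _ hnames ?_
      (hfresh _ hx' hx 2 (by decide) (by decide)) (hfresh _ hx' hx 3 (by decide) (by decide))
      (hfresh _ hx' hx 6 (by decide) (by decide)) ?_ g0 ?_ g5 ?_ ?_ ?_
    · rw [g2, h2, pointOf_node hℓ]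
    · rw [← nodes_insert]
      intro y hy z hz
      rw [mem_nodes] at hy hz
      obtain ⟨i, hi, rfl⟩ := hy
      obtain ⟨j, hj, rfl⟩ := hz
      rw [pointOf_node hℓ, pointOf_node hℓ]
      exact hor i hi j hj
    · rw [g1, h1]
    · rw [g8]
    · rw [g8, g7]
      simp [hs₁, State.setN]
    · rw [g8]
      exact gr

theorem deleteLevels_spec (hans : Functional ans) (hs : ∀ i j, d i j = d j i)
    (h0 : ∀ i, d i i = 0) (hI : I ⊆ Finset.Icc 1 q) {i₀ : ℕ} (hi₀ : i₀ ∈ I) {s : State}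
    {cen : ℕ → List ℕ} (hS : Steady d nm k L q I s cen) (h1 : s.nvar 1 = 1)
    (h2 : s.nvar 2 = nm i₀) (hor : ∀ i ∈ I, ∀ j ∈ I, ans (nm i) (nm j) (d i j))
    (F : ℕ → List ℕ → ℝ≥0∞) :
    Trip ans updateLevels s (fun s' b => ∃ cen', Steady d nm k L q (I.erase i₀) s' cen' ∧
      ∑ ℓ ∈ Finset.range L,
        (F ℓ (cen' ℓ) + (64 * garbage (nodes L (Finset.Icc 1 q) ℓ) s'.narr : ℕ)) ≤ b)
      (updateBound d k L q I (I.erase i₀) F s.narr cen + 50) := by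
  set s₁ : State := (s.setN 7 (i₀ * L + 1)).setN 8 0 with hs₁
  refine updateLevels_spec hans hs h0 (s₁ := s₁) hI ((Finset.erase_subset _ _).trans hI) le_rfl hS
    ?_ (fun _ _ => rfl) ?_ rfl ?_ ?_ ?_ ?_ ?_ F
  · unfold findPoint
    refine Det.cond (fun hb => absurd hb ?_) fun _ => Det.setN ⟨?_, ?_⟩
    · simp [Test.Holds, NExpr.eval, h1]
    · rw [hs₁]
      simp [NExpr.eval, State.setN, h2, hS.base i₀ hi₀]
    · simp [NExpr.cost, Test.cost]
  · intro x h6 h7 h8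
    simp [hs₁, State.setN, h7, h8]
  · simp [hs₁, State.setN]
  · simp [hs₁, State.setN, hS.top]
  · intro i hi
    exact hS.base i (Finset.mem_of_mem_erase hi)
  · intro s₂ h3 h4
    unfold countPoint
    refine Det.cond (fun hb => absurd hb ?_) fun _ => Det.setN ⟨?_, ?_⟩
    · simp [Test.Holds, NExpr.eval, h3, h1]
    · simp [NExpr.eval, h4, Finset.card_erase_of_mem hi₀]
    · simp [NExpr.cost, Test.cost]
  · intro ℓ hℓ s' cs g0 g1 g2 g5 g7 gr g8 hinv hnames hfresh
    rw [nodes_erase hℓ]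
    refine levelPrep_delete (levelData hs h0 hI hℓ) (mem_nodes.2 ⟨i₀, hi₀, rfl⟩) hinv _ hnames ?_ g0
      ?_ g5 ?_ ?_ ?_
    · intro y hy z hz
      rw [mem_nodes] at hy hz
      obtain ⟨i, hi, rfl⟩ := hy
      obtain ⟨j, hj, rfl⟩ := hz
      rw [pointOf_node hℓ, pointOf_node hℓ]
      exact hor i hi j hj
    · rw [g1, h1]
    · rw [g8]
    · rw [g8, g7]
      simp [hs₁, State.setN]
    · rw [g8]
      exact gr

end DynKCenter

/-! ### Initialization and output -/

namespace DynKCenter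

/-- Compute the radii of the levels. -/
def initLevels : Program :=
  .setN 8 (.lit 1) ;;
  .setR 3 (.lit 1) ;;
  .storeR 0 (.lit 1) (.lit 1) ;;
  .loop (.realLt (.var 3) (.var 0))
    (.setR 3 (.add (.var 3) (.var 3)) ;;
     .setN 8 (.add (.var 8) (.lit 1)) ;;
     .storeR 0 (.var 8) (.var 3)) ;;
  .setN 4 (.add (.var 8) (.lit 1)) ;;
  .setN 6 (.add (.var 4) (.lit 1))

/-- Find the first level whose centers cover all active points, and output its centers and its
radius. -/
def answer : Program :=
  .setN 8 (.lit 0) ;;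
  .loop (.natLt (.lit 0) (.cell 3 (.add (.var 8) (.lit 1)))) (.setN 8 (.add (.var 8) (.lit 1))) ;;
  .setR 2 (.cell 0 (.var 8)) ;;
  .setN 3 (.lit 0) ;;
  .setN 16 (.cell 7 (.add (.var 8) (.lit 1))) ;;
  .loop (.not (.natEq (.var 16) (.lit 0)))
    (.storeN 0 (.var 3) (.cell 8 (.var 16)) ;;
     .setN 3 (.add (.var 3) (.lit 1)) ;;
     .setN 16 (.cell 7 (.var 16)))

/-- The algorithm. -/
def algorithm : Program :=
  .cond (.natEq (.var 4) (.lit 0)) initLevels .skip ;; updateLevels ;; answer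

variable {ans : ℕ → ℕ → ℝ → Prop}

theorem initLevels_loop {Δ : ℝ} {J : ℕ} (hJ : Δ ≤ 2 ^ J) (hJ' : ∀ i < J, (2 : ℝ) ^ i < Δ) (n : ℕ) :
    ∀ (i : ℕ) (s : State), i + n = J → s.nvar 8 = i + 1 → s.rvar 3 = 2 ^ i → s.rvar 0 = Δ →
      (∀ ℓ ≤ i + 1, s.rarr 0 ℓ = radius ℓ) →
      Det ans (.loop (.realLt (.var 3) (.var 0))
        (.setR 3 (.add (.var 3) (.var 3)) ;;
         .setN 8 (.add (.var 8) (.lit 1)) ;;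
         .storeR 0 (.var 8) (.var 3))) s fun s' t =>
        s'.nvar 8 = J + 1 ∧ (∀ x, x ≠ 8 → s'.nvar x = s.nvar x) ∧ s'.narr = s.narr ∧
        (∀ ℓ ≤ J + 1, s'.rarr 0 ℓ = radius ℓ) ∧ t ≤ 20 * n + 10 := by
  induction n with
  | zero =>
    intro i s hn h8 h3 h0 hr
    obtain rfl : i = J := by omega
    refine Det.loop_exit ?_ ⟨h8, fun _ _ => rfl, rfl, hr, ?_⟩
    · simpa [Test.Holds, RExpr.eval, h3, h0] using hJ
    · simp [Test.cost, RExpr.cost]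
  | succ n ih =>
    intro i s hn h8 h3 h0 hr
    refine Det.loop_step ?_ (Det.seq (Det.setR (Det.seq (Det.setN (Det.storeR ?_)))))
    · simpa [Test.Holds, RExpr.eval, h3, h0] using hJ' i (by omega)
    · refine (ih (i + 1) _ (by omega) ?_ ?_ ?_ ?_).mono ?_
      · simp [State.storeR, State.setN, State.setR, NExpr.eval, h8]
      · simp [State.storeR, State.setN, State.setR, RExpr.eval, h3, pow_succ, mul_two]
      · simp [State.storeR, State.setN, State.setR, h0]
      · intro ℓ hℓ
        by_cases hℓ' : ℓ = i + 2
        · subst hℓ'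
          simp [State.storeR, State.setN, State.setR, RExpr.eval, NExpr.eval, h8, h3, radius,
            pow_succ, mul_two]
        · rw [← hr ℓ (by omega)]
          simp [State.storeR, State.setN, State.setR, NExpr.eval, h8, hℓ']
      · rintro s' t ⟨g1, g2, g3, g4, g5⟩
        refine ⟨g1, fun x hx => ?_, g3, g4, ?_⟩
        · rw [g2 x hx]
          simp [State.storeR, State.setN, State.setR, hx]
        · simp only [Test.cost, RExpr.cost, NExpr.cost]
          omega

section Level
open Classical

theorem LevelInv.empty {Dst : ℕ → ℕ → ℝ} {ρ : ℝ} {h k : ℕ} {m : ℕ → ℕ → ℕ}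
    (hm : ∀ a i, m a i = 0) : LevelInv Dst ρ ∅ ∅ h k m [] := by
  refine ⟨⟨fun _ => [], ?_, by simp, by simp, by simp, ?_, by simp, by simp, by simp, by simp,
    by simp, by simp, by simp, by simp⟩, hm _ _, by simp, hm _ _, by simp, .inr rfl⟩
  · exact fun g _ => hm _ _
  · intro g _
    rw [hm]
    rfl

end Level

theorem initLevels_spec {Δ : ℝ} {J k : ℕ} (hJ : Δ ≤ 2 ^ J) (hJ' : ∀ i < J, (2 : ℝ) ^ i < Δ)
    (d : ℕ → ℕ → ℝ) (nm : ℕ → ℕ) {s : State} (h0 : s.nvar 0 = k) (h5 : s.nvar 5 = 0)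
    (hm : ∀ a i, s.narr a i = 0) (hr : s.rarr 0 0 = 0) (hΔ : s.rvar 0 = Δ) :
    Det ans initLevels s fun s' t => Steady d nm k (J + 2) 0 ∅ s' (fun _ => []) ∧
      (∀ a i, s'.narr a i = 0) ∧ s'.nvar 1 = s.nvar 1 ∧ s'.nvar 2 = s.nvar 2 ∧
      t ≤ 30 * (J + 2) := by
  unfold initLevels
  refine Det.seq (Det.setN (Det.seq (Det.setR (Det.seq (Det.storeR (Det.seq
    ((initLevels_loop hJ hJ' J 0 _ (zero_add J) ?_ ?_ ?_ ?_).mono ?_)))))))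
  · simp [State.storeR, State.setN, State.setR, NExpr.eval]
  · simp [State.storeR, State.setN, State.setR, RExpr.eval]
  · simp [State.storeR, State.setN, State.setR, hΔ]
  · intro ℓ hℓ
    obtain rfl | rfl : ℓ = 0 ∨ ℓ = 1 := by omega
    · simp [State.storeR, State.setN, State.setR, NExpr.eval, hr, radius]
    · simp [State.storeR, State.setN, State.setR, NExpr.eval, RExpr.eval, radius]
  rintro s₁ t ⟨g1, g2, g3, g4, g5⟩
  have gn : ∀ x, x ≠ 8 → s₁.nvar x = s.nvar x := by
    intro x hx
    rw [g2 x hx]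
    simp [State.storeR, State.setN, State.setR, hx]
  have gm : ∀ a i, s₁.narr a i = 0 := by
    intro a i
    rw [g3]
    exact hm a i
  refine Det.seq (Det.setN (Det.setN ⟨⟨?_, ?_, ?_, ?_, ?_, by simp, ?_, ?_, ?_⟩, gm, ?_, ?_, ?_⟩))
  · simp [State.setN, gn 0 (by decide), h0]
  · simp [State.setN, NExpr.eval, g1]
  · simp [State.setN, gn 5 (by decide), h5]
  · simp [State.setN, NExpr.eval, g1]
  · exact fun ℓ hℓ => g4 ℓ (by omega)
  · exact fun y _ a _ _ => gm a y
  · intro ℓ hℓ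
    have := LevelInv.empty (Dst := fun y z => d (pointOf (J + 2) y) (pointOf (J + 2) z))
      (ρ := radius ℓ) (h := ℓ + 1) (k := k) gm
    show LevelInv _ _ _ _ _ _ s₁.narr []
    simpa [nodes] using this
  · simp [nodes]
  · simp [State.setN, gn 1 (by decide)]
  · simp [State.setN, gn 2 (by decide)]
  · simp only [NExpr.cost, RExpr.cost]
    omega

/-- What `answer` leaves unchanged. -/
structure AnswerFrame (s s' : State) : Prop where
  nvar : ∀ x, x ≤ 7 → x ≠ 3 → s'.nvar x = s.nvar x
  narr : ∀ a, a ≠ 0 → s'.narr a = s.narr a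
  rarr : s'.rarr = s.rarr

theorem answer_find {ℓ₀ : ℕ} (n : ℕ) : ∀ (ℓ : ℕ) (s : State), ℓ + n = ℓ₀ → s.nvar 8 = ℓ →
    s.narr 3 (ℓ₀ + 1) = 0 → (∀ j < ℓ₀, s.narr 3 (j + 1) ≠ 0) →
    Det ans (.loop (.natLt (.lit 0) (.cell 3 (.add (.var 8) (.lit 1))))
      (.setN 8 (.add (.var 8) (.lit 1)))) s fun s' t => s' = s.setN 8 ℓ₀ ∧ t ≤ 20 * n + 10 := by
  induction n with
  | zero =>
    intro ℓ s hn h8 h1 _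
    obtain rfl : ℓ = ℓ₀ := by omega
    refine Det.loop_exit ?_ ⟨?_, ?_⟩
    · simp [Test.Holds, NExpr.eval, h8, h1]
    · rw [State.setN, ← h8, Function.update_eq_self]
    · simp [Test.cost, NExpr.cost]
  | succ n ih =>
    intro ℓ s hn h8 h1 h2
    refine Det.loop_step ?_ (Det.setN ((ih (ℓ + 1)
      (s.setN 8 (NExpr.eval s (.add (.var 8) (.lit 1)))) (by omega) ?_ h1 h2).mono ?_))
    · simpa [Test.Holds, NExpr.eval, h8] using Nat.pos_of_ne_zero (h2 ℓ (by omega))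
    · simp [State.setN, NExpr.eval, h8]
    · rintro s' t ⟨rfl, ht⟩
      refine ⟨by simp [State.setN], ?_⟩
      simp only [Test.cost, NExpr.cost]
      omega

theorem answer_copy (cs : List ℕ) : ∀ (s : State), Chain (s.narr 7) (s.nvar 16) cs →
    Det ans (.loop (.not (.natEq (.var 16) (.lit 0)))
      (.storeN 0 (.var 3) (.cell 8 (.var 16)) ;;
       .setN 3 (.add (.var 3) (.lit 1)) ;;
       .setN 16 (.cell 7 (.var 16)))) s fun s' t =>
      AnswerFrame s s' ∧ s'.rvar = s.rvar ∧ s'.nvar 3 = s.nvar 3 + cs.length ∧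
      (∀ i < s.nvar 3, s'.narr 0 i = s.narr 0 i) ∧
      (∀ i (hi : i < cs.length), s'.narr 0 (s.nvar 3 + i) = s.narr 8 cs[i]) ∧
      t ≤ 20 * cs.length + 10 := by
  induction cs with
  | nil =>
    intro s hc
    have hc : s.nvar 16 = 0 := hc
    refine Det.loop_exit ?_ ⟨⟨fun _ _ _ => rfl, fun _ _ => rfl, rfl⟩, rfl, rfl, fun _ _ => rfl,
      by simp, ?_⟩
    · simp [Test.Holds, NExpr.eval, hc]
    · simp [Test.cost, NExpr.cost]
  | cons c cs ih =>
    intro s hc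
    obtain ⟨h1, h2, h3⟩ := hc
    refine Det.loop_step ?_ (Det.seq (Det.storeN (Det.seq (Det.setN (Det.setN ((ih _ ?_).mono ?_))))))
    · simpa [Test.Holds, NExpr.eval, h1] using h2
    · simpa [State.setN, State.storeN, NExpr.eval, h1] using h3
    · rintro s' t ⟨g1, g2, g3, g4, g5, g6⟩
      have e3 : (((s.storeN 0 (s.nvar 3) (s.narr 8 c)).setN 3 (s.nvar 3 + 1)).setN 16
          (s.narr 7 c)).nvar 3 = s.nvar 3 + 1 := by
        simp [State.setN]
      simp only [NExpr.eval, h1] at g1 g2 g3 g4 g5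
      refine ⟨⟨?_, ?_, g1.rarr⟩, g2, ?_, ?_, ?_, ?_⟩
      · intro x hx hx'
        rw [g1.nvar x hx hx']
        simp [State.setN, State.storeN, hx', show x ≠ 16 by omega]
      · intro a ha
        rw [g1.narr a ha]
        simp [State.setN, State.storeN, ha]
      · rw [g3]
        simp [State.setN, State.storeN]
        omega
      · intro i hi
        rw [g4 i (by simp [State.setN, State.storeN]; omega)]
        simp [State.setN, State.storeN, show i ≠ s.nvar 3 by omega]
      · intro i hi
        cases i with
        | zero =>
          rw [g4 _ (by simp [State.setN, State.storeN])]
          simp [State.setN, State.storeN]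
        | succ i =>
          have := g5 i (by simpa using hi)
          simp only [List.getElem_cons_succ]
          rw [show s.nvar 3 + (i + 1) = s.nvar 3 + 1 + i by ring]
          simpa [State.setN, State.storeN] using this
      · simp only [Test.cost, NExpr.cost, List.length_cons]
        omega

theorem answer_spec {s : State} {ℓ₀ : ℕ} {cs : List ℕ} (h1 : s.narr 3 (ℓ₀ + 1) = 0)
    (h2 : ∀ j < ℓ₀, s.narr 3 (j + 1) ≠ 0) (hc : Chain (s.narr 7) (s.narr 7 (ℓ₀ + 1)) cs) :
    Det ans answer s fun s' t => AnswerFrame s s' ∧ s'.rvar 2 = s.rarr 0 ℓ₀ ∧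
      s'.nvar 3 = cs.length ∧ (∀ i (hi : i < cs.length), s'.narr 0 i = s.narr 8 cs[i]) ∧
      t ≤ 20 * (ℓ₀ + cs.length) + 50 := by
  unfold answer
  refine Det.seq (Det.setN (Det.seq ((answer_find ℓ₀ 0
    (s.setN 8 (NExpr.eval s (.lit 0))) (zero_add _) ?_ h1 h2).mono ?_)))
  · simp [State.setN, NExpr.eval]
  rintro s₁ t₁ ⟨rfl, ht₁⟩
  refine Det.seq (Det.setR (Det.seq (Det.setN (Det.seq (Det.setN ((answer_copy cs _ ?_).mono ?_))))))
  · simpa [State.setN, State.setR, NExpr.eval] using hc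
  rintro s' t ⟨g1, g2, g3, g4, g5, g6⟩
  refine ⟨⟨?_, ?_, g1.rarr⟩, ?_, ?_, ?_, ?_⟩
  · intro x hx hx'
    rw [g1.nvar x hx hx']
    simp [State.setN, State.setR, hx', show x ≠ 16 by omega, show x ≠ 8 by omega]
  · exact g1.narr
  · rw [g2]
    simp [State.setN, State.setR, RExpr.eval, NExpr.eval]
  · rw [g3]
    simp [State.setN, State.setR, NExpr.eval]
  · intro i hi
    have := g5 i hi
    simpa [State.setN, State.setR, NExpr.eval] using this
  · simp only [NExpr.cost, RExpr.cost]
    omega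

end DynKCenter

namespace DynKCenter

/-! ### Approximation -/

theorem kCenterCost_le {X : Type*} [MetricSpace X] {P S : Set X} {ρ : ℝ}
    (h : ∀ p ∈ P, ∃ c ∈ S, dist c p ≤ ρ) : kCenterCost P S ≤ ENNReal.ofReal ρ := by
  refine iSup₂_le fun p hp => ?_
  obtain ⟨c, hc, hcp⟩ := h p hp
  refine (Metric.infEDist_le_edist_of_mem hc).trans ?_
  rw [edist_dist, dist_comm]
  exact ENNReal.ofReal_le_ofReal hcp

/-- More than `k` points of pairwise distance at least `2 * r` force a cost of at least `r`. -/
theorem le_kCenterOpt {X : Type*} [MetricSpace X] {k : ℕ} {P V : Set X} {T : Finset X} {r : ℝ}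
    (hT : (T : Set X) ⊆ P) (hk : k < T.card) (hr : ∀ x ∈ T, ∀ y ∈ T, x ≠ y → 2 * r ≤ dist x y) :
    ENNReal.ofReal r ≤ kCenterOpt k P V := by
  refine le_iInf fun S => le_iInf₂ fun _ hS => ?_
  by_contra hlt
  rw [not_le] at hlt
  have key : ∀ x ∈ T, ∃ c ∈ S, edist x c < ENNReal.ofReal r := by
    intro x hx
    have h1 : Metric.infEDist x S < ENNReal.ofReal r :=
      lt_of_le_of_lt (le_iSup₂ (f := fun p (_ : p ∈ P) => Metric.infEDist p (S : Set X)) x (hT hx))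
        hlt
    exact Metric.infEDist_lt_iff.1 h1
  choose! f hf hfd using key
  obtain ⟨x, hx, y, hy, hxy, hfxy⟩ :=
    Finset.exists_ne_map_eq_of_card_lt_of_maps_to (hS.trans_lt hk) hf
  have h1 : ∀ z ∈ T, dist z (f z) < r := by
    intro z hz
    have := hfd z hz
    rw [edist_dist] at this
    exact (ENNReal.ofReal_lt_ofReal_iff_of_nonneg dist_nonneg).1 this
  have h2 := dist_triangle_right x y (f x)
  have h3 := h1 x hx
  have h4 := h1 y hy
  rw [← hfxy] at h4
  linarith [hr x hx y hy hxy]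

section Level
open Classical

variable {Dst : ℕ → ℕ → ℝ} {ρ : ℝ} {N A : Finset ℕ} {h k : ℕ} {m : ℕ → ℕ → ℕ} {cs : List ℕ}

/-- The active nodes in the list of the header are exactly the uncovered ones, since covered nodes
are led by a center and no center is the header. So `answer` recognises a covering level by a single
cell. -/
theorem LevelInv.count_header (hD : LevelData Dst ρ N A h) (hI : LevelInv Dst ρ N A h k m cs) :
    m 3 h = 0 ↔ uncovList (Near Dst ρ) A cs = ∅ := by
  rw [hI.linked.count header_mem_headers, Finset.card_eq_zero, Finset.filter_eq_empty_iff,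
    uncovList, Finset.filter_eq_empty_iff]
  refine forall₂_congr fun y hy => not_congr ?_
  rw [hI.lead y hy]
  refine ⟨fun hh n hn hny => ?_, leader_eq_of_not⟩
  have := (leader_mem (h := h) (adj := Near Dst ρ) ⟨n, hn, hny⟩).1
  rw [hh] at this
  exact hD.header_notMem (hD.subset (hI.greedy.mem h this))

end Level

section Answer
open Classical

variable {ans : ℕ → ℕ → ℝ → Prop} {d : ℕ → ℕ → ℝ} {nm : ℕ → ℕ} {k L q : ℕ} {I : Finset ℕ}

/-- Some level covers all active points. -/
theorem Steady.exists_level (hs : ∀ i j, d i j = d j i) (h0 : ∀ i, d i i = 0)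
    (hI : I ⊆ Finset.Icc 1 q) {s : State} {cen : ℕ → List ℕ} (hS : Steady d nm k L q I s cen)
    (hL : 0 < L) (hk : 1 ≤ k) (hd : ∀ i ∈ I, ∀ j ∈ I, d i j ≤ radius (L - 1)) :
    ∃ ℓ < L, s.narr 3 (ℓ + 1) = 0 ∧ ∀ j < ℓ, s.narr 3 (j + 1) ≠ 0 := by
  have hlast : s.narr 3 (L - 1 + 1) = 0 := by
    have hD := levelData hs h0 hI (show L - 1 < L by omega)
    have hinv := hS.inv (L - 1) (by omega)
    rw [hinv.count_header hD]
    by_contra hne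
    have hne := Finset.nonempty_iff_ne_empty.2 hne
    have hlen := hinv.greedy.length_eq hne
    obtain ⟨y, hy⟩ := hne
    rw [mem_uncovList] at hy
    -- If a point were uncovered at the top level, there would be `k ≥ 1` centers, but the first of
    -- them already covers everything within the top radius.
    have hpos : 0 < (cen (L - 1)).length := by omega
    have hc := List.getElem_mem hpos
    refine hy.2 _ hc ?_
    have hcA := hinv.greedy.mem _ hc
    obtain ⟨i, hi, hic⟩ := mem_nodes.1 hcA
    obtain ⟨j, hj, hjy⟩ := mem_nodes.1 hy.1
    unfold Near
    beta_reduce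
    rw [← hic, ← hjy, pointOf_node (by omega), pointOf_node (by omega)]
    exact hd i hi j hj
  have hex : ∃ ℓ, s.narr 3 (ℓ + 1) = 0 := ⟨_, hlast⟩
  refine ⟨Nat.find hex, ?_, Nat.find_spec hex, fun j hj => Nat.find_min hex hj⟩
  have := Nat.find_min' hex hlast
  omega

theorem Steady.congr (hs : ∀ i j, d i j = d j i) (h0 : ∀ i, d i i = 0)
    (hI : I ⊆ Finset.Icc 1 q) {s s' : State} {cen : ℕ → List ℕ} (hS : Steady d nm k L q I s cen)
    (hn : ∀ x, x = 0 ∨ x = 4 ∨ x = 5 ∨ x = 6 → s'.nvar x = s.nvar x)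
    (ha : ∀ a, a ≠ 0 → s'.narr a = s.narr a) (hr : s'.rarr = s.rarr) :
    Steady d nm k L q I s' cen := by
  refine ⟨?_, ?_, ?_, ?_, ?_, ?_, ?_, ?_, ?_⟩
  · rw [hn 0 (by decide), hS.centers]
  · rw [hn 4 (by decide), hS.levels]
  · rw [hn 5 (by decide), hS.count]
  · rw [hn 6 (by decide), hS.top]
  · rw [hr]
    exact hS.radii
  · rw [ha 9 (by decide)]
    exact hS.base
  · intro y hy a h1 h8
    rw [ha a (by omega)]
    exact hS.fresh y hy a h1 h8
  · intro ℓ hℓ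
    have hD := levelData hs h0 hI hℓ
    have hinv := hS.inv ℓ hℓ
    refine hinv.congr hD (fun a ha' i _ => by rw [ha a (by omega)]) ?_ ?_
    · rw [ha 2 (by decide), hinv.free]
    · rw [ha 3 (by decide), hinv.count_zero hD]
  · intro ℓ hℓ y hy
    rw [ha 8 (by decide)]
    exact hS.names ℓ hℓ y hy

/-- Consecutive positive radii differ by the factor two. At level `0`, whose radius vanishes, the
minimum distance `1` takes the role of the radius. -/
theorem radius_le_of_separated {ℓ : ℕ} {x : ℝ} (h1 : 1 ≤ x) (h2 : radius ℓ < x) :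
    radius (ℓ + 1) ≤ 2 * x := by
  unfold radius at *
  rw [if_neg (by omega), Nat.add_sub_cancel]
  split_ifs at h2 with h
  · subst h
    rw [pow_zero]
    linarith
  · rw [show ℓ = ℓ - 1 + 1 by omega, pow_succ]
    linarith

theorem answersWithin_of_level {X : Type*} [MetricSpace X] {name : X → ℕ} {pts : ℕ → X} {ε : ℝ}
    (hε : 0 < ε) (hI : I ⊆ Finset.Icc 1 q) {s s' : State} {cen : ℕ → List ℕ}
    (hS : Steady (fun i j => dist (pts i) (pts j)) (fun i => name (pts i)) k L q I s cen)
    (hsep : ∀ i ∈ I, ∀ j ∈ I, pts i ≠ pts j → 1 ≤ dist (pts i) (pts j))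
    {ℓ₀ : ℕ} (hℓ₀ : ℓ₀ < L) (h1 : s.narr 3 (ℓ₀ + 1) = 0) (h2 : ∀ j < ℓ₀, s.narr 3 (j + 1) ≠ 0)
    (h3 : s'.rvar 2 = s.rarr 0 ℓ₀) (h4 : s'.nvar 3 = (cen ℓ₀).length)
    (h5 : ∀ i (hi : i < (cen ℓ₀).length), s'.narr 0 i = s.narr 8 (cen ℓ₀)[i]) (V : Set X) :
    AnswersWithin name (6 + ε) k (pts '' I) V s' := by
  have hdat : ∀ ℓ < L, LevelData (fun y z => dist (pts (pointOf L y)) (pts (pointOf L z)))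
      (radius ℓ) (nodes L (Finset.Icc 1 q) ℓ) (nodes L I ℓ) (ℓ + 1) := fun ℓ hℓ =>
    levelData (d := fun i j => dist (pts i) (pts j)) (fun i j => dist_comm _ _)
      (fun i => dist_self _) hI hℓ
  have hinv := hS.inv ℓ₀ hℓ₀
  have hcov := (hinv.count_header (hdat ℓ₀ hℓ₀)).1 h1
  have hpt : ∀ ℓ < L, ∀ y ∈ nodes L I ℓ, pointOf L y ∈ I := by
    intro ℓ hℓ y hy
    obtain ⟨i, hi, rfl⟩ := mem_nodes.1 hy
    rwa [pointOf_node hℓ]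
  have hρ : s'.rvar 2 = radius ℓ₀ := by rw [h3, hS.radii ℓ₀ hℓ₀]
  set S : Finset X := ((cen ℓ₀).map fun y => pts (pointOf L y)).toFinset with hSdef
  have hSP : (S : Set X) ⊆ pts '' I := by
    intro x hx
    simp only [hSdef, List.coe_toFinset, List.mem_map, Set.mem_ofPred_eq] at hx
    obtain ⟨y, hy, rfl⟩ := hx
    exact ⟨_, hpt ℓ₀ hℓ₀ y (hinv.greedy.mem y hy), rfl⟩
  have hlen := hinv.greedy.length_le
  have hScard : S.card ≤ k := by
    refine (List.toFinset_card_le _).trans ?_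
    rwa [List.length_map]
  have hcost : kCenterCost (pts '' I) (S : Set X) ≤ ENNReal.ofReal (radius ℓ₀) := by
    refine kCenterCost_le ?_
    rintro _ ⟨i, hi, rfl⟩
    have hi' : i * L + 1 + ℓ₀ ∈ nodes L I ℓ₀ := mem_nodes.2 ⟨i, hi, rfl⟩
    have : i * L + 1 + ℓ₀ ∉ uncovList (Near (fun y z =>
        dist (pts (pointOf L y)) (pts (pointOf L z))) (radius ℓ₀)) (nodes L I ℓ₀) (cen ℓ₀) := by
      rw [hcov]
      simp
    rw [mem_uncovList] at this
    push Not at this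
    obtain ⟨c, hc, hci⟩ := this hi'
    refine ⟨pts (pointOf L c), ?_, ?_⟩
    · simp only [hSdef, List.coe_toFinset, List.mem_map, Set.mem_ofPred_eq]
      exact ⟨c, hc, rfl⟩
    · unfold Near at hci
      beta_reduce at hci
      rwa [pointOf_node hℓ₀] at hci
  have happrox : ENNReal.ofReal (radius ℓ₀) ≤
      ENNReal.ofReal (6 + ε) * kCenterOpt k (pts '' I) V := by
    rcases Nat.eq_zero_or_pos ℓ₀ with rfl | hpos
    · simp [radius]
    obtain ⟨ℓ, rfl⟩ : ∃ ℓ, ℓ₀ = ℓ + 1 := ⟨ℓ₀ - 1, by omega⟩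
    have hℓ : ℓ < L := by omega
    have hinv' := hS.inv ℓ hℓ
    have hne := h2 ℓ (by omega)
    rw [Ne, hinv'.count_header (hdat ℓ hℓ), ← Ne, ← Finset.nonempty_iff_ne_empty] at hne
    have hlen' := hinv'.greedy.length_eq hne
    obtain ⟨y, hy⟩ := hne
    rw [mem_uncovList] at hy
    -- The `k` centers of the level below together with a node that they do not cover.
    set Y : List ℕ := cen ℓ ++ [y] with hY
    have hYA : ∀ z ∈ Y, pointOf L z ∈ I := by
      intro z hz
      refine hpt ℓ hℓ z ?_
      rw [hY, List.mem_append, List.mem_singleton] at hz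
      rcases hz with hz | rfl
      · exact hinv'.greedy.mem z hz
      · exact hy.1
    have hpw : (Y.map fun z => pts (pointOf L z)).Pairwise fun a b => radius ℓ < dist a b := by
      rw [List.pairwise_map, hY, List.pairwise_append]
      refine ⟨hinv'.greedy.pairwise.imp fun hh => not_le.1 hh, by simp, fun a ha b hb => ?_⟩
      rw [List.mem_singleton] at hb
      subst hb
      exact not_le.1 (hy.2 a ha)
    have hnd : (Y.map fun z => pts (pointOf L z)).Nodup := hpw.imp fun {a b} hh hab => by
      subst hab
      rw [dist_self] at hh
      exact absurd hh (not_lt.2 (radius_nonneg ℓ))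
    have hsymm : Std.Symm fun a b : X => radius ℓ < dist a b :=
      ⟨fun a b hab => by rwa [dist_comm]⟩
    have hall := hpw.forall
    have hmem : ∀ x ∈ Y.map (fun z => pts (pointOf L z)), ∃ i ∈ I, pts i = x := by
      intro x hx
      rw [List.mem_map] at hx
      obtain ⟨z, hz, rfl⟩ := hx
      exact ⟨_, hYA z hz, rfl⟩
    -- The points of `Y` have distances at least half of the next radius, and two that share a
    -- center lose another factor two. The positions of the centers play no role, so deleted points
    -- are allowed.
    have hopt : ENNReal.ofReal (radius (ℓ + 1) / 4) ≤ kCenterOpt k (pts '' I) V := by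
      refine le_kCenterOpt (T := (Y.map fun z => pts (pointOf L z)).toFinset) ?_ ?_ ?_
      · intro x hx
        rw [List.coe_toFinset] at hx
        exact hmem x hx
      · rw [List.toFinset_card_of_nodup hnd, List.length_map, hY, List.length_append, hlen',
          List.length_singleton]
        omega
      · intro x hx x' hx' hne
        rw [List.mem_toFinset] at hx hx'
        have hlt := hall hx hx' hne
        obtain ⟨i, hi, rfl⟩ := hmem x hx
        obtain ⟨j, hj, rfl⟩ := hmem x' hx'
        have := radius_le_of_separated (hsep i hi j hj hne) hlt
        linarith
    calc ENNReal.ofReal (radius (ℓ + 1)) = ENNReal.ofReal 4 * ENNReal.ofReal (radius (ℓ + 1) / 4) := by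
          rw [← ENNReal.ofReal_mul (by norm_num)]
          congr 1
          ring
      _ ≤ _ := by
          gcongr
          linarith
  refine ⟨⟨S, hSP, hScard, by omega, ?_, hcost.trans happrox⟩, ?_, ?_, ?_⟩
  · ext c
    simp only [Set.mem_image, hSdef, List.coe_toFinset, List.mem_map, Set.mem_ofPred_eq]
    have hnames : ∀ y ∈ cen ℓ₀, s.narr 8 y = name (pts (pointOf L y)) := fun y hy =>
      hS.names ℓ₀ hℓ₀ y ((hdat ℓ₀ hℓ₀).subset (hinv.greedy.mem y hy))
    constructor
    · rintro ⟨_, ⟨y, hy, rfl⟩, rfl⟩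
      obtain ⟨i, hi, rfl⟩ := List.getElem_of_mem hy
      exact ⟨i, by omega, by rw [h5 i hi, hnames _ hy]⟩
    · rintro ⟨i, hi, rfl⟩
      have hi' : i < (cen ℓ₀).length := by omega
      have hmem := List.getElem_mem hi'
      exact ⟨_, ⟨_, hmem, rfl⟩, by rw [h5 i hi', hnames _ hmem]⟩
  · rw [hρ]
    exact radius_nonneg ℓ₀
  -- The centers in `S` are active, so the solution itself witnesses the upper bound on the optimum
  -- over active centers.
  · rw [hρ]
    exact (iInf_le_of_le S (iInf₂_le_of_le hSP hScard hcost))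
  · rw [hρ]
    exact happrox

/-- The memory after an update contains a good solution. -/
theorem answer_within {X : Type*} [MetricSpace X] {name : X → ℕ} {pts : ℕ → X} {ε : ℝ}
    (hε : 0 < ε) (hI : I ⊆ Finset.Icc 1 q) {s : State} {cen : ℕ → List ℕ}
    (hS : Steady (fun i j => dist (pts i) (pts j)) (fun i => name (pts i)) k L q I s cen)
    (hL : 0 < L) (hk : 1 ≤ k) (hd : ∀ i ∈ I, ∀ j ∈ I, dist (pts i) (pts j) ≤ radius (L - 1))
    (hsep : ∀ i ∈ I, ∀ j ∈ I, pts i ≠ pts j → 1 ≤ dist (pts i) (pts j))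
    (V : Set X) :
    Det ans answer s fun s' t =>
      Steady (fun i j => dist (pts i) (pts j)) (fun i => name (pts i)) k L q I s' cen ∧
      AnswersWithin name (6 + ε) k (pts '' I) V s' ∧ s'.narr 6 = s.narr 6 ∧
      t ≤ 20 * (L + k) + 50 := by
  obtain ⟨ℓ₀, hℓ₀, h1, h2⟩ := hS.exists_level (fun i j => dist_comm _ _) (fun i => dist_self _) hI
    hL hk hd
  have hinv := hS.inv ℓ₀ hℓ₀
  refine (answer_spec h1 h2 hinv.chain).mono ?_
  rintro s' t ⟨g1, g2, g3, g4, g5⟩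
  refine ⟨hS.congr (fun i j => dist_comm _ _) (fun i => dist_self _) hI ?_ g1.narr g1.rarr,
    answersWithin_of_level hε hI hS hsep hℓ₀ h1 h2 g2 g3 g4 V, g1.narr 6 (by decide), ?_⟩
  · rintro x (rfl | rfl | rfl | rfl) <;> exact g1.nvar _ (by decide) (by decide)
  · have := hinv.greedy.length_le
    omega

end Answer

end DynKCenter

namespace DynKCenter

/-! ### One update -/

section Update
open Classical

variable {X : Type*} [MetricSpace X]

/-- The memory is ready for the next update: it is the memory between two updates, or the initial
memory. -/
def Ready (name : X → ℕ) (pts : ℕ → X) (Δ ε : ℝ) (k L q : ℕ) (I : Finset ℕ) (s : State)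
    (cen : ℕ → List ℕ) : Prop :=
  Steady (fun i j => dist (pts i) (pts j)) (fun i => name (pts i)) k L q I s cen ∨
    q = 0 ∧ I = ∅ ∧ (cen = fun _ => []) ∧ s = initial k Δ ε

/-- The memory is ready for the next update and contains a good solution, and `b` is a bound for
`F` and the potential for the deleted nodes. -/
def Good (name : X → ℕ) (pts : ℕ → X) (Δ ε : ℝ) (k L q : ℕ) (I : Finset ℕ) (V : Set X)
    (F : ℕ → List ℕ → ℝ≥0∞) (s : State) (b : ℝ≥0∞) : Prop :=
  ∃ cen, Ready name pts Δ ε k L q I s cen ∧ AnswersWithin name (6 + ε) k (pts '' I) V s ∧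
    ∑ ℓ ∈ Finset.range L,
      (F ℓ (cen ℓ) + (64 * garbage (nodes L (Finset.Icc 1 q) ℓ) s.narr : ℕ)) ≤ b

variable {ans : ℕ → ℕ → ℝ → Prop} {name : X → ℕ} {pts : ℕ → X} {Δ ε : ℝ} {k J q q' : ℕ}
  {I I' : Finset ℕ}

theorem prelude_spec (hJ : Δ ≤ 2 ^ J) (hJ' : ∀ i < J, (2 : ℝ) ^ i < Δ)
    (hI : I ⊆ Finset.Icc 1 q) {s : State} {cen : ℕ → List ℕ}
    (hR : Ready name pts Δ ε k (J + 2) q I s cen) (u : Update X) :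
    Det ans (.cond (.natEq (.var 4) (.lit 0)) initLevels .skip) (announce name u s) fun s' t =>
      Steady (fun i j => dist (pts i) (pts j)) (fun i => name (pts i)) k (J + 2) q I s' cen ∧
      s'.nvar 1 = u.code ∧ s'.nvar 2 = name u.point ∧ s'.narr 6 = s.narr 6 ∧
      t ≤ 30 * (J + 2) + 10 := by
  have e1 : (announce name u s).nvar 1 = u.code := by simp [announce, State.setN]
  have e2 : (announce name u s).nvar 2 = name u.point := by simp [announce, State.setN]
  have en : ∀ x, x ≠ 1 → x ≠ 2 → (announce name u s).nvar x = s.nvar x := by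
    intro x h1 h2
    simp [announce, State.setN, h1, h2]
  rcases hR with hS | ⟨rfl, rfl, rfl, rfl⟩
  · have hen : ∀ x, x = 0 ∨ x = 4 ∨ x = 5 ∨ x = 6 →
        (announce name u s).nvar x = s.nvar x := by
      rintro x (rfl | rfl | rfl | rfl) <;> exact en _ (by decide) (by decide)
    have hS' := hS.congr (s' := announce name u s) (fun i j => dist_comm _ _)
      (fun i => dist_self _) hI hen (fun _ _ => rfl) rfl
    refine Det.cond (fun hb => absurd hb ?_) fun _ => Det.skip ⟨hS', e1, e2, rfl, ?_⟩
    · simp [Test.Holds, NExpr.eval, hS'.levels]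
    · simp [Test.cost, NExpr.cost]
  · refine Det.cond (fun _ => (initLevels_spec hJ hJ'
      (fun i j => dist (pts i) (pts j)) (fun i => name (pts i)) (k := k) ?_ ?_ ?_ ?_ ?_).mono ?_)
      fun hb => absurd ?_ hb
    · rw [en 0 (by decide) (by decide)]
      rfl
    · rw [en 5 (by decide) (by decide)]
      rfl
    · exact fun _ _ => rfl
    · rfl
    · rfl
    · rintro s' t ⟨g1, g2, g3, g4, g5⟩
      refine ⟨g1, g3.trans e1, g4.trans e2, funext fun i => g2 6 i, ?_⟩
      simp only [Test.cost, NExpr.cost]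
      omega
    · show (announce name u _).nvar 4 = 0
      rw [en 4 (by decide) (by decide)]
      rfl

/-- Beyond `adaptCost` and the garbage there are only the initialization, a constant per level, and
the output of at most `k` names after a search through the levels. As `k ≥ 1`, all this is at most a
multiple of `k * (J + 2)`. -/
theorem algorithm_spec (hans : Functional ans) (hε : 0 < ε) (hk : 1 ≤ k) (hJ : Δ ≤ 2 ^ J)
    (hJ' : ∀ i < J, (2 : ℝ) ^ i < Δ) (hI : I ⊆ Finset.Icc 1 q) (hI' : I' ⊆ Finset.Icc 1 q')
    (hd : ∀ i ∈ I', ∀ j ∈ I', pts i ≠ pts j → 1 ≤ dist (pts i) (pts j) ∧ dist (pts i) (pts j) ≤ Δ)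
    (u : Update X) (V : Set X) (F : ℕ → List ℕ → ℝ≥0∞)
    (hupd : ∀ (s : State) (cen : ℕ → List ℕ),
      Steady (fun i j => dist (pts i) (pts j)) (fun i => name (pts i)) k (J + 2) q I s cen →
      s.nvar 1 = u.code → s.nvar 2 = name u.point →
      Trip ans updateLevels s (fun s' b => ∃ cen',
        Steady (fun i j => dist (pts i) (pts j)) (fun i => name (pts i)) k (J + 2) q' I' s' cen' ∧
        ∑ ℓ ∈ Finset.range (J + 2),
          (F ℓ (cen' ℓ) + (64 * garbage (nodes (J + 2) (Finset.Icc 1 q') ℓ) s'.narr : ℕ)) ≤ b)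
        (updateBound (fun i j => dist (pts i) (pts j)) k (J + 2) q I I' F s.narr cen + 50))
    {s : State} {cen : ℕ → List ℕ} (hR : Ready name pts Δ ε k (J + 2) q I s cen) :
    Trip ans algorithm (announce name u s) (Good name pts Δ ε k (J + 2) q' I' V F)
      (∑ ℓ ∈ Finset.range (J + 2),
        (adaptCost (Near (fun y z => dist (pts (pointOf (J + 2) y)) (pts (pointOf (J + 2) z)))
          (radius ℓ)) 600 (cen ℓ) k (nodes (J + 2) I ℓ) (nodes (J + 2) I' ℓ) (F ℓ) +
          (64 * garbage (nodes (J + 2) (Finset.Icc 1 q) ℓ) s.narr : ℕ)) +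
        (1000 * k * (J + 2) : ℕ)) := by
  set B : ℝ≥0∞ := ∑ ℓ ∈ Finset.range (J + 2),
        (adaptCost (Near (fun y z => dist (pts (pointOf (J + 2) y)) (pts (pointOf (J + 2) z)))
          (radius ℓ)) 600 (cen ℓ) k (nodes (J + 2) I ℓ) (nodes (J + 2) I' ℓ) (F ℓ) +
          (64 * garbage (nodes (J + 2) (Finset.Icc 1 q) ℓ) s.narr : ℕ)) with hB
  have hkJ : (J + 2) + k ≤ 2 * (k * (J + 2)) := by nlinarith
  unfold algorithm
  refine Trip.seq hans (R := fun s' b =>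
    Steady (fun i j => dist (pts i) (pts j)) (fun i => name (pts i)) k (J + 2) q I s' cen ∧
    s'.nvar 1 = u.code ∧ s'.nvar 2 = name u.point ∧ s'.narr 6 = s.narr 6 ∧
      b = B + (205 * (J + 2) + 20 * (J + 2 + k) + 100 : ℕ))
    (Trip.of_det ((prelude_spec hJ hJ' hI hR u).mono ?_)) ?_
  · rintro s' t ⟨g1, g2, g3, g4, g5⟩
    refine ⟨_, ⟨g1, g2, g3, g4, rfl⟩, ?_⟩
    rw [add_assoc]
    gcongr
    norm_cast
    nlinarith
  rintro s₁ b ⟨g1, g2, g3, g4, rfl⟩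
  have hgarb : updateBound (fun i j => dist (pts i) (pts j)) k (J + 2) q I I' F s₁.narr cen =
      B + (205 * (J + 2) : ℕ) := by
    have hsum : ((205 * (J + 2) : ℕ) : ℝ≥0∞) = ∑ ℓ ∈ Finset.range (J + 2), ((205 : ℕ) : ℝ≥0∞) := by
      rw [Finset.sum_const, Finset.card_range, nsmul_eq_mul, mul_comm]
      push_cast
      ring
    rw [hB, hsum, ← Finset.sum_add_distrib]
    unfold updateBound
    refine Finset.sum_congr rfl fun ℓ _ => ?_
    rw [garbage_congr (m := s.narr) (m' := s₁.narr) fun i _ => by rw [g4], add_assoc,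
      ← Nat.cast_add]
  refine Trip.seq hans (((hupd s₁ cen g1 g2 g3).add_const (20 * (J + 2 + k) + 50 : ℕ)).mono ?_
    fun s' b hb => ⟨b, le_rfl, hb⟩) ?_
  · rw [hgarb, add_assoc, add_assoc]
    gcongr
    norm_cast
    omega
  rintro s₂ b ⟨b₁, ⟨cen', g5, g6⟩, rfl⟩
  refine Trip.of_det ((answer_within hε hI' g5 (by omega) hk ?_ ?_ V).mono ?_)
  · intro i hi j hj
    by_cases hij : pts i = pts j
    · rw [hij, dist_self]
      exact radius_nonneg _
    · refine ((hd i hi j hj hij).2.trans hJ).trans ?_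
      simp [radius]
  · exact fun i hi j hj hij => (hd i hi j hj hij).1
  · rintro s₃ t ⟨g7, g8, g9, g10⟩
    refine ⟨b₁, ⟨cen', .inl g7, g8, ?_⟩, ?_⟩
    · refine le_trans (le_of_eq (Finset.sum_congr rfl fun ℓ _ => ?_)) g6
      rw [garbage_congr (m := s₂.narr) (m' := s₃.narr) fun i _ => by rw [g9]]
    · gcongr

/-! ### Update sequences -/

/-- The points inserted, in the order of their insertions. -/
def inserted {X : Type*} : List (Update X) → List X
  | [] => []
  | .insert x :: l => x :: inserted l
  | .delete _ :: l => inserted l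

theorem inserted_append {X : Type*} (l m : List (Update X)) :
    inserted (l ++ m) = inserted l ++ inserted m := by
  induction l with
  | nil => rfl
  | cons u l ih => cases u <;> simp [inserted, ih]

theorem ValidFrom.of_append {X : Type*} {l m : List (Update X)} {P : Finset X}
    (h : ValidFrom P (l ++ m)) : ValidFrom (l.foldl Update.apply P) m := by
  induction l generalizing P with
  | nil => exact h
  | cons u l ih =>
    cases u <;> exact ih h.2

theorem active_append_singleton {X : Type*} (l : List (Update X)) (u : Update X) :
    active (l ++ [u]) = Update.apply (active l) u := by
  simp [active]

theorem seen_mono {X : Type*} {l l' : List (Update X)} (h : l <+: l') : seen l ⊆ seen l' :=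
  fun _ hx => h.subset hx

/-- The numbering `pts` of the inserted points fits the updates `l`: `q` points were inserted, and
those with the numbers in `I` are active. -/
structure Slots (pts : ℕ → X) (l : List (Update X)) (q : ℕ) (I : Finset ℕ) : Prop where
  length : (inserted l).length = q
  subset : I ⊆ Finset.Icc 1 q
  inj : Set.InjOn pts I
  image : pts '' I = active l
  mem_seen : ∀ i ∈ I, pts i ∈ seen l

/-- The bound for the expected costs after an update. -/
noncomputable def levelsLaw (pts : ℕ → X) (k L : ℕ) (I : Finset ℕ) (F : ℕ → List ℕ → ℝ≥0∞) :
    ℝ≥0∞ :=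
  ∑ ℓ ∈ Finset.range L, lawE (Near (fun y z => dist (pts (pointOf L y)) (pts (pointOf L z)))
    (radius ℓ)) k (nodes L I ℓ) (F ℓ)

/-- The active sets differ in at most one node per level, and both budgets are `k`. So the potential
is at most 7 · 600 · (2k + 1) + 600 · (2k + 1), which is at most 14400k. -/
theorem levelsLaw_adaptCost_le {L : ℕ} {i₀ : ℕ} (hk : 1 ≤ k) (hII : ∀ j, j ≠ i₀ → (j ∈ I ↔ j ∈ I'))
    (F : ℕ → List ℕ → ℝ≥0∞) :
    levelsLaw pts k L I (fun ℓ cs => adaptCost (Near (fun y z => dist (pts (pointOf L y))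
      (pts (pointOf L z))) (radius ℓ)) 600 cs k (nodes L I ℓ) (nodes L I' ℓ) (F ℓ)) ≤
      levelsLaw pts k L I' F + (14400 * k * L : ℕ) := by
  have hsum : ((14400 * k * L : ℕ) : ℝ≥0∞) =
      ∑ ℓ ∈ Finset.range L, ((14400 * k : ℕ) : ℝ≥0∞) := by
    rw [Finset.sum_const, Finset.card_range, nsmul_eq_mul, mul_comm]
    push_cast
    ring
  unfold levelsLaw
  rw [hsum, ← Finset.sum_add_distrib]
  refine Finset.sum_le_sum fun ℓ hℓ => ?_
  refine (lawE_adaptCost_le (fun p q hpq => ?_) 600 k k _ _ _).trans ?_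
  · unfold Near at *
    beta_reduce
    rwa [dist_comm]
  gcongr
  have hcard : (symmDiff (nodes L I ℓ) (nodes L I' ℓ)).card ≤ 1 := by
    rw [← Finset.card_singleton (i₀ * L + 1 + ℓ)]
    refine Finset.card_le_card fun y hy => ?_
    rw [Finset.mem_singleton]
    by_contra hne
    have : y ∈ nodes L I ℓ ↔ y ∈ nodes L I' ℓ := by
      rw [mem_nodes, mem_nodes]
      constructor <;> rintro ⟨i, hi, rfl⟩
      · exact ⟨i, (hII i fun h => hne (by rw [h])).1 hi, rfl⟩
      · exact ⟨i, (hII i fun h => hne (by rw [h])).2 hi, rfl⟩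
    rw [Finset.mem_symmDiff] at hy
    tauto
  unfold potential
  have h1 : (k + k + 1) * (symmDiff (nodes L I ℓ) (nodes L I' ℓ)).card ≤ (k + k + 1) * 1 :=
    Nat.mul_le_mul_left _ hcard
  simp only [Nat.sub_self, zero_mul, mul_zero, add_zero]
  omega

theorem oracle_functional {V : Set X} (hinj : Set.InjOn name V) : Functional (oracle name V) := by
  rintro i j d d' ⟨x, hx, y, hy, rfl, rfl, rfl⟩ ⟨x', hx', y', hy', h1, h2, rfl⟩
  rw [hinj hx' hx h1, hinj hy' hy h2]

/-- The effect of one update. -/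
theorem Slots.step (hε : 0 < ε) (hk : 1 ≤ k) (hJ : Δ ≤ 2 ^ J) (hJ' : ∀ i < J, (2 : ℝ) ^ i < Δ)
    {l : List (Update X)} {u : Update X} (hsl : Slots pts l q I)
    (hval : ValidFrom (active l) [u]) (hinj : Set.InjOn name (seen (l ++ [u])))
    (hd : ∀ x ∈ seen (l ++ [u]), ∀ y ∈ seen (l ++ [u]), x ≠ y → 1 ≤ dist x y ∧ dist x y ≤ Δ)
    (hpts : ∀ x, u = .insert x → pts (q + 1) = x) :
    ∃ q' I', Slots pts (l ++ [u]) q' I' ∧ ∃ i₀, (∀ j, j ≠ i₀ → (j ∈ I ↔ j ∈ I')) ∧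
      ∀ (F : ℕ → List ℕ → ℝ≥0∞) (V : Set X) (s : State) (cen : ℕ → List ℕ),
        Ready name pts Δ ε k (J + 2) q I s cen →
        Trip (oracle name (seen (l ++ [u]))) algorithm (announce name u s)
          (Good name pts Δ ε k (J + 2) q' I' V F)
          (∑ ℓ ∈ Finset.range (J + 2),
            (adaptCost (Near (fun y z => dist (pts (pointOf (J + 2) y)) (pts (pointOf (J + 2) z)))
              (radius ℓ)) 600 (cen ℓ) k (nodes (J + 2) I ℓ) (nodes (J + 2) I' ℓ) (F ℓ) +
              (64 * garbage (nodes (J + 2) (Finset.Icc 1 q) ℓ) s.narr : ℕ)) +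
            (1000 * k * (J + 2) : ℕ)) := by
  have hans := oracle_functional hinj
  have hseen : ∀ i ∈ I, pts i ∈ seen (l ++ [u]) := fun i hi =>
    seen_mono (List.prefix_append l [u]) (hsl.mem_seen i hi)
  cases u with
  | insert x =>
    have hx := hpts x rfl
    have hxP : x ∉ active l := hval.1
    have hxI : ∀ i ∈ I, pts i ≠ pts (q + 1) := by
      intro i hi hh
      rw [hx] at hh
      refine hxP ?_
      have : pts i ∈ (active l : Set X) := by
        rw [← hsl.image]
        exact ⟨i, hi, rfl⟩
      rwa [hh] at this
    have hxs : pts (q + 1) ∈ seen (l ++ [Update.insert x]) := by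
      rw [hx]
      simp [seen]
    have hseen' : ∀ i ∈ insert (q + 1) I, pts i ∈ seen (l ++ [Update.insert x]) := by
      intro i hi
      rw [Finset.mem_insert] at hi
      rcases hi with rfl | hi
      · exact hxs
      · exact hseen i hi
    have hsl' : Slots pts (l ++ [Update.insert x]) (q + 1) (insert (q + 1) I) := by
      refine ⟨?_, ?_, ?_, ?_, hseen'⟩
      · rw [inserted_append, List.length_append, hsl.length]
        rfl
      · refine Finset.insert_subset (by simp) (hsl.subset.trans ?_)
        exact Finset.Icc_subset_Icc le_rfl (by omega)
      · rw [Finset.coe_insert, Set.injOn_insert]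
        · refine ⟨hsl.inj, ?_⟩
          rintro ⟨i, hi, hh⟩
          exact hxI i hi hh
        · intro hh
          exact hxI _ hh rfl
      · rw [active_append_singleton, Finset.coe_insert, Set.image_insert_eq, hsl.image, hx]
        simp [Update.apply]
    refine ⟨q + 1, insert (q + 1) I, hsl', q + 1, ?_, ?_⟩
    · intro j hj
      simp [hj]
    intro F V s cen hR
    refine algorithm_spec hans hε hk hJ hJ' hsl.subset hsl'.subset
      (fun i hi j hj => hd _ (hseen' i hi) _ (hseen' j hj)) (.insert x) V F ?_ hR
    intro s₁ cen₁ hS h1 h2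
    refine insertLevels_spec hans (fun i j => dist_comm _ _) (fun i => dist_self _) hsl.subset hS h1
      (by rw [h2, hx]; rfl) (fun i hi hh => hxI i hi (hinj (hseen i hi) hxs hh)) ?_ F
    exact fun i hi j hj => ⟨_, hseen' i hi, _, hseen' j hj, rfl, rfl, rfl⟩
  | delete x =>
    have hxP : x ∈ active l := hval.1
    have hxP : x ∈ (active l : Set X) := hxP
    rw [← hsl.image] at hxP
    obtain ⟨i₀, hi₀, rfl⟩ := hxP
    have hsl' : Slots pts (l ++ [Update.delete (pts i₀)]) q (I.erase i₀) := by
      refine ⟨?_, (Finset.erase_subset _ _).trans hsl.subset, hsl.inj.mono ?_, ?_, ?_⟩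
      · rw [inserted_append, List.length_append, hsl.length]
        rfl
      · exact Finset.coe_subset.2 (Finset.erase_subset _ _)
      · rw [active_append_singleton]
        simp only [Update.apply, Finset.coe_erase]
        rw [hsl.inj.image_sdiff, ← hsl.image, Set.inter_eq_right.2 (by simpa using hi₀),
          Set.image_singleton]
      · exact fun i hi => hseen i (Finset.mem_of_mem_erase hi)
    refine ⟨q, I.erase i₀, hsl', i₀, ?_, ?_⟩
    · intro j hj
      simp [hj]
    intro F V s cen hR
    refine algorithm_spec hans hε hk hJ hJ' hsl.subset hsl'.subset
      (fun i hi j hj => hd _ (hsl'.mem_seen i hi) _ (hsl'.mem_seen j hj)) (.delete (pts i₀)) V F ?_ hR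
    intro s₁ cen₁ hS h1 h2
    exact deleteLevels_spec hans (fun i j => dist_comm _ _) (fun i => dist_self _) hsl.subset hi₀ hS
      h1 h2 (fun i hi j hj => ⟨_, hseen i hi, _, hseen j hj, rfl, rfl, rfl⟩) F

theorem answersWithin_initial (name : X → ℕ) (α Δ ε : ℝ) (k : ℕ) (V : Set X) :
    AnswersWithin name α k ∅ V (initial k Δ ε) := by
  refine ⟨⟨∅, by simp, by simp, by simp [initial], by simp [initial], by simp [kCenterCost]⟩,
    by simp [initial], ?_, by simp [initial]⟩
  refine iInf_le_of_le ∅ (iInf₂_le_of_le (by simp) (by simp) ?_)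
  simp [kCenterCost]

/-- The state of the algorithm after each prefix of the updates. -/
theorem exists_run (hε : 0 < ε) (hk : 1 ≤ k) (hJ : Δ ≤ 2 ^ J) (hJ' : ∀ i < J, (2 : ℝ) ^ i < Δ)
    {l₀ : List (Update X)} (hval : ValidFrom ∅ l₀) (hinj : Set.InjOn name (seen l₀))
    (hd : ∀ x ∈ seen l₀, ∀ y ∈ seen l₀, x ≠ y → 1 ≤ dist x y ∧ dist x y ≤ Δ)
    (hpts : ∀ i (hi : i < (inserted l₀).length), pts (i + 1) = (inserted l₀)[i])
    (l : List (Update X)) (hl : l <+: l₀) :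
    ∃ q I, Slots pts l q I ∧ ∀ F : ℕ → List ℕ → ℝ≥0∞, ∃ μ,
      Run algorithm name (initial k Δ ε) l μ ∧
      (∀ r ∈ μ.support, ∃ b, Good name pts Δ ε k (J + 2) q I (seen l) F r.1 b) ∧
      expect μ (bestBound (Good name pts Δ ε k (J + 2) q I (seen l) F)) ≤
        levelsLaw pts k (J + 2) I F + (15400 * k * (J + 2) * l.length : ℕ) := by
  induction l using List.reverseRecOn with
  | nil =>
    refine ⟨0, ∅, ⟨rfl, by simp, by simp, by simp [active], by simp⟩, fun F => ?_⟩
    have hgood : Good name pts Δ ε k (J + 2) 0 ∅ (seen []) F (initial k Δ ε)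
        (levelsLaw pts k (J + 2) ∅ F) := by
      refine ⟨fun _ => [], .inr ⟨rfl, rfl, rfl, rfl⟩, ?_, ?_⟩
      · simpa using answersWithin_initial name (6 + ε) Δ ε k _
      · unfold levelsLaw
        refine Finset.sum_le_sum fun ℓ _ => ?_
        simp [nodes, garbage, lawE_empty]
    refine ⟨_, .nil, ?_, ?_⟩
    · intro r hr
      rw [PMF.support_pure, Set.mem_singleton_iff] at hr
      subst hr
      exact ⟨_, hgood⟩
    · rw [expect_pure]
      simpa using bestBound_le hgood
  | append_singleton l u ih =>
    obtain ⟨q, I, hsl, hrun⟩ := ih ((List.prefix_append l [u]).trans hl)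
    have hval' : ValidFrom (active l) [u] := by
      obtain ⟨m, rfl⟩ := hl
      rw [List.append_assoc] at hval
      have := hval.of_append
      cases u <;> exact ⟨this.1, trivial⟩
    have hx : ∀ x, u = .insert x → pts (q + 1) = x := by
      rintro x rfl
      obtain ⟨m, rfl⟩ := hl
      have hq : q < (inserted ((l ++ [Update.insert x]) ++ m)).length := by
        simp only [inserted_append, List.length_append, hsl.length, inserted, List.length_singleton]
        omega
      rw [hpts q hq]
      simp [inserted_append, inserted, ← hsl.length]
    have hinj' := hinj.mono (seen_mono hl)
    obtain ⟨q', I', hsl', i₀, hII, hstep⟩ := hsl.step hε hk hJ hJ' hval' hinj'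
      (fun x hx y hy => hd x (seen_mono hl hx) y (seen_mono hl hy)) hx
    refine ⟨q', I', hsl', fun F => ?_⟩
    -- The induction hypothesis is applied to the expected cost of the next update followed by `F`.
    -- Averaged over the law of the old centers, this becomes `F` under the law of the new centers
    -- plus a multiple of the number of levels times `k`.
    obtain ⟨μ, h1, h2, h3⟩ := hrun fun ℓ cs => adaptCost (Near (fun y z =>
      dist (pts (pointOf (J + 2) y)) (pts (pointOf (J + 2) z))) (radius ℓ)) 600 cs k
      (nodes (J + 2) I ℓ) (nodes (J + 2) I' ℓ) (F ℓ)
    set G : State → ℝ≥0∞ → Prop := Good name pts Δ ε k (J + 2) q I (seen l)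
      fun ℓ cs => adaptCost (Near (fun y z =>
        dist (pts (pointOf (J + 2) y)) (pts (pointOf (J + 2) z))) (radius ℓ)) 600 cs k
        (nodes (J + 2) I ℓ) (nodes (J + 2) I' ℓ) (F ℓ) with hG
    have h4 : expect μ (bestBound fun s b => ∃ b', G s b' ∧ b = b' + (1000 * k * (J + 2) : ℕ)) ≤
        expect μ (bestBound G) + (1000 * k * (J + 2) : ℕ) := by
      rw [← expect_add_const]
      exact expect_mono_support fun r _ => bestBound_add_le G _ r.1
    obtain ⟨ν, h5, h6, h7⟩ := Trip.bind (g := announce name u)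
      (R' := Good name pts Δ ε k (J + 2) q' I' (seen (l ++ [u])) F)
      (oracle_functional hinj') (fun r hr => (h2 r hr).imp' (· + _) fun b hb => ⟨b, hb, rfl⟩) h4
      (by
        rintro s b ⟨b', ⟨cen, hR, -, hb'⟩, rfl⟩
        refine (hstep F _ s cen hR).mono ?_ fun s' b hb => ⟨b, le_rfl, hb⟩
        gcongr)
    refine ⟨_, .snoc l u μ ν h1 h5, h6, ?_⟩
    calc _ ≤ _ := h7
      _ ≤ (levelsLaw pts k (J + 2) I' F + (14400 * k * (J + 2) : ℕ) +
          (15400 * k * (J + 2) * l.length : ℕ)) + (1000 * k * (J + 2) : ℕ) := by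
        gcongr
        refine h3.trans ?_
        gcongr
        exact levelsLaw_adaptCost_le hk hII F
      _ = _ := by
        rw [List.length_append, List.length_singleton]
        push_cast
        ring

end Update

/-! ### The number of levels and the final constants -/

theorem exists_two_pow {Δ : ℝ} (hΔ : 1 ≤ Δ) : ∃ J : ℕ, Δ ≤ 2 ^ J ∧ (∀ i < J, (2 : ℝ) ^ i < Δ) ∧
    (J + 2 : ℝ) ≤ 3 * (1 + Real.log Δ) := by
  have hex : ∃ J : ℕ, Δ ≤ 2 ^ J := by
    obtain ⟨J, hJ⟩ := pow_unbounded_of_one_lt Δ (one_lt_two (α := ℝ))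
    exact ⟨J, hJ.le⟩
  classical
  refine ⟨Nat.find hex, Nat.find_spec hex, fun i hi => not_le.1 (Nat.find_min hex hi), ?_⟩
  have hlog := Real.log_nonneg hΔ
  rcases Nat.eq_zero_or_pos (Nat.find hex) with h | h
  · rw [h]
    push_cast
    linarith
  · obtain ⟨i, hi⟩ : ∃ i, Nat.find hex = i + 1 := ⟨_, (Nat.sub_add_cancel h).symm⟩
    -- Minimality of the exponent gives an upper bound on it: `i * log 2 < log Δ`, and `log 2 >
    -- 0.69` makes the factor `3` sufficient for `i + 3` levels.
    have h1 : (2 : ℝ) ^ i < Δ := not_le.1 (Nat.find_min hex (by omega))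
    have h2 := Real.log_le_log (by positivity) h1.le
    rw [Real.log_pow] at h2
    have h3 := Real.log_two_gt_d9
    have h4 : (i : ℝ) * 0.69 ≤ i * Real.log 2 := by
      gcongr
      linarith
    rw [hi]
    push_cast
    linarith

theorem time_le {k J : ℕ} {Δ ε : ℝ} (hΔ : 1 ≤ Δ) (hε : 0 < ε)
    (hJ : (J + 2 : ℝ) ≤ 3 * (1 + Real.log Δ)) (n : ℕ → ℕ) (T : ℕ) :
    ((15400 * k * (J + 2) * T : ℕ) : ℝ≥0∞) ≤ ENNReal.ofReal (∑ t ∈ Finset.range T,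
      100000 * k * (1 + Real.log Δ) * (1 + 1 / ε) * Real.log ((n t : ℝ) + 2) ^ 2) := by
  rw [← ENNReal.ofReal_natCast]
  refine ENNReal.ofReal_le_ofReal ?_
  have hlog := Real.log_nonneg hΔ
  have key : ∀ t ∈ Finset.range T, (15400 * k * (J + 2) : ℝ) ≤
      100000 * k * (1 + Real.log Δ) * (1 + 1 / ε) * Real.log ((n t : ℝ) + 2) ^ 2 := by
    intro t _
    have h1 : Real.log 2 ≤ Real.log ((n t : ℝ) + 2) :=
      Real.log_le_log (by norm_num) (by linarith [Nat.cast_nonneg (α := ℝ) (n t)])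
    have h2 := Real.log_two_gt_d9
    -- The logarithm is never smaller than `log 2`, whose square exceeds 0.47, and 100000 · 0.47
    -- exceeds 3 · 15400.
    have h3 : (0.47 : ℝ) ≤ Real.log ((n t : ℝ) + 2) ^ 2 := by nlinarith
    have h4 : 1 ≤ 1 + 1 / ε := by
      have : 0 < 1 / ε := by positivity
      linarith
    calc (15400 * k * (J + 2) : ℝ) ≤ 15400 * k * (3 * (1 + Real.log Δ)) := by gcongr
      _ ≤ 100000 * k * (1 + Real.log Δ) * 1 * 0.47 := by
        have : 0 ≤ (k : ℝ) * (1 + Real.log Δ) := by positivity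
        nlinarith
      _ ≤ _ := by gcongr
  have := Finset.sum_le_sum key
  rw [Finset.sum_const, Finset.card_range, nsmul_eq_mul] at this
  refine le_trans (le_of_eq ?_) this
  push_cast
  ring

end DynKCenter

theorem mainTheorem2 :
    ∃ (A : DynKCenter.Program) (C : ℝ), 0 < C ∧
      ∀ (k : ℕ) (Δ ε : ℝ), 1 ≤ k → 1 ≤ Δ → 0 < ε →
      ∀ (X : Type*) [MetricSpace X] (name : X → ℕ) (l : List (DynKCenter.Update X)),
        DynKCenter.ValidFrom ∅ l →
        Set.InjOn name (DynKCenter.seen l) →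
        (∀ x ∈ DynKCenter.seen l, ∀ y ∈ DynKCenter.seen l, x ≠ y → 1 ≤ dist x y ∧ dist x y ≤ Δ) →
        ∃ μ : PMF (DynKCenter.State × ℕ),
          DynKCenter.Run A name (DynKCenter.initial k Δ ε) l μ ∧
          (∀ r ∈ μ.support,
            DynKCenter.AnswersWithin name (6 + ε) k (DynKCenter.active l) (DynKCenter.seen l) r.1) ∧
          DynKCenter.expectedTime μ ≤
            ENNReal.ofReal (∑ t ∈ Finset.range l.length,
              C * k * (1 + Real.log Δ) * (1 + 1 / ε) *
                Real.log (((DynKCenter.active (l.take (t + 1))).card : ℝ) + 2) ^ 2) := by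
  refine ⟨DynKCenter.algorithm, 100000, by norm_num, ?_⟩
  intro k Δ ε hk hΔ hε X _ name l hval hinj hd
  obtain ⟨J, hJ, hJ', hJlog⟩ := DynKCenter.exists_two_pow hΔ
  -- The empty sequence is treated separately, because the numbering of the points needs a default
  -- element of `X`.
  cases l with
  | nil =>
    refine ⟨_, .nil, ?_, ?_⟩
    · intro r hr
      rw [PMF.support_pure, Set.mem_singleton_iff] at hr
      subst hr
      simpa [DynKCenter.active] using DynKCenter.answersWithin_initial name (6 + ε) Δ ε k _
    · rw [← DynKCenter.expect_zero, DynKCenter.expect_pure]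
      simp
  | cons u l =>
    obtain ⟨q, I, hsl, hrun⟩ := DynKCenter.exists_run hε hk hJ hJ' hval hinj hd
      -- Numbers start at `1`, and `u.point` only serves as the value outside the range.
      (pts := fun i => (DynKCenter.inserted (u :: l)).getD (i - 1) u.point)
      (fun i hi => by simp [hi]) (u :: l) List.prefix_rfl
    -- With the zero test function the bound controls the expected running time alone.
    obtain ⟨μ, h1, h2, h3⟩ := hrun fun _ _ => 0
    refine ⟨μ, h1, ?_, ?_⟩
    · intro r hr
      obtain ⟨b, cen, -, h4, -⟩ := h2 r hr
      rwa [hsl.image] at h4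
    · refine le_trans ?_ (DynKCenter.time_le (k := k) hΔ hε hJlog
        (fun t => (DynKCenter.active ((u :: l).take (t + 1))).card) (u :: l).length)
      rw [← DynKCenter.expect_zero]
      refine (DynKCenter.expect_mono_support fun r _ => zero_le).trans (h3.trans ?_)
      simp [DynKCenter.levelsLaw, DynKCenter.lawE_const]
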